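/- **Conclusion (CH).** *Creatures.* A creature is a finite tree $(S,\trianglelefteq)$ (least element $\mathrm{root}(S)$, predecessors of a node linearly ordered) whose set $\mathrm{ext}(S)$ of maximal nodes (leaves) is exactly the set of its nodes that are natural numbers, such that for any two incomparable nodes $\eta,\nu$ either $\max[\eta]<\min[\nu]$ or $\max[\nu]<\min[\eta]$; here $\max[\eta],\min[\eta]$ are the largest and smallest leaf $\trianglerighteq\eta$. $\mathrm{int}(S)$ is the set of non-leaves, $\mathrm{succ}_S(\eta)$ the set of direct successors of $\eta$. $S$ is proper if $\mathrm{root}(S)\in\mathrm{int}(S)$, and then $\|S\|=\min\{|\mathrm{succ}_S(\eta)|:\eta\in\mathrm{int}(S)\}$. $T\le S$ means that $T\subseteq S$ carries the induced order, contains $\mathrm{root}(S)$, and $\emptyset\ne\mathrm{succ}_T(\eta)\subseteq\mathrm{succ}_S(\eta)$ for all $\eta\in T\cap\mathrm{int}(S)$. *Zoos.* A zoo is a sequence $s=(S_0,S_1,\dots)$ of pairwise disjoint proper creatures with $\max\mathrm{ext}(S_n)<\min\mathrm{ext}(S_{n+1})$, $\|S_n\|\ge4$ and $\|S_n\|\to\infty$.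 Put $\mathrm{ext}(s)=\bigcup_n\mathrm{ext}(S_n)$, $\mathrm{int}(s)=\bigcup_n\mathrm{int}(S_n)$, $\mathrm{root}(s)=\{\mathrm{root}(S_n):n\in\mathbb N\}$, and identify $s$ with $\bigcup_nS_n$. Write $s=^*t$ if $s$ and $t$ become equal after deleting finitely many initial creatures from each. A gluing recipe is a sequence $r=(R_n)$ of possibly improper creatures with $\max\mathrm{ext}(R_n)<\min\mathrm{ext}(R_{n+1})$ whose norms tend to $\infty$ along the proper $R_n$ (if there are infinitely many). Write $t\leqq s$ if for some gluing recipe $r$ with $\mathrm{int}(r)\cap\mathrm{int}(s)=\emptyset$ and some creatures $S'_k\le S_k$, each $T_n$ arises from $R_n$ by replacing every leaf $k$ of $R_n$ by $S'_k$. Write $t\leqq^*s$ if $t'\leqq s$ for some $t'=^*t$. *Colorings.* A coloring of $s$ is a map with finitely many values defined on the nodes of $s$ (unary), on pairs of nodes of $s$ (binary), or on $\mathrm{ext}(s)$ (branch coloring). If $t\leqq s$, then $t$ is $c$-homogeneous if $c$ is constant on $\mathrm{succ}_t(\eta)$ (resp. on pairs of distinct elements of $\mathrm{succ}_t(\eta)$)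 for every $\eta\in\mathrm{int}(t)\cap s$, resp. if $c$ is constant on $\mathrm{ext}(t)$. And $t$ is almost $c$-homogeneous if some $t'=^*t$ with $t'\leqq s$ is $c$-homogeneous. *Fronts.* A branch of $s$ is a set $\{\eta:\eta\trianglelefteq k\}$ with $k\in\mathrm{ext}(s)$. A *front of $s$ is a set $F\subseteq s$ which meets all but finitely many branches of $s$ in exactly one node. For *fronts of $s$, $F\preccurlyeq^*_sG$ (resp. $F\prec^*_sG$) means that on all but finitely many branches the node in $F$ is $\trianglerighteq$ (resp. strictly above) the node in $G$; $F\approx^*_sG$ means that $F\mathbin{\triangle}G$ is finite. *Generic sequences.* $\vec s=(s_i:i\in\omega_1)$ is sufficiently generic if: (1) $s_j\leqq^*s_i$ for $i<j$; (2) for every $i$ and every coloring $c$ of $s_i$ there is $j>i$ such that $s_j$ is almost $c$-homogeneous; (3) for every $f:\mathbb N\to\mathbb N$ there is $i$ such that, with $s_i=(S_0,S_1,\dots)$, $f(\max\mathrm{ext}(S_n))\le\min\mathrm{ext}(S_{n+1})$ for almost all $n$; (4) for every $i$ there is $j\ge i$ with $\mathrm{root}(s_i)\cap s_j\prec^*_{s_j}\mathrm{root}(s_j)$.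 Let $\mathcal F(\vec s)$ be the set of all sets $F$ that are *fronts of some $s_i$, modulo the relation $F\approx^*G$: $F\cap s_i\approx^*_{s_i}G\cap s_i$ for all large $i$. It is ordered by $F\preccurlyeq^*G$: $F\cap s_i\preccurlyeq^*_{s_i}G\cap s_i$ for all large $i$. *Growth functions.* A growth function is a nondecreasing $f:\mathbb N\to\mathbb N$ with $f(n)>n$ for all $n$. For infinite $A\subseteq\mathbb N$ let $h_A(n)=\min\{a\in A:a>n\}$. For a filter $U$ of infinite sets, $f\le_Ug$ means that for some $A\in U$ and $k\in\mathbb N$, $f$ is pointwise at most the $k$-fold iterate of $\max(g,h_A)$; $f\sim_Ug$ means $f\le_Ug\le_Uf$. *Orders.* Call a linear order a $D_1$-order if it has a least and no largest element, has cardinality $\aleph_1$, has uncountably many elements between any two distinct elements, and for all countable subsets $C\neq\emptyset$ and $C'$ with $C<C'$ (every element of $C$ is less than every element of $C'$) there is $c$ with $C<c<C'$. Call a linear order a $D_2$-order if it has a least and no largest element, every element has a direct successor, every element except the least has a direct predecessor, and its quotient by the relation "the interval between $x$ and $y$ is finite" is a $D_1$-order. *Statement.* Assume CH, let $\vec s=(s_i:i\in\omega_1)$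 be a sufficiently generic sequence of zoos, and let $U$ be the filter on $\mathbb N$ generated by the sets $\mathrm{ext}(s_i)$. Then there is a $D_2$-order $D_2$, every $D_2$-order is isomorphic to it, all members of $U$ are infinite, and: (a) $U$ is an ultrafilter modulo finite sets, i.e. $U$ together with the cofinite sets generates an ultrafilter; (b) $(\mathcal F(\vec s),\preccurlyeq^*)$ is order isomorphic to $D_2$; (c) the set of growth functions modulo $\sim_U$, ordered by $\le_U$, is order isomorphic to $D_2$; (d) if $\langle U\rangle$ is the clone on $\mathbb N$ generated by all finitary operations $g$ with $g(x_1,\dots,x_n)\le\max(x_1,\dots,x_n)$ and all $h_A$, $A\in U$, and $\mathscr O$ is the clone of all finitary operations (of arity $\geq 1$) on $\mathbb N$, then the interval $[\langle U\rangle,\mathscr O]$ in the lattice of clones is order isomorphic to the Dedekind completion of $D_2$ (its nonempty initial segments, ordered by inclusion). -/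

import Mathlib

open Set Filter Cardinal Ordinal

noncomputable section

namespace CloneZoo

/-! ### Trees and creatures -/

/-- Nodes: natural numbers (external nodes) and further objects, labelled by `N` (internal nodes). -/
abbrev Node (N : Type*) := ℕ ⊕ N

/-- A finite tree of nodes. The relation `le` is supported on `carrier`, so that two trees with the
same nodes and the same order are equal. -/
structure FinTree (N : Type*) where
  carrier : Finset (Node N)
  le : Node N → Node N → Prop
  root : Node N
  mem_of_le : ∀ x y, le x y → x ∈ carrier ∧ y ∈ carrier
  le_refl : ∀ x ∈ carrier, le x x
  le_antisymm : ∀ x y, le x y → le y x → x = y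
  le_trans : ∀ x y z, le x y → le y z → le x z
  root_mem : root ∈ carrier
  root_le : ∀ x ∈ carrier, le root x
  linear_below : ∀ x y z, le x z → le y z → le x y ∨ le y x

namespace FinTree

variable {N : Type*} (T : FinTree N)

def lt (x y : Node N) : Prop := T.le x y ∧ x ≠ y

/-- Maximal nodes. -/
def leaf : Set (Node N) := {x | x ∈ T.carrier ∧ ∀ y, T.le x y → y = x}

/-- Nodes that are not maximal. -/
def internal : Set (Node N) := {x | x ∈ T.carrier ∧ x ∉ T.leaf}

/-- Direct successors of a node. -/
def succ (x : Node N) : Set (Node N) := {y | T.lt x y ∧ ¬ ∃ z, T.lt x z ∧ T.lt z y}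

/-- The natural numbers which are nodes at or above `x`. -/
def above (x : Node N) : Set ℕ := {k | T.le x (Sum.inl k)}

/-- `max[x]` -/
def maxAt (x : Node N) : ℕ := sSup (T.above x)

/-- `min[x]` -/
def minAt (x : Node N) : ℕ := sInf (T.above x)

end FinTree

/-- A creature: the leaves are exactly those nodes that are natural numbers, and incomparable nodes
sit over separated sets of leaves. -/
structure Creature (N : Type*) extends FinTree N where
  leaf_iff : ∀ x ∈ carrier, x ∈ toFinTree.leaf ↔ ∃ k : ℕ, x = Sum.inl k
  separated : ∀ x ∈ carrier, ∀ y ∈ carrier, ¬ le x y → ¬ le y x →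
    toFinTree.maxAt x < toFinTree.minAt y ∨ toFinTree.maxAt y < toFinTree.minAt x

namespace Creature

variable {N : Type*} (T : Creature N)

/-- The set of leaves, as a set of natural numbers. -/
def ext : Set ℕ := {k | Sum.inl k ∈ T.carrier}

def maxExt : ℕ := sSup T.ext

def minExt : ℕ := sInf T.ext

def Proper : Prop := T.root ∈ T.internal

/-- The least number of direct successors of an internal node (meaningful for proper creatures). -/
def width : ℕ := sInf {m | ∃ x ∈ T.internal, m = (T.succ x).ncard}

/-- `T` is a subtree of `S`. -/
def Subtree (T S : Creature N) : Prop :=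
  T.carrier ⊆ S.carrier ∧
  (∀ x ∈ T.carrier, ∀ y ∈ T.carrier, T.le x y ↔ S.le x y) ∧
  S.root ∈ T.carrier ∧
  ∀ x ∈ T.carrier, x ∈ S.internal → (T.succ x).Nonempty ∧ T.succ x ⊆ S.succ x

end Creature

/-! ### Zoos -/

structure Zoo (N : Type*) where
  S : ℕ → Creature N
  proper : ∀ n, (S n).Proper
  disjoint : ∀ m n, m ≠ n → Disjoint (S m).carrier (S n).carrier
  ext_lt : ∀ n, (S n).maxExt < (S (n + 1)).minExt
  tendsto_width : Tendsto (fun n => (S n).width) atTop atTop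
  four_le_width : ∀ n, 4 ≤ (S n).width

namespace Zoo

variable {N : Type*} (s : Zoo N)

def nodes : Set (Node N) := {x | ∃ n, x ∈ (s.S n).carrier}

def internal : Set (Node N) := {x | ∃ n, x ∈ (s.S n).internal}

def ext : Set ℕ := {k | ∃ n, k ∈ (s.S n).ext}

def le (x y : Node N) : Prop := ∃ n, (s.S n).le x y

def succ (x : Node N) : Set (Node N) := {y | ∃ n, y ∈ (s.S n).succ x}

/-- The front consisting of all roots. -/
def roots : Set (Node N) := {x | ∃ n, x = (s.S n).root}

/-- The branch of `s` that ends in the leaf `k`. -/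
def branch (k : ℕ) : Set (Node N) := {x | s.le x (Sum.inl k)}

/-- `P` holds for all but finitely many branches; branches are named by their leaves. -/
def AlmostAllBranches (P : ℕ → Prop) : Prop := {k | k ∈ s.ext ∧ ¬ P k}.Finite

/-- `s =* t`: equality after omitting finitely many creatures on each side. -/
def EqStar (s t : Zoo N) : Prop := ∃ n k, ∀ i, s.S (n + i) = t.S (k + i)

end Zoo

/-- A gluing recipe: like a zoo, but improper creatures are allowed. -/
structure GluingRecipe (N : Type*) where
  R : ℕ → Creature N
  ext_lt : ∀ k, (R k).maxExt < (R (k + 1)).minExt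
  tendsto_width : {k | (R k).Proper}.Infinite →
    Tendsto (fun k => (R k).width) (atTop ⊓ 𝓟 {k | (R k).Proper}) atTop

namespace GluingRecipe

variable {N : Type*} (r : GluingRecipe N)

def internal : Set (Node N) := {x | ∃ n, x ∈ (r.R n).internal}

def ext : Set ℕ := {k | ∃ n, k ∈ (r.R n).ext}

end GluingRecipe

namespace Zoo

variable {N : Type*}

/-- `t ≤ s` via the gluing recipe `r`: the zoo `t` arises from `r` by replacing each leaf `k` of `r`
by a subtree `S' k` of the `k`-th creature of `s`. -/
def LEVia (t s : Zoo N) (r : GluingRecipe N) : Prop :=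
  ∃ S' : ℕ → Creature N,
    (∀ k, (S' k).Subtree (s.S k)) ∧
    (∀ k ∈ r.ext, Disjoint r.internal (S' k).internal) ∧
    ∀ n,
      (∀ x, x ∈ (t.S n).carrier ↔
        x ∈ (r.R n).internal ∨ ∃ k ∈ (r.R n).ext, x ∈ (S' k).carrier) ∧
      ∀ x y, (t.S n).le x y ↔
        (x ∈ (r.R n).internal ∧ y ∈ (r.R n).internal ∧ (r.R n).le x y) ∨
        (x ∈ (r.R n).internal ∧ ∃ k, (r.R n).le x (Sum.inl k) ∧ y ∈ (S' k).carrier) ∨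
        ∃ k ∈ (r.R n).ext, (S' k).le x y

/-- `t ≦ s`: in addition no internal node of `s` is recycled as an internal node of the recipe. -/
def LEQ (t s : Zoo N) : Prop :=
  ∃ r : GluingRecipe N, t.LEVia s r ∧ Disjoint r.internal s.internal

/-- `t ≦* s` -/
def LEQStar (t s : Zoo N) : Prop := ∃ t' : Zoo N, t'.EqStar t ∧ t'.LEQ s

/-! ### Colorings

Colorings are taken to be total functions on the ambient sets. This covers partial colorings: extend
them by a further color, or arbitrarily. -/

/-- `t ≦ s` is homogeneous for the unary node coloring `c`. -/
def HomUnary {m : ℕ} (t s : Zoo N) (c : Node N → Fin m) : Prop :=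
  ∀ x ∈ t.internal ∩ s.nodes, ∀ y ∈ t.succ x, ∀ z ∈ t.succ x, c y = c z

/-- `t ≦ s` is homogeneous for the binary node coloring `c`. -/
def HomBinary {m : ℕ} (t s : Zoo N) (c : Sym2 (Node N) → Fin m) : Prop :=
  ∀ x ∈ t.internal ∩ s.nodes,
    ∀ y ∈ t.succ x, ∀ y' ∈ t.succ x, ∀ z ∈ t.succ x, ∀ z' ∈ t.succ x,
      y ≠ y' → z ≠ z' → c s(y, y') = c s(z, z')

/-- `t` is homogeneous for the branch coloring `c`. -/
def HomBranch {m : ℕ} (t : Zoo N) (c : ℕ → Fin m) : Prop :=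
  ∀ k ∈ t.ext, ∀ l ∈ t.ext, c k = c l

def AlmostHomUnary {m : ℕ} (t s : Zoo N) (c : Node N → Fin m) : Prop :=
  ∃ t' : Zoo N, t'.EqStar t ∧ t'.LEQ s ∧ t'.HomUnary s c

def AlmostHomBinary {m : ℕ} (t s : Zoo N) (c : Sym2 (Node N) → Fin m) : Prop :=
  ∃ t' : Zoo N, t'.EqStar t ∧ t'.LEQ s ∧ t'.HomBinary s c

def AlmostHomBranch {m : ℕ} (t s : Zoo N) (c : ℕ → Fin m) : Prop :=
  ∃ t' : Zoo N, t'.EqStar t ∧ t'.LEQ s ∧ t'.HomBranch c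

/-- `s` is almost `f`-strong. -/
def AlmostStrong (s : Zoo N) (f : ℕ → ℕ) : Prop :=
  ∀ᶠ n in atTop, f (s.S n).maxExt ≤ (s.S (n + 1)).minExt

/-! ### Almost fronts and their order -/

/-- `F` is a *front (almost front) in `s`. -/
def IsStarFront (s : Zoo N) (F : Set (Node N)) : Prop :=
  F ⊆ s.nodes ∧ s.AlmostAllBranches fun k => ∃ x, s.branch k ∩ F = {x}

/-- `F ≼* G` in `s`: almost every branch meets `F` at or above the place where it meets `G`. -/
def FrontLE (s : Zoo N) (F G : Set (Node N)) : Prop :=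
  s.AlmostAllBranches fun k =>
    ∃ x y, s.branch k ∩ F = {x} ∧ s.branch k ∩ G = {y} ∧ s.le y x

/-- `F ≺* G` in `s`, which is the same as `F + 1 ≼* G`: almost every branch meets `F` strictly above
the place where it meets `G`. -/
def FrontLT (s : Zoo N) (F G : Set (Node N)) : Prop :=
  s.AlmostAllBranches fun k =>
    ∃ x y, s.branch k ∩ F = {x} ∧ s.branch k ∩ G = {y} ∧ s.le y x ∧ y ≠ x

end Zoo

/-! ### Sufficiently generic sequences and their fronts -/

structure SufficientlyGeneric {N I : Type*} [Preorder I] (s : I → Zoo N) : Prop where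
  decreasing : ∀ i j, i < j → (s j).LEQStar (s i)
  homUnary : ∀ (i : I) (m : ℕ) (c : Node N → Fin m), ∃ j, i < j ∧ (s j).AlmostHomUnary (s i) c
  homBinary : ∀ (i : I) (m : ℕ) (c : Sym2 (Node N) → Fin m),
    ∃ j, i < j ∧ (s j).AlmostHomBinary (s i) c
  homBranch : ∀ (i : I) (m : ℕ) (c : ℕ → Fin m), ∃ j, i < j ∧ (s j).AlmostHomBranch (s i) c
  strong : ∀ f : ℕ → ℕ, ∃ i, (s i).AlmostStrong f
  roots_lt : ∀ i, ∃ j, i ≤ j ∧ (s j).FrontLT ((s i).roots ∩ (s j).nodes) (s j).roots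

/-- The *fronts in a sequence of zoos. -/
def SeqFront {N I : Type*} (s : I → Zoo N) : Type _ :=
  {F : Set (Node N) // ∃ i, (s i).IsStarFront F}

/-- `F ≈* G`: for all large `i`, the traces of `F` and `G` on `s i` differ by a finite set. -/
def seqFrontSetoid {N I : Type*} [Preorder I] (s : I → Zoo N) : Setoid (SeqFront s) where
  r F G := ∀ᶠ i in atTop, (symmDiff (F.1 ∩ (s i).nodes) (G.1 ∩ (s i).nodes)).Finite
  iseqv :=
    { refl := fun F => by simp
      symm := fun {F G} h => by
        filter_upwards [h] with i hi
        rwa [symmDiff_comm]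
      trans := fun {F G H} h₁ h₂ => by
        filter_upwards [h₁, h₂] with i hi₁ hi₂
        exact (hi₁.union hi₂).subset (symmDiff_triangle _ _ _) }

/-- The `≈*`-classes of *fronts in a sequence of zoos. -/
def FrontClasses {N I : Type*} [Preorder I] (s : I → Zoo N) : Type _ := Quotient (seqFrontSetoid s)

/-- Two classes are compared by comparing representatives: `F ≼* G` in `s i` for all large `i`. -/
instance {N I : Type*} [Preorder I] (s : I → Zoo N) : LE (FrontClasses s) where
  le a b := ∃ F G : SeqFront s,
    Quotient.mk (seqFrontSetoid s) F = a ∧ Quotient.mk (seqFrontSetoid s) G = b ∧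
      ∀ᶠ i in atTop, (s i).FrontLE (F.1 ∩ (s i).nodes) (G.1 ∩ (s i).nodes)

/-- The filter generated by the sets of leaves of the zoos of a sequence. -/
def extFilter {N I : Type*} (s : I → Zoo N) : Filter ℕ :=
  Filter.generate (Set.range fun i => (s i).ext)

/-! ### Growth functions modulo a filter -/

structure GrowthFunction where
  toFun : ℕ → ℕ
  mono : Monotone toFun
  lt_apply : ∀ n, n < toFun n

/-- `h_A n` is the least element of `A` above `n` (for infinite `A`). -/
def nextIn (A : Set ℕ) (n : ℕ) : ℕ := sInf {a | a ∈ A ∧ n < a}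

/-- `f ≤_A g`: some iterate of `max g h_A` dominates `f`. -/
def GrowthLE (A : Set ℕ) (f g : GrowthFunction) : Prop :=
  ∃ k : ℕ, ∀ n, f.toFun n ≤ (fun m => max (g.toFun m) (nextIn A m))^[k] n

lemma nextIn_anti {A B : Set ℕ} (hA : A.Infinite) (h : A ⊆ B) (n : ℕ) :
    nextIn B n ≤ nextIn A n := by
  obtain ⟨a, ha, hn⟩ := hA.exists_gt n
  have hm : nextIn A n ∈ {a | a ∈ A ∧ n < a} := Nat.sInf_mem ⟨a, ha, hn⟩
  exact Nat.sInf_le ⟨h hm.1, hm.2⟩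

lemma nextIn_mono {A : Set ℕ} (hA : A.Infinite) : Monotone (nextIn A) := by
  intro m n hmn
  obtain ⟨a, ha, hn⟩ := hA.exists_gt n
  have hm : nextIn A n ∈ {a | a ∈ A ∧ n < a} := Nat.sInf_mem ⟨a, ha, hn⟩
  exact Nat.sInf_le ⟨hm.1, lt_of_le_of_lt hmn hm.2⟩

lemma GrowthLE.refl (A : Set ℕ) (f : GrowthFunction) : GrowthLE A f f :=
  ⟨1, fun _ => le_max_left _ _⟩

lemma GrowthLE.trans {A B : Set ℕ} (hAB : (A ∩ B).Infinite) {f g h : GrowthFunction}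
    (h₁ : GrowthLE A f g) (h₂ : GrowthLE B g h) : GrowthLE (A ∩ B) f h := by
  obtain ⟨k, hk⟩ := h₁
  obtain ⟨l, hl⟩ := h₂
  set φ : ℕ → ℕ := fun m => max (h.toFun m) (nextIn (A ∩ B) m) with hφ
  have φm : Monotone φ := fun _ _ hmn => max_le_max (h.mono hmn) (nextIn_mono hAB hmn)
  have φid : ∀ n, n ≤ φ n := fun n => (h.lt_apply n).le.trans (le_max_left _ _)
  have hB : ∀ n, (fun m => max (h.toFun m) (nextIn B m))^[l] n ≤ φ^[l] n := by
    have hm : Monotone (fun m => max (h.toFun m) (nextIn B m)) := fun m n hmn =>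
      max_le_max (h.mono hmn) (nextIn_mono (hAB.mono inter_subset_right) hmn)
    exact fun n => hm.iterate_le_of_le
      (fun m => max_le_max le_rfl (nextIn_anti hAB inter_subset_right m)) l n
  have hid : ∀ n, n ≤ φ^[l] n := fun n => Function.id_le_iterate_of_id_le φid l n
  have hA : ∀ n, max (g.toFun n) (nextIn A n) ≤ φ^[l + 1] n := by
    intro n
    rw [Function.iterate_succ_apply']
    refine max_le (((hl n).trans (hB n)).trans (φid _)) ?_
    calc nextIn A n ≤ nextIn (A ∩ B) n := nextIn_anti hAB inter_subset_left n
      _ ≤ φ n := le_max_right _ _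
      _ ≤ φ (φ^[l] n) := φm (hid n)
  have hm : Monotone (fun m => max (g.toFun m) (nextIn A m)) := fun m n hmn =>
    max_le_max (g.mono hmn) (nextIn_mono (hAB.mono inter_subset_left) hmn)
  refine ⟨(l + 1) * k, fun n => (hk n).trans ?_⟩
  rw [Function.iterate_mul]
  exact hm.iterate_le_of_le hA k n

/-- Growth functions, to be compared modulo the filter `U` of infinite sets. -/
def GrowthMod (U : Filter ℕ) (_ : ∀ A ∈ U, A.Infinite) : Type := GrowthFunction

/-- `f ≤_U g` iff `f ≤_A g` for some `A ∈ U`. -/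
instance (U : Filter ℕ) (hU : ∀ A ∈ U, A.Infinite) : Preorder (GrowthMod U hU) where
  le f g := ∃ A ∈ U, GrowthLE A f g
  le_refl f := ⟨Set.univ, Filter.univ_mem, GrowthLE.refl _ _⟩
  le_trans _ _ _ := fun ⟨A, hA, h₁⟩ ⟨B, hB, h₂⟩ =>
    ⟨A ∩ B, Filter.inter_mem hA hB, h₁.trans (hU _ (Filter.inter_mem hA hB)) h₂⟩

/-! ### Clones on the natural numbers -/

/-- A clone on `ℕ`; `ops k` is the set of its operations of arity `k + 1`. -/
@[ext]
structure NatClone where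
  ops : ∀ k : ℕ, Set ((Fin (k + 1) → ℕ) → ℕ)
  proj_mem : ∀ k i, (fun x => x i) ∈ ops k
  comp_mem : ∀ k n, ∀ f ∈ ops k, ∀ g : Fin (k + 1) → (Fin (n + 1) → ℕ) → ℕ,
    (∀ i, g i ∈ ops n) → (fun x => f fun i => g i x) ∈ ops n

namespace NatClone

instance : PartialOrder NatClone where
  le C D := ∀ k, C.ops k ⊆ D.ops k
  le_refl _ _ := Subset.rfl
  le_trans _ _ _ h₁ h₂ k := (h₁ k).trans (h₂ k)
  le_antisymm _ _ h₁ h₂ := NatClone.ext (funext fun k => (h₁ k).antisymm (h₂ k))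

/-- The clone of all operations. -/
def full : NatClone where
  ops _ := Set.univ
  proj_mem _ _ := trivial
  comp_mem _ _ _ _ _ _ := trivial

/-- The clone generated by a set of operations. -/
def generatedBy (X : ∀ k : ℕ, Set ((Fin (k + 1) → ℕ) → ℕ)) : NatClone where
  ops k := {f | ∀ C : NatClone, (∀ n, X n ⊆ C.ops n) → f ∈ C.ops k}
  proj_mem k i C _ := C.proj_mem k i
  comp_mem k n f hf g hg C hC := C.comp_mem k n f (hf C hC) g fun i => hg i C hC

/-- The operations bounded by the maximum function. -/
def belowMax (k : ℕ) : Set ((Fin (k + 1) → ℕ) → ℕ) := {g | ∀ x, g x ≤ Finset.univ.sup x}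

/-- The operations `h_A`, `A ∈ U`, which are unary. -/
def nextOps (U : Filter ℕ) (k : ℕ) : Set ((Fin (k + 1) → ℕ) → ℕ) :=
  {g | k = 0 ∧ ∃ A ∈ U, ∀ x, g x = nextIn A (x 0)}

/-- The clone generated by the operations bounded by `max` and by all `h_A`, `A ∈ U`. -/
def ofFilter (U : Filter ℕ) : NatClone := generatedBy fun k => belowMax k ∪ nextOps U k

end NatClone

/-! ### The linear orders `D₁` and `D₂` -/

/-- The properties that characterize `D₁` under CH. -/
structure IsD1 (D : Type*) [LinearOrder D] : Prop where
  exists_bot : ∃ a : D, IsBot a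
  no_top : ∀ x : D, ∃ y, x < y
  card_eq : #D = ℵ₁
  dense : ∀ a b : D, a < b → ¬ (Set.Ioo a b).Countable
  saturated : ∀ C C' : Set D, C.Countable → C'.Countable → C.Nonempty →
    (∀ x ∈ C, ∀ y ∈ C', x < y) → ∃ c, (∀ x ∈ C, x < c) ∧ ∀ y ∈ C', c < y

/-- The properties that characterize `D₂` under CH. The last one says that the quotient of `D` by
the relation "the interval between `x` and `y` is finite" is a linear order as in `IsD1`. -/
structure IsD2.{u} (D : Type u) [LinearOrder D] : Prop where
  exists_bot : ∃ a : D, IsBot a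
  no_top : ∀ x : D, ∃ y, x < y
  exists_succ : ∀ x : D, ∃ y, x ⋖ y
  exists_pred : ∀ x : D, ¬ IsBot x → ∃ y, y ⋖ x
  quotient : ∃ (D₁ : Type u) (_ : LinearOrder D₁) (π : D →o D₁), IsD1 D₁ ∧
    Function.Surjective π ∧ ∀ x y, π x = π y ↔ (Set.uIcc x y).Finite

/-- The Dedekind completion of a linear order: its nonempty initial segments, ordered by
inclusion. -/
def DedekindCompletion (D : Type*) [LinearOrder D] : Type _ :=
  {L : LowerSet D // (L : Set D).Nonempty}

instance (D : Type*) [LinearOrder D] : PartialOrder (DedekindCompletion D) :=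
  inferInstanceAs (PartialOrder {L : LowerSet D // (L : Set D).Nonempty})

end CloneZoo

end

/-!
The whole argument takes place at the leaves. A zoo `s` carries the filter `Zoo.leaves s` of almost
all its leaves, and if `t ≦* s`, then at almost every leaf `k` of `t` the zoo `t` refines `s`: the
nodes of `s` on the branch of `t` below `k` are those of the branch of `s`
(`Zoo.LEQStar.refinesAt`). This is all that is needed to know about gluing recipes and subtrees. By
homogeneity for branch colorings every property of leaves is decided in some later zoo, which yields
the ultrafilter (`exists_ultrafilter_eq`) and makes any two almost fronts comparable
(`Tracked.exists_comparable`).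

Growth functions and almost fronts are connected by the relation `Zoo.Matches`: `f` matches `F` if
an iterate of `f` jumps over the set of leaves above any node of `F`, while `f` does not jump beyond
the next such set. Every almost front is matched by a growth function
(`Zoo.exists_growth_matches`). Conversely, given `f`, take a zoo that is `f`-strong and homogeneous
for `Zoo.growthColoring`. As internal nodes have at least four successors, a node over which `f^[3]`
does not jump has successors across which `f` does not jump
(`Zoo.stepsAcross_of_not_jumpsOver`), so `f` matches the front of the lowest nodes over which
`f^[3]` jumps (`Zoo.matches_growthFront`). If `f` matches `F` and `g` matches `G`, then `f ≤_U g`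
iff `F ≼* G` (`growthLE_iff_seqFrontLE`): if `F` lies strictly below `G`, towards the roots, then
the leaves above a node of `F` fall into more and more parts separated by `G`, because the widths of
the creatures tend to infinity, and `g` needs a step for each part. Hence almost fronts and growth
functions give the same linear order (`nonempty_frontMap`).

That order has a least element (the leaves), predecessors (the direct successors of the nodes of a
front) and successors (the direct predecessors, after homogenizing for membership in the front).
Countable sets `A ≤ B` of fronts are interpolated: since `ω₁` has uncountable cofinality they
live on a common zoo, and there one follows later and later members of `A` on the creatures
(`FrontMap.exists_between`). Under CH these properties give a `D₂`-order
(`isD2_of_interpolation`), and `D₂`-orders are unique by a back-and-forth argument of length `ω₁`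
with countable partial isomorphisms closed under successors and predecessors
(`BackForthData.nonempty_orderIso`).

A clone above the clone of the filter contains an operation iff it contains the growth function that
bounds it (`NatClone.hasGrowth_bound_iff`), so it is determined by an initial segment of classes of
growth functions; as these classes are linearly ordered, every nonempty initial segment arises
(`NatClone.nonempty_interval_orderIso`).
-/

/-! ### Trees, creatures and zoos -/

namespace CloneZoo

namespace FinTree

variable {N : Type*} (T : FinTree N)

open Classical in
/-- The number of nodes at or below `x`, which grows strictly along the tree order. -/
noncomputable def depth (x : Node N) : ℕ := (T.carrier.filter (T.le · x)).card

lemma depth_lt {x y : Node N} (h : T.le x y) (hne : x ≠ y) : T.depth x < T.depth y := by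
  classical
  refine Finset.card_lt_card ⟨fun z hz => ?_, fun hsub => hne ?_⟩
  · simp only [Finset.mem_filter] at hz ⊢
    exact ⟨hz.1, T.le_trans _ _ _ hz.2 h⟩
  · have := hsub (Finset.mem_filter.2 ⟨(T.mem_of_le _ _ h).2, T.le_refl _ (T.mem_of_le _ _ h).2⟩)
    exact T.le_antisymm _ _ h (Finset.mem_filter.1 this).2

lemma exists_maximal_node {P : Node N → Prop} {x : Node N} (hx : x ∈ T.carrier) (hP : P x) :
    ∃ m ∈ T.carrier, P m ∧ ∀ z, P z → T.le m z → z = m := by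
  classical
  obtain ⟨m, hm, hmax⟩ := Finset.exists_max_image (T.carrier.filter P) T.depth
    ⟨x, Finset.mem_filter.2 ⟨hx, hP⟩⟩
  rw [Finset.mem_filter] at hm
  refine ⟨m, hm.1, hm.2, fun z hz hle => ?_⟩
  by_contra hne
  have h1 := hmax z (Finset.mem_filter.2 ⟨(T.mem_of_le _ _ hle).2, hz⟩)
  have h2 := T.depth_lt hle (Ne.symm hne)
  omega

lemma exists_minimal_node {P : Node N → Prop} {x : Node N} (hx : x ∈ T.carrier) (hP : P x) :
    ∃ m ∈ T.carrier, P m ∧ ∀ z, P z → T.le z m → z = m := by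
  classical
  obtain ⟨m, hm, hmin⟩ := Finset.exists_min_image (T.carrier.filter P) T.depth
    ⟨x, Finset.mem_filter.2 ⟨hx, hP⟩⟩
  rw [Finset.mem_filter] at hm
  refine ⟨m, hm.1, hm.2, fun z hz hle => ?_⟩
  by_contra hne
  have h1 := hmin z (Finset.mem_filter.2 ⟨(T.mem_of_le _ _ hle).1, hz⟩)
  have h2 := T.depth_lt hle hne
  omega

lemma above_finite (x : Node N) : (T.above x).Finite := by
  refine Set.Finite.of_finite_image (f := (Sum.inl : ℕ → Node N))
    (T.carrier.finite_toSet.subset ?_) Sum.inl_injective.injOn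
  rintro _ ⟨k, hk, rfl⟩
  exact (T.mem_of_le _ _ hk).2

end FinTree

namespace Creature

variable {N : Type*} (T : Creature N)

lemma exists_leaf {x : Node N} (hx : x ∈ T.carrier) : ∃ k : ℕ, T.le x (Sum.inl k) := by
  obtain ⟨m, hm, hxm, hmax⟩ := T.exists_maximal_node (P := T.le x) hx (T.le_refl x hx)
  obtain ⟨k, rfl⟩ := (T.leaf_iff m hm).1
    ⟨hm, fun y hy => hmax y (T.le_trans _ _ _ hxm hy) hy⟩
  exact ⟨k, hxm⟩

lemma eq_of_inl_le {k : ℕ} {y : Node N} (h : T.le (Sum.inl k) y) : y = Sum.inl k :=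
  ((T.leaf_iff _ (T.mem_of_le _ _ h).1).2 ⟨k, rfl⟩).2 y h

lemma mem_internal_iff {x : Node N} :
    x ∈ T.internal ↔ x ∈ T.carrier ∧ ∀ k : ℕ, x ≠ Sum.inl k := by
  refine and_congr_right fun hx => ?_
  rw [T.leaf_iff x hx, not_exists]

lemma mem_ext_iff {k : ℕ} : k ∈ T.ext ↔ T.le T.root (Sum.inl k) :=
  ⟨fun h => T.root_le _ h, fun h => (T.mem_of_le _ _ h).2⟩

lemma ext_finite : T.ext.Finite :=
  (T.above_finite T.root).subset fun _ hk => T.mem_ext_iff.1 hk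

lemma ext_nonempty : T.ext.Nonempty := by
  obtain ⟨k, hk⟩ := T.exists_leaf T.root_mem
  exact ⟨k, (T.mem_of_le _ _ hk).2⟩

lemma le_maxExt {k : ℕ} (hk : k ∈ T.ext) : k ≤ T.maxExt := le_csSup T.ext_finite.bddAbove hk

lemma minExt_le {k : ℕ} (hk : k ∈ T.ext) : T.minExt ≤ k := Nat.sInf_le hk

lemma maxExt_mem : T.maxExt ∈ T.ext := Nat.sSup_mem T.ext_nonempty T.ext_finite.bddAbove

lemma minExt_mem : T.minExt ∈ T.ext := Nat.sInf_mem T.ext_nonempty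

lemma separated_leaves {x y : Node N} (hx : x ∈ T.carrier) (hy : y ∈ T.carrier)
    (hxy : ¬ T.le x y) (hyx : ¬ T.le y x) {k l k' l' : ℕ} (hk : T.le x (Sum.inl k))
    (hl : T.le y (Sum.inl l)) (hkl : k < l) (hk' : T.le x (Sum.inl k'))
    (hl' : T.le y (Sum.inl l')) : k' < l' := by
  have hmax {z : Node N} {j : ℕ} (h : T.le z (Sum.inl j)) : j ≤ T.maxAt z :=
    le_csSup (T.above_finite z).bddAbove h
  have hmin {z : Node N} {j : ℕ} (h : T.le z (Sum.inl j)) : T.minAt z ≤ j := Nat.sInf_le h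
  rcases T.separated x hx y hy hxy hyx with h | h
  · exact ((hmax hk').trans_lt h).trans_le (hmin hl')
  · have := hmin hk
    have := hmax hl
    omega

/-- A subtree is closed downwards, because it contains the root and its successors are successors
of the large tree. -/
lemma Subtree.mem_of_le {T S : Creature N} (h : T.Subtree S) {x y : Node N} (hy : y ∈ T.carrier)
    (hxy : S.le x y) : x ∈ T.carrier := by
  obtain ⟨hsub, hle, hroot, hsucc⟩ := h
  obtain ⟨z, hz, hzx, hmax⟩ := T.exists_maximal_node (P := fun z => S.le z x) hroot
    (S.root_le _ (S.mem_of_le _ _ hxy).1)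
  by_cases hne : z = x
  · exact hne ▸ hz
  have hzy : S.le z y := S.le_trans _ _ _ hzx hxy
  have hzy' : z ≠ y := by
    rintro rfl
    exact hne (S.le_antisymm _ _ hzx hxy)
  obtain ⟨w, hw, ⟨hzw, hwz, hwy⟩, hmin⟩ := T.exists_minimal_node
    (P := fun w => T.le z w ∧ w ≠ z ∧ S.le w y) hy
    ⟨(hle z hz y hy).2 hzy, hzy'.symm, S.le_refl _ (hsub hy)⟩
  have hwsucc : w ∈ T.succ z := by
    refine ⟨⟨hzw, hwz.symm⟩, ?_⟩
    rintro ⟨v, hzv, hvw⟩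
    have hv := (T.mem_of_le _ _ hvw.1).1
    exact hvw.2 (hmin v ⟨hzv.1, hzv.2.symm, S.le_trans _ _ _ ((hle v hv w hw).1 hvw.1) hwy⟩ hvw.1)
  have hzint : z ∈ S.internal := by
    refine ⟨hsub hz, fun hl => hzy' (hl.2 y hzy).symm⟩
  have hws := (hsucc z hz hzint).2 hwsucc
  rcases S.linear_below _ _ _ hwy hxy with hwx | hxw
  · exact absurd (hmax w hwx hzw) hwz
  · by_cases hxw' : x = w
    · exact hxw' ▸ hw
    · exact absurd ⟨x, ⟨hzx, hne⟩, hxw, hxw'⟩ hws.2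

end Creature

namespace Zoo

variable {N : Type*} {s : Zoo N} {x y z : Node N} {k l : ℕ}

lemma index_unique {m n : ℕ} (hm : x ∈ (s.S m).carrier) (hn : x ∈ (s.S n).carrier) : m = n := by
  by_contra h
  exact Finset.disjoint_left.1 (s.disjoint m n h) hm hn

lemma le_iff_left {n : ℕ} (hx : x ∈ (s.S n).carrier) : s.le x y ↔ (s.S n).le x y := by
  refine ⟨fun ⟨m, hm⟩ => ?_, fun h => ⟨n, h⟩⟩
  rwa [index_unique hx ((s.S m).mem_of_le _ _ hm).1]

lemma le_iff_right {n : ℕ} (hy : y ∈ (s.S n).carrier) : s.le x y ↔ (s.S n).le x y := by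
  refine ⟨fun ⟨m, hm⟩ => ?_, fun h => ⟨n, h⟩⟩
  rwa [index_unique hy ((s.S m).mem_of_le _ _ hm).2]

lemma left_mem (h : s.le x y) : x ∈ s.nodes := h.imp fun _ h => (FinTree.mem_of_le _ _ _ h).1

lemma right_mem (h : s.le x y) : y ∈ s.nodes := h.imp fun _ h => (FinTree.mem_of_le _ _ _ h).2

lemma ext_of_le (h : s.le x (Sum.inl k)) : k ∈ s.ext := right_mem h

lemma le_refl (h : x ∈ s.nodes) : s.le x x := h.imp fun _ h => FinTree.le_refl _ _ h

lemma le_trans (h₁ : s.le x y) (h₂ : s.le y z) : s.le x z := by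
  obtain ⟨n, hn⟩ := h₁
  exact ⟨n, (s.S n).le_trans _ _ _ hn ((le_iff_left ((s.S n).mem_of_le _ _ hn).2).1 h₂)⟩

lemma le_antisymm (h₁ : s.le x y) (h₂ : s.le y x) : x = y := by
  obtain ⟨n, hn⟩ := h₁
  exact (s.S n).le_antisymm _ _ hn ((le_iff_left ((s.S n).mem_of_le _ _ hn).2).1 h₂)

lemma linear_below (h₁ : s.le x z) (h₂ : s.le y z) : s.le x y ∨ s.le y x := by
  obtain ⟨n, hn⟩ := h₁
  have := (le_iff_right ((s.S n).mem_of_le _ _ hn).2).1 h₂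
  exact ((s.S n).linear_below _ _ _ hn this).imp (⟨n, ·⟩) (⟨n, ·⟩)

lemma mem_creature_of_le {n : ℕ} (hx : x ∈ (s.S n).carrier) (h : s.le x y) :
    y ∈ (s.S n).carrier := (FinTree.mem_of_le _ _ _ ((le_iff_left hx).1 h)).2

lemma mem_creature_of_ge {n : ℕ} (hy : y ∈ (s.S n).carrier) (h : s.le x y) :
    x ∈ (s.S n).carrier := (FinTree.mem_of_le _ _ _ ((le_iff_right hy).1 h)).1

lemma exists_leaf (hx : x ∈ s.nodes) : ∃ k, s.le x (Sum.inl k) := by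
  obtain ⟨n, hn⟩ := hx
  exact ((s.S n).exists_leaf hn).imp fun k hk => ⟨n, hk⟩

lemma eq_of_inl_le (h : s.le (Sum.inl k) y) : y = Sum.inl k := by
  obtain ⟨n, hn⟩ := h
  exact (s.S n).eq_of_inl_le hn

lemma mem_succ_iff :
    y ∈ s.succ x ↔ s.le x y ∧ x ≠ y ∧ ∀ z, s.le x z → s.le z y → z = x ∨ z = y := by
  constructor
  · rintro ⟨n, ⟨hle, hne⟩, hmin⟩
    refine ⟨⟨n, hle⟩, hne, fun z hxz hzy => ?_⟩
    by_contra! h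
    rw [le_iff_left ((s.S n).mem_of_le _ _ hle).1] at hxz
    rw [le_iff_right ((s.S n).mem_of_le _ _ hle).2] at hzy
    exact hmin ⟨z, ⟨hxz, h.1.symm⟩, hzy, h.2⟩
  · rintro ⟨⟨n, hle⟩, hne, hmin⟩
    refine ⟨n, ⟨hle, hne⟩, ?_⟩
    rintro ⟨z, hxz, hzy⟩
    rcases hmin z ⟨n, hxz.1⟩ ⟨n, hzy.1⟩ with h | h
    · exact hxz.2 h.symm
    · exact hzy.2 h

lemma le_of_mem_succ (h : y ∈ s.succ x) : s.le x y := (mem_succ_iff.1 h).1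

lemma not_le_of_mem_succ (h : y ∈ s.succ x) : ¬ s.le y x := fun h' =>
  (mem_succ_iff.1 h).2.1 (le_antisymm (mem_succ_iff.1 h).1 h')

lemma eq_of_succ_le (hy : y ∈ s.succ x) (hz : z ∈ s.succ x) (h : s.le y z) : y = z := by
  rcases (mem_succ_iff.1 hz).2.2 y (le_of_mem_succ hy) h with rfl | h
  · exact absurd rfl (mem_succ_iff.1 hy).2.1
  · exact h

lemma eq_of_succ_le_common {w : Node N} (hy : y ∈ s.succ x) (hz : z ∈ s.succ x)
    (h₁ : s.le y w) (h₂ : s.le z w) : y = z := by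
  rcases linear_below h₁ h₂ with h | h
  · exact eq_of_succ_le hy hz h
  · exact (eq_of_succ_le hz hy h).symm

lemma exists_succ_le (h : s.le x y) (hne : x ≠ y) : ∃ z ∈ s.succ x, s.le z y := by
  obtain ⟨n, hn⟩ := h
  have hy := ((s.S n).mem_of_le _ _ hn).2
  obtain ⟨m, hm, ⟨h1, h2, h3⟩, hmin⟩ := (s.S n).exists_minimal_node
    (P := fun z => s.le x z ∧ x ≠ z ∧ s.le z y) hy ⟨⟨n, hn⟩, hne, le_refl ⟨n, hy⟩⟩
  refine ⟨m, mem_succ_iff.2 ⟨h1, h2, fun z hxz hzm => ?_⟩, h3⟩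
  by_cases hz : z = x
  · exact Or.inl hz
  · exact Or.inr (hmin z ⟨hxz, Ne.symm hz, le_trans hzm h3⟩ ((le_iff_right hm).1 hzm))

lemma exists_pred_ge (h : s.le x y) (hne : x ≠ y) : ∃ z, s.le x z ∧ y ∈ s.succ z := by
  obtain ⟨n, hn⟩ := h
  have hx := ((s.S n).mem_of_le _ _ hn).1
  obtain ⟨m, hm, ⟨h1, h2, h3⟩, hmax⟩ := (s.S n).exists_maximal_node
    (P := fun z => s.le x z ∧ z ≠ y ∧ s.le z y) hx ⟨le_refl ⟨n, hx⟩, hne, ⟨n, hn⟩⟩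
  refine ⟨m, h1, mem_succ_iff.2 ⟨h3, h2, fun z hmz hzy => ?_⟩⟩
  by_cases hz : z = y
  · exact Or.inr hz
  · exact Or.inl (hmax z ⟨le_trans h1 hmz, hz, hzy⟩ ((le_iff_left hm).1 hmz))

lemma eq_of_mem_succ_of_mem_succ (hx : z ∈ s.succ x) (hy : z ∈ s.succ y) : x = y := by
  have h1 := mem_succ_iff.1 hx
  have h2 := mem_succ_iff.1 hy
  rcases linear_below h1.1 h2.1 with h | h
  · exact ((h1.2.2 y h h2.1).resolve_right h2.2.1).symm
  · exact (h2.2.2 x h h1.1).resolve_right h1.2.1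

lemma exists_meet (hk : s.le x (Sum.inl k)) (hl : s.le x (Sum.inl l)) :
    ∃ p, s.le p (Sum.inl k) ∧ s.le p (Sum.inl l) ∧
      ∀ q, s.le q (Sum.inl k) → s.le q (Sum.inl l) → s.le q p := by
  obtain ⟨n, hn⟩ := left_mem hk
  obtain ⟨m, hm, ⟨h1, h2⟩, hmax⟩ := (s.S n).exists_maximal_node
    (P := fun z => s.le z (Sum.inl k) ∧ s.le z (Sum.inl l)) hn ⟨hk, hl⟩
  refine ⟨m, h1, h2, fun q hqk hql => ?_⟩
  rcases linear_below hqk h1 with h | h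
  · exact h
  · rw [hmax q ⟨hqk, hql⟩ ((le_iff_left hm).1 h)]
    exact le_refl ⟨n, hm⟩

lemma exists_lowest {P : Node N → Prop} (hx : s.le x y) (hP : P x) :
    ∃ m, s.le m x ∧ P m ∧ ∀ z, s.le z m → P z → z = m := by
  obtain ⟨n, hn⟩ := left_mem hx
  obtain ⟨m, hm, ⟨h1, h2⟩, hmin⟩ := (s.S n).exists_minimal_node
    (P := fun z => s.le z x ∧ P z) hn ⟨le_refl ⟨n, hn⟩, hP⟩
  exact ⟨m, h1, h2, fun z hzm hz => hmin z ⟨le_trans hzm h1, hz⟩ ((le_iff_right hm).1 hzm)⟩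

lemma maxExt_lt_minExt {m n : ℕ} (h : m < n) : (s.S m).maxExt < (s.S n).minExt := by
  induction n, h using Nat.le_induction with
  | base => exact s.ext_lt m
  | succ n _ ih =>
    exact ih.trans_le (((s.S n).minExt_le (s.S n).maxExt_mem).trans (s.ext_lt n).le)

lemma index_lt {m n : ℕ} (hk : k ∈ (s.S m).ext) (hl : l ∈ (s.S n).ext) (h : m < n) : k < l :=
  (((s.S m).le_maxExt hk).trans_lt (maxExt_lt_minExt h)).trans_le ((s.S n).minExt_le hl)

lemma separated_leaves (hxy : ¬ s.le x y) (hyx : ¬ s.le y x) {k' l' : ℕ}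
    (hk : s.le x (Sum.inl k)) (hl : s.le y (Sum.inl l)) (hkl : k < l)
    (hk' : s.le x (Sum.inl k')) (hl' : s.le y (Sum.inl l')) : k' < l' := by
  obtain ⟨m, hm⟩ := left_mem hk
  obtain ⟨n, hn⟩ := left_mem hl
  rcases lt_trichotomy m n with h | rfl | h
  · exact index_lt (mem_creature_of_le hm hk') (mem_creature_of_le hn hl') h
  · rw [le_iff_left hm] at hk hk' hxy
    rw [le_iff_left hn] at hl hl' hyx
    exact (s.S m).separated_leaves hm hn hxy hyx hk hl hkl hk' hl'
  · have := index_lt (mem_creature_of_le hn hl) (mem_creature_of_le hm hk) h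
    omega

/-- The set of leaves above a node is convex in the set of all leaves. -/
lemma le_of_between {j : ℕ} (hk : s.le x (Sum.inl k)) (hl : s.le x (Sum.inl l)) (hj : j ∈ s.ext)
    (hkj : k ≤ j) (hjl : j ≤ l) : s.le x (Sum.inl j) := by
  by_contra h
  have hj' : s.le (Sum.inl j) (Sum.inl j) := le_refl hj
  have hjx : ¬ s.le (Sum.inl j) x := fun h' => h (by rw [eq_of_inl_le h']; exact hj')
  have hkj' : k ≠ j := by rintro rfl; exact h hk
  have := separated_leaves h hjx hk hj' (by omega) hl hj'
  omega

lemma le_minExt (n : ℕ) : n ≤ (s.S n).minExt := by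
  induction n with
  | zero => exact Nat.zero_le _
  | succ n ih =>
    have h := (s.S n).minExt_le (s.S n).maxExt_mem
    exact Nat.succ_le_of_lt ((ih.trans h).trans_lt (s.ext_lt n))

lemma ext_infinite (s : Zoo N) : s.ext.Infinite := by
  refine Set.infinite_of_not_bddAbove fun ⟨b, hb⟩ => ?_
  have h1 := hb ⟨b + 1, (s.S (b + 1)).minExt_mem⟩
  have h2 := le_minExt (s := s) (b + 1)
  omega

lemma width_le_ncard {n : ℕ} (hx : x ∈ (s.S n).carrier) (hk : s.le x (Sum.inl k))
    (hne : x ≠ Sum.inl k) : (s.S n).width ≤ (s.succ x).ncard := by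
  have hint : x ∈ (s.S n).internal := by
    refine (s.S n).mem_internal_iff.2 ⟨hx, fun l hl => hne ?_⟩
    rw [hl] at hk ⊢
    exact (eq_of_inl_le hk).symm
  have : s.succ x = (s.S n).succ x := by
    ext y
    refine ⟨fun ⟨m, hm⟩ => ?_, fun h => ⟨n, h⟩⟩
    rwa [index_unique hx ((s.S m).mem_of_le _ _ hm.1.1).1]
  rw [this]
  exact Nat.sInf_le ⟨x, hint, rfl⟩

/-! ### Almost all leaves -/

/-- The filter on the leaves of `s` that expresses "for almost all leaves". -/
def leaves (s : Zoo N) : Filter ℕ := atTop ⊓ 𝓟 s.ext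

instance : (leaves s).NeBot := by
  rw [leaves, ← Nat.cofinite_eq_atTop]
  exact cofinite_inf_principal_neBot_iff.2 s.ext_infinite

lemma eventually_mem_ext (s : Zoo N) : ∀ᶠ k in s.leaves, k ∈ s.ext :=
  mem_inf_of_right (mem_principal_self _)

lemma leaves_le_atTop (s : Zoo N) : s.leaves ≤ atTop := inf_le_left

lemma eventually_leaves_iff {P : ℕ → Prop} :
    (∀ᶠ k in s.leaves, P k) ↔ ∀ᶠ k in atTop, k ∈ s.ext → P k :=
  eventually_inf_principal

lemma almostAllBranches_iff {P : ℕ → Prop} :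
    s.AlmostAllBranches P ↔ ∀ᶠ k in s.leaves, P k := by
  rw [eventually_leaves_iff, ← Nat.cofinite_eq_atTop, eventually_cofinite, AlmostAllBranches]
  simp only [Classical.not_imp]

/-- Almost all leaves have a property iff in almost all creatures all leaves have it. -/
lemma eventually_leaves_iff_creatures {P : ℕ → Prop} :
    (∀ᶠ k in s.leaves, P k) ↔ ∀ᶠ n in atTop, ∀ k ∈ (s.S n).ext, P k := by
  rw [eventually_leaves_iff, eventually_atTop, eventually_atTop]
  constructor
  · rintro ⟨a, ha⟩
    refine ⟨a, fun n hn k hk => ha k ?_ ⟨n, hk⟩⟩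
    exact (hn.trans (le_minExt n)).trans ((s.S n).minExt_le hk)
  · rintro ⟨a, ha⟩
    refine ⟨(s.S a).minExt, fun k hk ⟨n, hn⟩ => ha n ?_ k hn⟩
    by_contra! h
    have := index_lt hn (s.S a).minExt_mem h
    omega

/-- A property of almost all leaves holds, for almost all leaves, at all leaves of their
creature. -/
lemma eventually_creature {P : ℕ → Prop} (h : ∀ᶠ k in s.leaves, P k) :
    ∀ᶠ k in s.leaves, ∀ x l, s.le x (Sum.inl k) → s.le x (Sum.inl l) → P l := by
  rw [eventually_leaves_iff_creatures] at h ⊢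
  filter_upwards [h] with n hn k hk x l hxk hxl
  exact hn l (mem_creature_of_le (mem_creature_of_ge hk hxk) hxl)

lemma eventually_width (s : Zoo N) (w : ℕ) : ∀ᶠ k in s.leaves, ∀ x, s.le x (Sum.inl k) →
    x ≠ Sum.inl k → w ≤ (s.succ x).ncard := by
  rw [eventually_leaves_iff_creatures]
  filter_upwards [s.tendsto_width.eventually_ge_atTop w] with n hn k hk x hxk hne
  exact hn.trans (width_le_ncard (mem_creature_of_ge hk hxk) hxk hne)

lemma four_le_ncard (hk : s.le x (Sum.inl k)) (hne : x ≠ Sum.inl k) :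
    4 ≤ (s.succ x).ncard := by
  obtain ⟨n, hn⟩ := left_mem hk
  exact (s.four_le_width n).trans (width_le_ncard hn hk hne)

end Zoo

namespace Zoo

variable {N : Type*} {s t : Zoo N} {x y z : Node N} {k l : ℕ}

/-- A node with at least `w` direct successors has `w` leaves above distinct direct successors. -/
lemma exists_leaves_above_succ {w : ℕ} (hw : w ≤ (s.succ x).ncard) :
    ∃ (k : Fin w → ℕ) (y : Fin w → Node N), StrictMono k ∧ Function.Injective y ∧
      ∀ i, y i ∈ s.succ x ∧ s.le (y i) (Sum.inl (k i)) := by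
  classical
  have hleaf : ∀ y ∈ s.succ x, ∃ k, s.le y (Sum.inl k) := fun y hy =>
    exists_leaf (right_mem (le_of_mem_succ hy))
  choose! f hf using hleaf
  have hinj : Set.InjOn f (s.succ x) := fun y hy z hz h =>
    eq_of_succ_le_common hy hz (hf y hy) (h ▸ hf z hz)
  rw [← hinj.ncard_image] at hw
  obtain ⟨F, hF, hcard⟩ : ∃ F : Finset ℕ, (F : Set ℕ) ⊆ f '' s.succ x ∧ F.card = w := by
    rcases Nat.eq_zero_or_pos w with rfl | hpos
    · exact ⟨∅, by simp, rfl⟩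
    have hfin : (f '' s.succ x).Finite := Set.finite_of_ncard_pos (hpos.trans_le hw)
    rw [Set.ncard_eq_toFinset_card _ hfin] at hw
    obtain ⟨F, hF, hc⟩ := Finset.exists_subset_card_eq hw
    exact ⟨F, fun a ha => by simpa using hF ha, hc⟩
  have hmem : ∀ i : Fin w, ∃ y ∈ s.succ x, f y = F.orderEmbOfFin hcard i := fun i =>
    hF (Finset.orderEmbOfFin_mem F hcard i)
  choose y hy hfy using hmem
  refine ⟨F.orderEmbOfFin hcard, y, (F.orderEmbOfFin hcard).strictMono, fun i j h => ?_,
    fun i => ⟨hy i, hfy i ▸ hf _ (hy i)⟩⟩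
  apply (F.orderEmbOfFin hcard).injective
  rw [← hfy i, ← hfy j, h]

/-! ### Refinement of zoos, seen from a leaf -/

/-- At the leaf `k` the zoo `t` refines `s`: `k` is a leaf of `s`, and on the branch of `t` below
`k` the nodes of `s` are exactly those of the branch of `s`, with the same order. -/
def RefinesAt (t s : Zoo N) (k : ℕ) : Prop :=
  k ∈ s.ext ∧ ∀ x ∈ s.nodes, ∀ y, t.le y (Sum.inl k) → (t.le x y ↔ s.le x y)

/-- In the order `≦` the gluing recipe only contributes nodes that are not in `s`. -/
lemma LEQ.refinesAt (h : t.LEQ s) (hk : k ∈ t.ext) : t.RefinesAt s k := by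
  obtain ⟨r, ⟨S', hsub, -, hT⟩, hdisj⟩ := h
  have hR : ∀ n, ∀ x ∈ (r.R n).internal, x ∉ s.nodes := by
    rintro n x hx ⟨m, hm⟩
    have h1 := ((r.R n).mem_internal_iff.1 hx).2
    exact Set.disjoint_left.1 hdisj ⟨n, hx⟩ ⟨m, (s.S m).mem_internal_iff.2 ⟨hm, h1⟩⟩
  have hle : ∀ a x y, (S' a).le x y → s.le x y := fun a x y hxy => by
    have hm := (S' a).mem_of_le _ _ hxy
    exact ⟨a, ((hsub a).2.1 x hm.1 y hm.2).1 hxy⟩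
  refine ⟨?_, fun x hx y hyk => ?_⟩
  · obtain ⟨n, hn⟩ := hk
    rcases ((hT n).1 _).1 hn with h | ⟨a, -, ha⟩
    · exact absurd rfl (((r.R n).mem_internal_iff.1 h).2 k)
    · exact ⟨a, (hsub a).1 ha⟩
  · constructor
    · rintro ⟨n, hn⟩
      rcases ((hT n).2 x y).1 hn with h | h | ⟨a, -, ha⟩
      · exact absurd hx (hR n x h.1)
      · exact absurd hx (hR n x h.1)
      · exact hle a x y ha
    · intro hxy
      obtain ⟨n, hn⟩ := left_mem hyk
      rcases ((hT n).1 y).1 hn with h | ⟨a, ha, hya⟩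
      · exact absurd (right_mem hxy) (hR n y h)
      · have hxy' := (le_iff_right ((hsub a).1 hya)).1 hxy
        have hxa := (hsub a).mem_of_le hya hxy'
        exact ⟨n, ((hT n).2 x y).2
          (Or.inr (Or.inr ⟨a, ha, ((hsub a).2.1 x hxa y hya).2 hxy'⟩))⟩

lemma EqStar.exists_creature_eq {t' : Zoo N} (h : t'.EqStar t) :
    ∀ᶠ n in atTop, ∃ m, t'.S m = t.S n := by
  obtain ⟨a, b, hab⟩ := h
  filter_upwards [eventually_ge_atTop b] with n hn
  exact ⟨a + (n - b), by rw [hab, Nat.add_sub_cancel' hn]⟩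

/-- A property of the leaves that only depends on their creature passes to zoos with the same
tail. -/
lemma EqStar.eventually {t' : Zoo N} (h : t'.EqStar t) {P : Creature N → ℕ → Prop}
    (hP : ∀ m, ∀ k ∈ (t'.S m).ext, P (t'.S m) k) :
    ∀ᶠ k in t.leaves, ∀ n, k ∈ (t.S n).ext → P (t.S n) k := by
  rw [eventually_leaves_iff_creatures]
  filter_upwards [h.exists_creature_eq] with n ⟨m, hm⟩ k hk n' hn'
  rw [← index_unique hk hn', ← hm]
  exact hP m k (hm ▸ hk)

lemma LEQStar.refinesAt (h : t.LEQStar s) : ∀ᶠ k in t.leaves, t.RefinesAt s k := by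
  obtain ⟨t', ht, hs⟩ := h
  refine ((ht.eventually (P := fun T k => k ∈ s.ext ∧
    ∀ x ∈ s.nodes, ∀ y, T.le y (Sum.inl k) → (T.le x y ↔ s.le x y)) ?_).and
    t.eventually_mem_ext).mono ?_
  · intro m k hk
    have := hs.refinesAt ⟨m, hk⟩
    refine ⟨this.1, fun x hx y hy => ?_⟩
    have hyn := ((t'.S m).mem_of_le _ _ hy).1
    rw [← this.2 x hx y ⟨m, hy⟩, le_iff_right hyn]
  · rintro k ⟨hk, n, hn⟩
    refine ⟨(hk n hn).1, fun x hx y hy => ?_⟩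
    have hyn := mem_creature_of_ge hn hy
    rw [le_iff_right hyn]
    exact (hk n hn).2 x hx y ((le_iff_right hn).1 hy)

lemma AlmostHomUnary.eventually {m : ℕ} {c : Node N → Fin m} (h : t.AlmostHomUnary s c) :
    ∀ᶠ k in t.leaves, ∀ x ∈ s.nodes, t.le x (Sum.inl k) → x ≠ Sum.inl k →
      ∀ y ∈ t.succ x, ∀ z ∈ t.succ x, c y = c z := by
  obtain ⟨t', ht, -, hc⟩ := h
  refine ((ht.eventually (P := fun T k => ∀ x ∈ s.nodes,
    T.le x (Sum.inl k) → x ≠ Sum.inl k → ∀ y ∈ T.succ x, ∀ z ∈ T.succ x, c y = c z) ?_).and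
    t.eventually_mem_ext).mono ?_
  · intro a k hk x hx hxk hne y hy z hz
    refine hc x ⟨⟨a, (t'.S a).mem_internal_iff.2
      ⟨((t'.S a).mem_of_le _ _ hxk).1, ?_⟩⟩, hx⟩ y ⟨a, hy⟩ z ⟨a, hz⟩
    rintro l rfl
    exact hne ((t'.S a).eq_of_inl_le hxk).symm
  · rintro k ⟨hk, n, hn⟩ x hx hxk hne y ⟨n₁, hy⟩ z ⟨n₂, hz⟩
    have hxn := mem_creature_of_ge hn hxk
    obtain rfl := index_unique hxn ((t.S n₁).mem_of_le _ _ hy.1.1).1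
    obtain rfl := index_unique hxn ((t.S n₂).mem_of_le _ _ hz.1.1).1
    exact hk _ hn x hx ((le_iff_right hn).1 hxk) hne y hy z hz

lemma AlmostHomBinary.eventually {m : ℕ} {c : Sym2 (Node N) → Fin m}
    (h : t.AlmostHomBinary s c) :
    ∀ᶠ k in t.leaves, ∀ x ∈ s.nodes, t.le x (Sum.inl k) → x ≠ Sum.inl k →
      ∀ y ∈ t.succ x, ∀ y' ∈ t.succ x, ∀ z ∈ t.succ x, ∀ z' ∈ t.succ x, y ≠ y' → z ≠ z' →
        c s(y, y') = c s(z, z') := by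
  obtain ⟨t', ht, -, hc⟩ := h
  refine ((ht.eventually (P := fun T k => ∀ x ∈ s.nodes,
    T.le x (Sum.inl k) → x ≠ Sum.inl k → ∀ y ∈ T.succ x, ∀ y' ∈ T.succ x, ∀ z ∈ T.succ x,
      ∀ z' ∈ T.succ x, y ≠ y' → z ≠ z' → c s(y, y') = c s(z, z')) ?_).and
    t.eventually_mem_ext).mono ?_
  · intro a k hk x hx hxk hne y hy y' hy' z hz z' hz'
    refine hc x ⟨⟨a, (t'.S a).mem_internal_iff.2
      ⟨((t'.S a).mem_of_le _ _ hxk).1, ?_⟩⟩, hx⟩ y ⟨a, hy⟩ y' ⟨a, hy'⟩ z ⟨a, hz⟩ z' ⟨a, hz'⟩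
    rintro l rfl
    exact hne ((t'.S a).eq_of_inl_le hxk).symm
  · rintro k ⟨hk, n, hn⟩ x hx hxk hne y ⟨n₁, hy⟩ y' ⟨n₂, hy'⟩ z ⟨n₃, hz⟩ z' ⟨n₄, hz'⟩
    have hxn := mem_creature_of_ge hn hxk
    obtain rfl := index_unique hxn ((t.S n₁).mem_of_le _ _ hy.1.1).1
    obtain rfl := index_unique hxn ((t.S n₂).mem_of_le _ _ hy'.1.1).1
    obtain rfl := index_unique hxn ((t.S n₃).mem_of_le _ _ hz.1.1).1
    obtain rfl := index_unique hxn ((t.S n₄).mem_of_le _ _ hz'.1.1).1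
    exact hk _ hn x hx ((le_iff_right hn).1 hxk) hne y hy y' hy' z hz z' hz'

lemma AlmostHomBranch.eventually {m : ℕ} {c : ℕ → Fin m} (h : t.AlmostHomBranch s c) :
    ∃ i, ∀ᶠ k in t.leaves, c k = i := by
  obtain ⟨t', ht, -, hc⟩ := h
  obtain ⟨l, hl⟩ := t'.ext_infinite.nonempty
  refine ⟨c l, ?_⟩
  filter_upwards [t.eventually_mem_ext, ht.eventually (P := fun _ k => c k = c l)
    fun m k hk => hc k ⟨m, hk⟩ l hl] with k ⟨n, hn⟩ hk
  exact hk n hn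

/-- Leaves of `s` that do not lie in a common creature are far apart if `s` is almost strong. -/
lemma AlmostStrong.eventually {f : ℕ → ℕ} (hf : Monotone f) (h : s.AlmostStrong f) :
    ∀ᶠ k in s.leaves, ∀ l ∈ s.ext, k < l →
      (¬ ∃ x, s.le x (Sum.inl k) ∧ s.le x (Sum.inl l)) → f k ≤ l := by
  rw [eventually_leaves_iff_creatures]
  filter_upwards [h] with n hn k hk l ⟨m, hl⟩ hkl hno
  have hnm : n < m := by
    rcases lt_trichotomy n m with h | rfl | h
    · exact h
    · exact absurd ⟨(s.S n).root, ⟨n, (s.S n).root_le _ hk⟩, n, (s.S n).root_le _ hl⟩ hno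
    · have := index_lt hl hk h
      omega
  calc f k ≤ f (s.S n).maxExt := hf ((s.S n).le_maxExt hk)
    _ ≤ (s.S (n + 1)).minExt := hn
    _ ≤ (s.S m).minExt := by
      rcases Nat.eq_or_lt_of_le hnm with h | h
      · exact (congrArg (fun i => (s.S i).minExt) h).le
      · exact ((s.S (n + 1)).minExt_le (s.S (n + 1)).maxExt_mem).trans (maxExt_lt_minExt h).le
    _ ≤ l := (s.S m).minExt_le hl

lemma leaves_le_of_LEQStar (h : t.LEQStar s) : t.leaves ≤ s.leaves := by
  refine le_inf t.leaves_le_atTop (le_principal_iff.2 ?_)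
  filter_upwards [h.refinesAt] with k hk using hk.1

end Zoo

/-! ### Iterating growth functions -/

namespace GrowthFunction

lemma le_iterate (f : GrowthFunction) (m n : ℕ) : n ≤ f.toFun^[m] n :=
  Function.id_le_iterate_of_id_le (fun i => (f.lt_apply i).le) m n

/-- The function `max f h_A` whose iterates define `≤_A`. -/
noncomputable def maxNext (f : GrowthFunction) (A : Set ℕ) (n : ℕ) : ℕ :=
  max (f.toFun n) (nextIn A n)

lemma lt_maxNext (f : GrowthFunction) (A : Set ℕ) (n : ℕ) : n < f.maxNext A n :=
  (f.lt_apply n).trans_le (le_max_left _ _)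

lemma maxNext_mono (f : GrowthFunction) {A : Set ℕ} (hA : A.Infinite) : Monotone (f.maxNext A) :=
  fun _ _ h => max_le_max (f.mono h) (nextIn_mono hA h)

lemma add_le_iterate_maxNext (f : GrowthFunction) (A : Set ℕ) (r n : ℕ) :
    n + r ≤ (f.maxNext A)^[r] n := by
  induction r with
  | zero => simp
  | succ r ih =>
    rw [Function.iterate_succ_apply']
    have := f.lt_maxNext A ((f.maxNext A)^[r] n)
    omega

lemma iterate_maxNext_le_of_le (f : GrowthFunction) (A : Set ℕ) {r r' : ℕ} (h : r ≤ r') (n : ℕ) :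
    (f.maxNext A)^[r] n ≤ (f.maxNext A)^[r'] n := by
  obtain ⟨d, rfl⟩ := Nat.exists_eq_add_of_le' h
  rw [Function.iterate_add_apply]
  exact Function.id_le_iterate_of_id_le (fun i => (f.lt_maxNext A i).le) d _

/-- A comparison for large arguments is enough, since iterates also absorb finitely many values. -/
lemma growthLE_of_eventually {A : Set ℕ} {f g : GrowthFunction} {r K : ℕ}
    (h : ∀ n, K ≤ n → f.toFun n ≤ (g.maxNext A)^[r] n) : GrowthLE A f g := by
  refine ⟨max r (f.toFun K), fun n => ?_⟩
  change f.toFun n ≤ (g.maxNext A)^[max r (f.toFun K)] n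
  rcases le_total K n with hn | hn
  · exact (h n hn).trans (g.iterate_maxNext_le_of_le A (le_max_left _ _) n)
  · have h1 := g.add_le_iterate_maxNext A (f.toFun K) n
    have h2 := g.iterate_maxNext_le_of_le A (le_max_right r (f.toFun K)) n
    have h3 := f.mono hn
    omega

/-- The successor function, the least growth function. -/
def succFun : GrowthFunction :=
  ⟨fun n => n + 1, fun _ _ h => Nat.succ_le_succ h, fun n => n.lt_succ_self⟩

end GrowthFunction

lemma nextIn_spec {A : Set ℕ} (hA : A.Infinite) (n : ℕ) : nextIn A n ∈ A ∧ n < nextIn A n := by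
  obtain ⟨a, ha, hn⟩ := hA.exists_gt n
  exact Nat.sInf_mem (s := {a | a ∈ A ∧ n < a}) ⟨a, ha, hn⟩

lemma nextIn_le {A : Set ℕ} {n a : ℕ} (ha : a ∈ A) (h : n < a) : nextIn A n ≤ a :=
  Nat.sInf_le ⟨ha, h⟩

namespace Zoo

variable {N : Type*} {s t : Zoo N} {x y z : Node N} {k l : ℕ} {F G : Set (Node N)}

lemma branch_inter_eq_singleton_iff :
    s.branch k ∩ F = {x} ↔
      (s.le x (Sum.inl k) ∧ x ∈ F) ∧ ∀ y, s.le y (Sum.inl k) → y ∈ F → y = x := by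
  rw [Set.eq_singleton_iff_unique_mem]
  refine and_congr Iff.rfl (forall_congr' fun y => ?_)
  exact ⟨fun h h1 h2 => h ⟨h1, h2⟩, fun h h1 => h h1.1 h1.2⟩

lemma branch_inter_inter_nodes : s.branch k ∩ (F ∩ s.nodes) = s.branch k ∩ F := by
  ext x
  exact ⟨fun h => ⟨h.1, h.2.1⟩, fun h => ⟨h.1, h.2, left_mem h.1⟩⟩

lemma frontLE_iff : s.FrontLE F G ↔ ∀ᶠ k in s.leaves,
    ∃ x y, s.branch k ∩ F = {x} ∧ s.branch k ∩ G = {y} ∧ s.le y x := almostAllBranches_iff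

lemma frontLT_iff : s.FrontLT F G ↔ ∀ᶠ k in s.leaves,
    ∃ x y, s.branch k ∩ F = {x} ∧ s.branch k ∩ G = {y} ∧ s.le y x ∧ y ≠ x := almostAllBranches_iff

lemma frontLE_inter_nodes : s.FrontLE (F ∩ s.nodes) (G ∩ s.nodes) ↔ s.FrontLE F G := by
  simp only [FrontLE, branch_inter_inter_nodes]

lemma FrontLT.frontLE (h : s.FrontLT F G) : s.FrontLE F G := by
  rw [frontLT_iff] at h
  rw [frontLE_iff]
  exact h.mono fun k ⟨x, y, hx, hy, h, _⟩ => ⟨x, y, hx, hy, h⟩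

lemma FrontLT.not_frontLE (h : s.FrontLT F G) : ¬ s.FrontLE G F := by
  rw [frontLT_iff] at h
  rw [frontLE_iff]
  intro h'
  obtain ⟨k, ⟨x, y, hx, hy, hyx, hne⟩, y', x', hy', hx', hxy⟩ := (h.and h').exists
  obtain rfl := Set.singleton_injective (hx.symm.trans hx')
  obtain rfl := Set.singleton_injective (hy.symm.trans hy')
  exact hne (le_antisymm hyx hxy)

lemma eventually_forall_ge {P : ℕ → Prop} (h : ∀ᶠ k in s.leaves, P k) :
    ∀ᶠ k in s.leaves, ∀ l ∈ s.ext, k ≤ l → P l := by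
  rw [eventually_leaves_iff] at h ⊢
  filter_upwards [eventually_forall_ge_atTop.2 h] with k hk _ l hl hkl
  exact hk l hkl hl

lemma exists_threshold {P : ℕ → Prop} (h : ∀ᶠ k in s.leaves, P k) :
    ∃ K, ∀ k ∈ s.ext, K ≤ k → P k := by
  rw [eventually_leaves_iff, eventually_atTop] at h
  exact h.imp fun K hK k hk hKk => hK k hKk hk

lemma RefinesAt.le_iff (h : t.RefinesAt s k) (hx : x ∈ s.nodes) (hy : t.le y (Sum.inl k)) :
    t.le x y ↔ s.le x y := h.2 x hx y hy

lemma RefinesAt.le_leaf_iff (h : t.RefinesAt s k) (hk : k ∈ t.ext) (hx : x ∈ s.nodes) :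
    t.le x (Sum.inl k) ↔ s.le x (Sum.inl k) := h.2 x hx _ (le_refl hk)

lemma RefinesAt.mem_nodes (h : t.RefinesAt s k) (hx : x ∈ s.nodes) (hy : t.le y (Sum.inl k))
    (hxy : t.le x y) : y ∈ s.nodes := right_mem ((h.le_iff hx hy).1 hxy)

/-! ### Growth functions and fronts -/

/-- The growth function `f` matches the set `F` of nodes if, up to finitely many exceptions, some
iterate of `f` jumps over the set of leaves above any node of `F`, while `f` itself does not jump
beyond the next such set. -/
def Matches (t : Zoo N) (f : GrowthFunction) (F : Set (Node N)) : Prop :=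
  (∃ m, ∀ᶠ k in t.leaves, ∀ x ∈ F, t.le x (Sum.inl k) → ∀ l, t.le x (Sum.inl l) →
    l ≤ f.toFun^[m] k) ∧
  ∀ᶠ k in t.leaves, ∀ l ∈ t.ext, k < l →
    (¬ ∃ x ∈ F, t.le x (Sum.inl k) ∧ t.le x (Sum.inl l)) → f.toFun k ≤ l

lemma growthLE_of_frontLE {f g : GrowthFunction} (h : t.FrontLE F G) (hf : t.Matches f F)
    (hg : t.Matches g G) : GrowthLE t.ext f g := by
  obtain ⟨m, hm⟩ := hg.1
  obtain ⟨K, hK⟩ := exists_threshold ((frontLE_iff.1 h).and (hf.2.and hm))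
  refine GrowthFunction.growthLE_of_eventually (K := K) (r := m + 2) fun n hn => ?_
  have hinf := t.ext_infinite
  obtain ⟨hk, hnk⟩ := nextIn_spec hinf n
  set k := nextIn t.ext n with hkdef
  obtain ⟨hl, hkl⟩ := nextIn_spec hinf (g.toFun^[m] k)
  set l := nextIn t.ext (g.toFun^[m] k) with hldef
  obtain ⟨⟨x, y, hx, hy, hyx⟩, h1, h2⟩ := hK k hk (by omega)
  rw [branch_inter_eq_singleton_iff] at hx hy
  have hfl : f.toFun n ≤ l := by
    refine (f.mono hnk.le).trans (h1 l hl ((g.le_iterate m k).trans_lt hkl) ?_)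
    rintro ⟨x', hx'F, hx'k, hx'l⟩
    obtain rfl := hx.2 x' hx'k hx'F
    exact hkl.not_ge (h2 y hy.1.2 hy.1.1 l (le_trans hyx hx'l))
  have hmono := g.maxNext_mono hinf
  calc f.toFun n ≤ l := hfl
    _ ≤ g.maxNext t.ext (g.toFun^[m] k) := le_max_right _ _
    _ ≤ g.maxNext t.ext ((g.maxNext t.ext)^[m] k) :=
      hmono (g.mono.iterate_le_of_le (fun i => le_max_left _ _) m k)
    _ ≤ g.maxNext t.ext ((g.maxNext t.ext)^[m] (g.maxNext t.ext n)) :=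
      hmono (hmono.iterate m (le_max_right _ _))
    _ = (g.maxNext t.ext)^[m + 2] n := by
      rw [← Function.iterate_succ_apply (g.maxNext t.ext),
        ← Function.iterate_succ_apply' (g.maxNext t.ext)]

/-- If the front `F` lies strictly below the front `G`, towards the roots, then every set of leaves
above a node of `F` splits into many such sets for `G`. As `g` needs one step for each of them, no
fixed iterate of `max g h` keeps up with `f`. -/
lemma not_growthLE_of_frontLT {f g : GrowthFunction} (h : t.FrontLT G F) (hf : t.Matches f F)
    (hg : t.Matches g G) (K r : ℕ) : ¬ ∀ n, K ≤ n → f.toFun n ≤ (g.maxNext t.ext)^[r] n := by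
  intro hle
  set φ := g.maxNext t.ext with hφ
  have hinf := t.ext_infinite
  have hmono : Monotone φ := g.maxNext_mono hinf
  obtain ⟨m, hm⟩ := hf.1
  have hiter : ∀ a n, K ≤ n → f.toFun^[a] n ≤ φ^[r * a] n := by
    intro a n hn
    induction a with
    | zero => simp
    | succ a ih =>
      rw [Function.iterate_succ_apply', Nat.mul_succ, Nat.add_comm, Function.iterate_add_apply]
      exact (hle _ (hn.trans (f.le_iterate a n))).trans (hmono.iterate r ih)
  have hev := eventually_creature ((frontLT_iff.1 h).and (hm.and (hg.2.and
    (t.leaves_le_atTop (eventually_ge_atTop K)))))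
  obtain ⟨k, hk, hw, hkm⟩ :=
    (hev.and ((t.eventually_width (r * m + 2)).and t.eventually_mem_ext)).exists
  obtain ⟨⟨y, x, hy, hx, hxy, hne⟩, -⟩ := hk _ k (le_refl hkm) (le_refl hkm)
  rw [branch_inter_eq_singleton_iff] at hy hx
  have hxk : x ≠ Sum.inl k := by
    rintro rfl
    exact hne (eq_of_inl_le hxy).symm
  obtain ⟨a, z, ha, hz, haz⟩ := exists_leaves_above_succ (hw x hx.1.1 hxk)
  have hxa : ∀ i, t.le x (Sum.inl (a i)) := fun i => le_trans (le_of_mem_succ (haz i).1) (haz i).2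
  have hka := fun i => hk x (a i) hx.1.1 (hxa i)
  -- A node of `G` below the leaf `a i` lies above the successor `z i` of `x`.
  have hG : ∀ i, ∀ v ∈ G, t.le v (Sum.inl (a i)) → t.le (z i) v := by
    intro i v hv hvi
    obtain ⟨⟨y', x', hy', hx', hxy', hne'⟩, -⟩ := hka i
    rw [branch_inter_eq_singleton_iff] at hy' hx'
    obtain rfl := hx'.2 x (hxa i) hx.1.2
    obtain rfl := hy'.2 v hvi hv
    rcases linear_below (haz i).2 hvi with h | h
    · exact h
    · rcases (mem_succ_iff.1 (haz i).1).2.2 v hxy' h with h' | h'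
      · exact absurd h'.symm hne'
      · exact h' ▸ le_refl (left_mem hvi)
  have hstep : ∀ i j, i < j → φ (a i) ≤ a j := by
    intro i j hij
    refine max_le ((hka i).2.2.1 (a j) (ext_of_le (hxa j)) (ha hij) ?_)
      (nextIn_le (ext_of_le (hxa j)) (ha hij))
    rintro ⟨v, hv, hvi, hvj⟩
    exact hij.ne (hz (eq_of_succ_le_common (haz i).1 (haz j).1 (hG i v hv hvi) (hG j v hv hvj)))
  have hmany : ∀ i (hi : i < r * m + 2), φ^[i] (a ⟨0, by omega⟩) ≤ a ⟨i, hi⟩ := by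
    intro i
    induction i with
    | zero => exact fun _ => _root_.le_refl _
    | succ i ih =>
      intro hi
      rw [Function.iterate_succ_apply']
      exact (hmono (ih (by omega))).trans (hstep _ _ (by simp))
  have h0 := hka ⟨0, by omega⟩
  have h1 := h0.2.1 x hx.1.2 (hxa _) _ (hxa ⟨r * m + 1, by omega⟩)
  have h2 := hiter m _ h0.2.2.2
  have h3 := hmany (r * m) (by omega)
  have h4 : a ⟨r * m, by omega⟩ < a ⟨r * m + 1, by omega⟩ := ha (by simp)
  omega

lemma exists_growth_matches (t : Zoo N) (F : Set (Node N)) : ∃ f, t.Matches f F := by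
  set B : ℕ → Set ℕ := fun k => {l | ∃ x ∈ F, t.le x (Sum.inl k) ∧ t.le x (Sum.inl l)} with hB
  have hfin : ∀ k, (B k).Finite := by
    intro k
    by_cases hk : k ∈ t.ext
    · obtain ⟨n, hn⟩ := hk
      refine (t.S n).ext_finite.subset ?_
      rintro l ⟨x, -, hxk, hxl⟩
      exact mem_creature_of_le (mem_creature_of_ge hn hxk) hxl
    · refine Set.Finite.subset Set.finite_empty ?_
      rintro l ⟨x, -, hxk, -⟩
      exact hk (ext_of_le hxk)
  have hle : ∀ k, ∀ l ∈ B k, l ≤ sSup (B k) := fun k l hl => le_csSup (hfin k).bddAbove hl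
  let f : GrowthFunction :=
    { toFun := fun n => max (n + 1) ((Finset.range (n + 1)).sup fun k => sSup (B k))
      mono := fun a b hab => max_le_max (Nat.succ_le_succ hab)
        (Finset.sup_mono (Finset.range_mono (Nat.succ_le_succ hab)))
      lt_apply := fun n => (Nat.lt_succ_self n).trans_le (le_max_left _ _) }
  refine ⟨f, ⟨1, Eventually.of_forall fun k x hx hxk l hxl => ?_⟩,
    t.eventually_mem_ext.mono fun k hk l hl hkl hno => ?_⟩
  · rw [Function.iterate_one]
    refine ((hle k l ⟨x, hx, hxk, hxl⟩).trans ?_).trans (le_max_right _ _)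
    exact Finset.le_sup (f := fun k => sSup (B k)) (Finset.mem_range.2 (Nat.lt_succ_self k))
  · refine max_le hkl (Finset.sup_le fun k' hk' => ?_)
    rw [Finset.mem_range] at hk'
    rcases (B k').eq_empty_or_nonempty with he | hne
    · rw [he]
      simp
    · obtain ⟨x, hx, hxk', hxl'⟩ := Nat.sSup_mem hne (hfin k').bddAbove
      by_contra! hlt
      exact hno ⟨x, hx, le_of_between hxk' hxl' hk (by omega) (by omega),
        le_of_between hxk' hxl' hl (by omega) hlt.le⟩

/-- `f` jumps over the node `x` of `s`: it maps every leaf above `x` to an upper bound of the leaves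
above `x`. -/
def JumpsOver (s : Zoo N) (f : ℕ → ℕ) (x : Node N) : Prop :=
  ∀ k l, s.le x (Sum.inl k) → s.le x (Sum.inl l) → l ≤ f k

/-- `f` does not jump beyond the first leaf of one of the nodes `x`, `y` when it starts in the
other one. -/
def StepsAcross (s : Zoo N) (f : ℕ → ℕ) (p : Sym2 (Node N)) : Prop :=
  ∀ x y, p = s(x, y) → ∀ k l, s.le x (Sum.inl k) → s.le y (Sum.inl l) → k < l → f k ≤ l

open Classical in
/-- The coloring of pairs of nodes whose homogeneous zoos make the growth of `f` visible. The colors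
are: `f` does not jump across the pair; it does, and it jumps over both nodes; anything else. -/
noncomputable def growthColoring (s : Zoo N) (f : ℕ → ℕ) (p : Sym2 (Node N)) : Fin 3 :=
  if s.StepsAcross f p then 0 else if ∀ x ∈ p, s.JumpsOver f x then 1 else 2

/-- Let the successors of `x` in `t` be homogeneous for the growth coloring of `s`. If the third
iterate of `f` does not jump over `x`, then `f` does not jump across a successor of `x`. -/
lemma stepsAcross_of_not_jumpsOver {f : GrowthFunction} (hx : x ∈ s.nodes)
    (href : ∀ l, t.le x (Sum.inl l) → t.RefinesAt s l)
    (hhom : ∀ y ∈ t.succ x, ∀ y' ∈ t.succ x, ∀ z ∈ t.succ x, ∀ z' ∈ t.succ x, y ≠ y' → z ≠ z' →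
      s.growthColoring f.toFun s(y, y') = s.growthColoring f.toFun s(z, z'))
    (hj : ¬ t.JumpsOver (f.toFun^[3]) x) :
    ∀ y ∈ t.succ x, ∀ y' ∈ t.succ x, y ≠ y' → s.StepsAcross f.toFun s(y, y') := by
  intro y₀ hy₀ y₀' hy₀' hne₀
  by_contra hbad
  have hc₀ : s.growthColoring f.toFun s(y₀, y₀') ≠ 0 := by
    unfold growthColoring
    rw [if_neg hbad]
    split_ifs <;> simp
  have hbad' : ∀ y ∈ t.succ x, ∀ y' ∈ t.succ x, y ≠ y' → ¬ s.StepsAcross f.toFun s(y, y') := by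
    intro y hy y' hy' hne h
    apply hc₀
    rw [← hhom y hy y' hy' y₀ hy₀ y₀' hy₀' hne hne₀, growthColoring, if_pos h]
  have hle : ∀ y ∈ t.succ x, ∀ l, t.le y (Sum.inl l) → s.le y (Sum.inl l) := by
    intro y hy l hl
    have h := href l (le_trans (le_of_mem_succ hy) hl)
    exact (h.le_leaf_iff (ext_of_le hl) (h.mem_nodes hx hl (le_of_mem_succ hy))).1 hl
  have hincomp : ∀ y ∈ t.succ x, ∀ y' ∈ t.succ x, y ≠ y' → ¬ s.le y y' := by
    intro y hy y' hy' hne h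
    obtain ⟨l, hl⟩ := exists_leaf (right_mem (le_of_mem_succ hy'))
    have hr := href l (le_trans (le_of_mem_succ hy') hl)
    exact hne (eq_of_succ_le hy hy' ((hr.le_iff (left_mem h) hl).2 h))
  have hjump : ∀ a m, a ≤ f.toFun^[m] a := fun a m => f.le_iterate m a
  by_cases hall : ∀ v ∈ s(y₀, y₀'), s.JumpsOver f.toFun v
  · -- `f` jumps over all successors of `x`, and beyond the first leaf of any other successor.
    have hall' : ∀ y ∈ t.succ x, ∀ y' ∈ t.succ x, y ≠ y' → s.JumpsOver f.toFun y := by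
      intro y hy y' hy' hne
      have h := hhom y hy y' hy' y₀ hy₀ y₀' hy₀' hne hne₀
      unfold growthColoring at h
      rw [if_neg hbad, if_neg (hbad' y hy y' hy' hne), if_pos hall] at h
      split_ifs at h with h'
      · exact h' y (by simp)
      · exact absurd h (by decide)
    apply hj
    intro k l hk hl
    rcases le_or_gt l k with hlk | hkl
    · exact hlk.trans (hjump k 3)
    have hxk : x ≠ Sum.inl k := by
      rintro rfl
      have := Sum.inl_injective (eq_of_inl_le hl)
      omega
    have hxl : x ≠ Sum.inl l := by
      rintro rfl
      have := Sum.inl_injective (eq_of_inl_le hk)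
      omega
    obtain ⟨y, hy, hyk⟩ := exists_succ_le hk hxk
    obtain ⟨y', hy', hyl⟩ := exists_succ_le hl hxl
    by_cases hyy : y = y'
    · subst hyy
      have hsm : s.JumpsOver f.toFun y := by
        by_cases h : y = y₀
        · exact hall' y hy y₀' hy₀' (h ▸ hne₀)
        · exact hall' y hy y₀ hy₀ h
      exact (hsm k l (hle y hy k hyk) (hle y hy l hyl)).trans (hjump (f.toFun k) 2)
    · have h := hbad' y hy y' hy' hyy
      unfold StepsAcross at h
      push Not at h
      obtain ⟨a, b, hab, k', l', hk', hl', hkl', hlf⟩ := h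
      rcases Sym2.eq_iff.1 hab with ⟨rfl, rfl⟩ | ⟨rfl, rfl⟩
      · have h1 := hall' y hy y' hy' hyy k k' (hle y hy k hyk) hk'
        have h2 := hall' y' hy' y hy (Ne.symm hyy) l' l hl' (hle y' hy' l hyl)
        exact h2.trans (f.mono (hlf.le.trans (f.mono h1)))
      · have := separated_leaves (hincomp y hy y' hy' hyy) (hincomp y' hy' y hy (Ne.symm hyy))
          (hle y hy k hyk) (hle y' hy' l hyl) hkl hl' hk'
        omega
  · -- At most one successor is jumped over; a middle one that is not yields a contradiction.
    have hall' : ∀ y ∈ t.succ x, ∀ y' ∈ t.succ x, y ≠ y' →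
        ¬ (s.JumpsOver f.toFun y ∧ s.JumpsOver f.toFun y') := by
      intro y hy y' hy' hne ⟨h1, h2⟩
      have h := hhom y hy y' hy' y₀ hy₀ y₀' hy₀' hne hne₀
      unfold growthColoring at h
      rw [if_neg hbad, if_neg (hbad' y hy y' hy' hne), if_neg hall, if_pos] at h
      · exact absurd h (by decide)
      · intro v hv
        rcases Sym2.mem_iff.1 hv with rfl | rfl <;> assumption
    obtain ⟨l, hl⟩ := exists_leaf (right_mem (le_of_mem_succ hy₀))
    have hxl : x ≠ Sum.inl l := by
      rintro rfl
      exact not_le_of_mem_succ hy₀ hl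
    obtain ⟨a, z, ha, hz, haz⟩ :=
      exists_leaves_above_succ (four_le_ncard (le_trans (le_of_mem_succ hy₀) hl) hxl)
    obtain ⟨i, h0i, hi3, hi⟩ : ∃ i : Fin 4, 0 < i ∧ i < 3 ∧ ¬ s.JumpsOver f.toFun (z i) := by
      by_contra! h
      exact hall' (z 1) (haz 1).1 (z 2) (haz 2).1 (hz.ne (by decide))
        ⟨h 1 (by decide) (by decide), h 2 (by decide) (by decide)⟩
    have hsep : ∀ i j : Fin 4, i < j → ∀ k l, s.le (z i) (Sum.inl k) → s.le (z j) (Sum.inl l) →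
        k < l := fun i j hij k l hk hl =>
      separated_leaves (hincomp _ (haz i).1 _ (haz j).1 (hz.ne hij.ne))
        (hincomp _ (haz j).1 _ (haz i).1 (hz.ne hij.ne')) (hle _ (haz i).1 _ (haz i).2)
        (hle _ (haz j).1 _ (haz j).2) (ha hij) hk hl
    have h := hbad' _ (haz 0).1 _ (haz 3).1 (hz.ne (by decide))
    unfold StepsAcross at h
    unfold JumpsOver at hi
    push Not at h hi
    obtain ⟨u, v, huv, k', l', hk', hl', hkl', hlf⟩ := h
    obtain ⟨b, c, hb, hc, hbc⟩ := hi
    rcases Sym2.eq_iff.1 huv with ⟨rfl, rfl⟩ | ⟨rfl, rfl⟩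
    · have h1 := hsep 0 i h0i _ _ hk' hb
      have h2 := hsep i 3 hi3 _ _ hc hl'
      have h3 := f.mono h1.le
      omega
    · have := hsep 0 3 (by decide) _ _ hl' hk'
      omega

/-- The lowest nodes, those nearest to the roots, over which the third iterate of `f` jumps. -/
def growthFront (t : Zoo N) (f : GrowthFunction) : Set (Node N) :=
  {x | x ∈ t.nodes ∧ t.JumpsOver (f.toFun^[3]) x ∧
    ∀ z, t.le z x → t.JumpsOver (f.toFun^[3]) z → z = x}

lemma isStarFront_growthFront (t : Zoo N) (f : GrowthFunction) :
    t.IsStarFront (t.growthFront f) := by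
  refine ⟨fun x hx => hx.1, almostAllBranches_iff.2 (t.eventually_mem_ext.mono fun k hk => ?_)⟩
  have hleaf : t.JumpsOver (f.toFun^[3]) (Sum.inl k) := by
    intro a b ha hb
    obtain rfl := Sum.inl_injective (eq_of_inl_le ha)
    obtain rfl := Sum.inl_injective (eq_of_inl_le hb)
    exact f.le_iterate 3 b
  obtain ⟨m, hmk, hm, hmin⟩ := exists_lowest (le_refl hk) hleaf
  refine ⟨m, branch_inter_eq_singleton_iff.2 ⟨⟨hmk, left_mem hmk, hm, hmin⟩, ?_⟩⟩
  rintro y hyk ⟨hy, hyj, hymin⟩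
  rcases linear_below hyk hmk with h | h
  · exact hmin y h hyj
  · exact (hymin m h hm).symm

/-- A growth function matches the front of the lowest nodes over which its third iterate jumps, in
a zoo that is homogeneous for its growth coloring. -/
lemma matches_growthFront {f : GrowthFunction} (hs : s.AlmostStrong f.toFun)
    (hle : t.LEQStar s) (hc : t.AlmostHomBinary s (s.growthColoring f.toFun)) :
    t.Matches f (t.growthFront f) := by
  refine ⟨⟨3, Eventually.of_forall fun k x hx hxk l hxl => hx.2.1 k l hxk hxl⟩, ?_⟩
  have href := hle.refinesAt
  filter_upwards [t.eventually_mem_ext, eventually_forall_ge href, eventually_creature href,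
    hc.eventually, leaves_le_of_LEQStar hle (hs.eventually f.mono)]
    with k hkt h1 h2 h3 h4 l hl hkl hno
  have hrk := h1 k hkt (_root_.le_refl k)
  have hrl := h1 l hl hkl.le
  by_cases hcom : ∃ x, s.le x (Sum.inl k) ∧ s.le x (Sum.inl l)
  swap
  · exact h4 l hrl.1 hkl hcom
  obtain ⟨ρ, hρk, hρl⟩ := hcom
  have hρ := left_mem hρk
  have hρk' := (hrk.le_leaf_iff hkt hρ).2 hρk
  obtain ⟨p, hpk, hpl, hmax⟩ := exists_meet hρk' ((hrl.le_leaf_iff hl hρ).2 hρl)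
  have hρp := hmax ρ hρk' ((hrl.le_leaf_iff hl hρ).2 hρl)
  have hp := hrk.mem_nodes hρ hpk hρp
  have hpk' : p ≠ Sum.inl k := by
    rintro rfl
    have := Sum.inl_injective (eq_of_inl_le hpl)
    omega
  have hpl' : p ≠ Sum.inl l := by
    rintro rfl
    have := Sum.inl_injective (eq_of_inl_le hpk)
    omega
  have hpj : ¬ t.JumpsOver (f.toFun^[3]) p := by
    intro hj
    obtain ⟨m, hmp, hm, hmin⟩ := exists_lowest hpk hj
    exact hno ⟨m, ⟨left_mem hmp, hm, hmin⟩, le_trans hmp hpk, le_trans hmp hpl⟩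
  obtain ⟨y, hy, hyk⟩ := exists_succ_le hpk hpk'
  obtain ⟨y', hy', hyl⟩ := exists_succ_le hpl hpl'
  have hne : y ≠ y' := by
    rintro rfl
    exact not_le_of_mem_succ hy (hmax y hyk hyl)
  have hsucc := stepsAcross_of_not_jumpsOver hp (fun l hl => h2 p l hpk hl) (h3 p hp hpk hpk') hpj
    y hy y' hy' hne
  have hy1 := hrk.mem_nodes hp hyk (le_of_mem_succ hy)
  have hy2 := hrl.mem_nodes hp hyl (le_of_mem_succ hy')
  exact hsucc y y' rfl k l ((hrk.le_leaf_iff hkt hy1).1 hyk) ((hrl.le_leaf_iff hl hy2).1 hyl) hkl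

end Zoo

/-! ### Generic sequences: fronts -/

variable {N I : Type*} [LinearOrder I] {s : I → Zoo N} {F G : Set (Node N)} {i j : I}

namespace SufficientlyGeneric

lemma refinesAt (hs : SufficientlyGeneric s) (hij : i ≤ j) :
    ∀ᶠ k in (s j).leaves, (s j).RefinesAt (s i) k := by
  rcases hij.eq_or_lt with rfl | h
  · exact (s i).eventually_mem_ext.mono fun k hk => ⟨hk, fun _ _ _ _ => Iff.rfl⟩
  · exact (hs.decreasing i j h).refinesAt

lemma leaves_anti (hs : SufficientlyGeneric s) (hij : i ≤ j) : (s j).leaves ≤ (s i).leaves := by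
  rcases hij.eq_or_lt with rfl | h
  · exact le_rfl
  · exact Zoo.leaves_le_of_LEQStar (hs.decreasing i j h)

/-- Every property of leaves is decided by some later zoo. -/
lemma exists_decides (hs : SufficientlyGeneric s) (i : I) (P : ℕ → Prop) :
    ∃ j, i < j ∧ ((∀ᶠ k in (s j).leaves, P k) ∨ ∀ᶠ k in (s j).leaves, ¬ P k) := by
  classical
  obtain ⟨j, hij, hj⟩ := hs.homBranch i 2 fun k => if P k then 0 else 1
  refine ⟨j, hij, ?_⟩
  obtain ⟨c, hc⟩ := hj.eventually
  by_cases h : c = 0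
  · left
    filter_upwards [hc] with k hk
    by_contra hP
    rw [if_neg hP, h] at hk
    exact absurd hk (by decide)
  · right
    filter_upwards [hc] with k hk hP
    rw [if_pos hP] at hk
    exact h hk.symm

end SufficientlyGeneric

/-- `F` is an almost front of `s j` coming from some `s i` with `i ≤ j`; its nodes need not all be
nodes of `s j`. -/
def Tracked (s : I → Zoo N) (F : Set (Node N)) (j : I) : Prop :=
  (∃ i ≤ j, F ⊆ (s i).nodes) ∧ ∀ᶠ k in (s j).leaves, ∃ x, (s j).branch k ∩ F = {x}

lemma tracked_of_isStarFront (h : (s i).IsStarFront F) : Tracked s F i :=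
  ⟨⟨i, le_rfl, h.1⟩, Zoo.almostAllBranches_iff.1 h.2⟩

lemma Tracked.le_iff (h : Tracked s F i) (hs : SufficientlyGeneric s) (hij : i ≤ j) :
    ∀ᶠ k in (s j).leaves, ∀ x ∈ F, (s j).le x (Sum.inl k) ↔ (s i).le x (Sum.inl k) := by
  obtain ⟨⟨a, ha, hF⟩, -⟩ := h
  filter_upwards [(s j).eventually_mem_ext, hs.refinesAt (ha.trans hij),
    hs.leaves_anti hij (hs.refinesAt ha), hs.leaves_anti hij (s i).eventually_mem_ext]
    with k hk h1 h2 hk' x hx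
  rw [h1.le_leaf_iff hk (hF hx), h2.le_leaf_iff hk' (hF hx)]

lemma Tracked.branch_eq (h : Tracked s F i) (hs : SufficientlyGeneric s) (hij : i ≤ j) :
    ∀ᶠ k in (s j).leaves, (s j).branch k ∩ F = (s i).branch k ∩ F := by
  filter_upwards [h.le_iff hs hij] with k hk
  ext x
  exact and_congr_left fun hx => hk x hx

lemma Tracked.mono (h : Tracked s F i) (hs : SufficientlyGeneric s) (hij : i ≤ j) :
    Tracked s F j := by
  refine ⟨h.1.imp fun a ha => ⟨ha.1.trans hij, ha.2⟩, ?_⟩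
  filter_upwards [h.branch_eq hs hij, hs.leaves_anti hij h.2] with k h1 h2
  rwa [h1]

lemma Tracked.frontLE_refl (h : Tracked s F i) : (s i).FrontLE F F := by
  refine Zoo.frontLE_iff.2 (h.2.mono fun k ⟨x, hx⟩ => ⟨x, x, hx, hx, ?_⟩)
  exact Zoo.le_refl (Zoo.left_mem (Zoo.branch_inter_eq_singleton_iff.1 hx).1.1)

lemma Tracked.le_of_le (hF : Tracked s F i) (hG : Tracked s G i) (hs : SufficientlyGeneric s)
    (hij : i ≤ j) : ∀ᶠ k in (s j).leaves, ∀ x y, (s i).branch k ∩ F = {x} →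
      (s i).branch k ∩ G = {y} → (s i).le y x →
      (s j).branch k ∩ F = {x} ∧ (s j).branch k ∩ G = {y} ∧ (s j).le y x := by
  filter_upwards [hF.branch_eq hs hij, hG.branch_eq hs hij, hs.refinesAt hij]
    with k h1 h2 h3 x y hx hy hyx
  rw [← h1] at hx
  rw [← h2] at hy
  refine ⟨hx, hy, (h3.le_iff (Zoo.left_mem hyx) ?_).2 hyx⟩
  exact (Zoo.branch_inter_eq_singleton_iff.1 hx).1.1

lemma Tracked.frontLE_mono (hF : Tracked s F i) (hG : Tracked s G i) (hs : SufficientlyGeneric s)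
    (hij : i ≤ j) (h : (s i).FrontLE F G) : (s j).FrontLE F G := by
  rw [Zoo.frontLE_iff] at h ⊢
  filter_upwards [hF.le_of_le hG hs hij, hs.leaves_anti hij h] with k h1 ⟨x, y, hx, hy, hyx⟩
  exact ⟨x, y, h1 x y hx hy hyx⟩

lemma Tracked.frontLT_mono (hF : Tracked s F i) (hG : Tracked s G i) (hs : SufficientlyGeneric s)
    (hij : i ≤ j) (h : (s i).FrontLT F G) : (s j).FrontLT F G := by
  rw [Zoo.frontLT_iff] at h ⊢
  filter_upwards [hF.le_of_le hG hs hij, hs.leaves_anti hij h] with k h1 ⟨x, y, hx, hy, hyx, hne⟩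
  obtain ⟨h2, h3, h4⟩ := h1 x y hx hy hyx
  exact ⟨x, y, h2, h3, h4, hne⟩

lemma Tracked.matches_mono {f : GrowthFunction} (hF : Tracked s F i) (hs : SufficientlyGeneric s)
    (hij : i ≤ j) (h : (s i).Matches f F) : (s j).Matches f F := by
  obtain ⟨⟨m, hm⟩, h2⟩ := h
  have hle := Zoo.eventually_forall_ge (hF.le_iff hs hij)
  refine ⟨⟨m, ?_⟩, ?_⟩
  · filter_upwards [(s j).eventually_mem_ext, hle, hs.leaves_anti hij hm]
      with k hk h1 h2 x hx hxk l hxl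
    rcases le_or_gt l k with hlk | hkl
    · exact hlk.trans (f.le_iterate m k)
    · exact h2 x hx ((h1 k hk le_rfl x hx).1 hxk) l
        ((h1 l (Zoo.ext_of_le hxl) hkl.le x hx).1 hxl)
  · filter_upwards [(s j).eventually_mem_ext, hle, hs.leaves_anti hij h2,
      Zoo.eventually_forall_ge (hs.refinesAt hij)] with k hk h1 h2 h3 l hl hkl hno
    refine h2 l (h3 l hl hkl.le).1 hkl ?_
    rintro ⟨x, hx, hxk, hxl⟩
    exact hno ⟨x, hx, (h1 k hk le_rfl x hx).2 hxk, (h1 l hl hkl.le x hx).2 hxl⟩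

/-- Any two almost fronts become comparable in some later zoo. -/
lemma Tracked.exists_comparable (hF : Tracked s F i) (hG : Tracked s G i)
    (hs : SufficientlyGeneric s) :
    ∃ j, i < j ∧ ((s j).FrontLE F G ∨ (s j).FrontLT G F) := by
  obtain ⟨j, hij, h⟩ := hs.exists_decides i fun k =>
    ∃ x y, (s i).branch k ∩ F = {x} ∧ (s i).branch k ∩ G = {y} ∧ (s i).le y x
  refine ⟨j, hij, h.imp (fun h => ?_) fun h => ?_⟩
  · rw [Zoo.frontLE_iff]
    filter_upwards [hF.le_of_le hG hs hij.le, h] with k h1 ⟨x, y, hx, hy, hyx⟩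
    exact ⟨x, y, h1 x y hx hy hyx⟩
  · rw [Zoo.frontLT_iff]
    filter_upwards [hG.le_of_le hF hs hij.le, h, hs.leaves_anti hij.le hF.2,
      hs.leaves_anti hij.le hG.2] with k h1 h2 ⟨x, hx⟩ ⟨y, hy⟩
    have hyx : ¬ (s i).le y x := fun h => h2 ⟨x, y, hx, hy, h⟩
    have hxy : (s i).le x y := (Zoo.linear_below (Zoo.branch_inter_eq_singleton_iff.1 hx).1.1
      (Zoo.branch_inter_eq_singleton_iff.1 hy).1.1).resolve_right hyx
    obtain ⟨h3, h4, h5⟩ := h1 y x hy hx hxy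
    refine ⟨y, x, h3, h4, h5, ?_⟩
    rintro rfl
    exact hyx hxy

/-- `F ≼* G` in almost all zoos of the sequence. -/
def SeqFrontLE (s : I → Zoo N) (F G : Set (Node N)) : Prop :=
  ∀ᶠ i in atTop, (s i).FrontLE F G

lemma seqFrontLE_of_frontLE (hs : SufficientlyGeneric s) (hF : Tracked s F i)
    (hG : Tracked s G i) (h : (s i).FrontLE F G) : SeqFrontLE s F G :=
  (eventually_ge_atTop i).mono fun _ hij => hF.frontLE_mono hG hs hij h

section Growth

/-! ### Generic sequences: growth functions -/

lemma eventually_of_mem_extFilter (hs : SufficientlyGeneric s) {A : Set ℕ}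
    (hA : A ∈ extFilter s) : ∀ᶠ j in atTop, ∀ᶠ k in (s j).leaves, k ∈ A := by
  induction hA with
  | basic h =>
    obtain ⟨i, rfl⟩ := h
    filter_upwards [eventually_ge_atTop i] with j hij
    exact hs.leaves_anti hij (s i).eventually_mem_ext
  | univ => exact Eventually.of_forall fun _ => univ_mem
  | superset _ hsub ih => exact ih.mono fun _ h => h.mono fun _ hk => hsub hk
  | inter _ _ ih₁ ih₂ => exact (ih₁.and ih₂).mono fun _ h => h.1.and h.2

lemma ext_mem_extFilter {J : Type*} (s : J → Zoo N) (i : J) : (s i).ext ∈ extFilter s :=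
  Filter.GenerateSets.basic ⟨i, rfl⟩

lemma exists_front_matches (hs : SufficientlyGeneric s) (f : GrowthFunction) :
    ∃ i F, (s i).IsStarFront F ∧ (s i).Matches f F := by
  obtain ⟨i, hi⟩ := hs.strong f.toFun
  obtain ⟨j, hij, hj⟩ := hs.homBinary i 3 ((s i).growthColoring f.toFun)
  exact ⟨j, _, Zoo.isStarFront_growthFront _ f,
    Zoo.matches_growthFront hi (hs.decreasing i j hij) hj⟩

variable [Nonempty I]

lemma infinite_of_mem_extFilter (hs : SufficientlyGeneric s) (A : Set ℕ)
    (hA : A ∈ extFilter s) : A.Infinite := by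
  obtain ⟨j, hj⟩ := (eventually_of_mem_extFilter hs hA).exists
  exact Nat.frequently_atTop_iff_infinite.1 (hj.frequently.filter_mono (s j).leaves_le_atTop)

/-- The leaves of the zoos of a generic sequence generate an ultrafilter modulo finite sets. -/
lemma exists_ultrafilter_eq (hs : SufficientlyGeneric s) :
    ∃ V : Ultrafilter ℕ, (V : Filter ℕ) = extFilter s ⊓ cofinite := by
  have hle : ∀ i, extFilter s ⊓ cofinite ≤ (s i).leaves := fun i => by
    rw [Nat.cofinite_eq_atTop, inf_comm]
    exact inf_le_inf_left _ (le_principal_iff.2 (ext_mem_extFilter s i))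
  have hne : (extFilter s ⊓ cofinite).NeBot := by
    refine inf_neBot_iff.2 fun A hA C hC => ?_
    have := (infinite_of_mem_extFilter hs A hA).sdiff (mem_cofinite.1 hC)
    exact this.nonempty.mono fun k hk => ⟨hk.1, not_not.1 hk.2⟩
  refine ⟨Ultrafilter.ofComplNotMemIff _ fun A => ⟨fun h => ?_, fun h h' => ?_⟩, rfl⟩
  · obtain ⟨i⟩ := ‹Nonempty I›
    obtain ⟨j, -, hj | hj⟩ := hs.exists_decides i (· ∈ A)
    · exact hle j hj
    · exact absurd (hle j hj) h
  · exact hne.ne (empty_mem_iff_bot.1 (by simpa using inter_mem h h'))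

lemma growthLE_iff_seqFrontLE (hs : SufficientlyGeneric s) {f g : GrowthFunction}
    (hF : Tracked s F i) (hG : Tracked s G i) (hf : (s i).Matches f F) (hg : (s i).Matches g G) :
    (∃ A ∈ extFilter s, GrowthLE A f g) ↔ SeqFrontLE s F G := by
  constructor
  · rintro ⟨A, hA, r, hr⟩
    obtain ⟨j, hij, h | h⟩ := hF.exists_comparable hG hs
    · exact seqFrontLE_of_frontLE hs (hF.mono hs hij.le) (hG.mono hs hij.le) h
    exfalso
    obtain ⟨a, hAa, hja⟩ :=
      ((eventually_of_mem_extFilter hs hA).and (eventually_ge_atTop j)).exists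
    have hia := hij.le.trans hja
    obtain ⟨K, hK⟩ := Zoo.exists_threshold hAa
    refine Zoo.not_growthLE_of_frontLT
      ((hG.mono hs hij.le).frontLT_mono (hF.mono hs hij.le) hs hja h)
      (hF.matches_mono hs hia hf) (hG.matches_mono hs hia hg) K r fun n hn => (hr n).trans ?_
    -- Above `K` the set `A` contains all leaves of `s a`, so `h_A` is at most their `h`.
    have hinf := (s a).ext_infinite
    have hstep : ∀ b, K ≤ b → max (g.toFun b) (nextIn A b) ≤ g.maxNext (s a).ext b := by
      intro b hb
      obtain ⟨h1, h2⟩ := nextIn_spec hinf b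
      exact max_le_max le_rfl (nextIn_le (hK _ h1 (by omega)) h2)
    have : ∀ c, (fun b => max (g.toFun b) (nextIn A b))^[c] n ≤ (g.maxNext (s a).ext)^[c] n := by
      intro c
      induction c with
      | zero => exact le_rfl
      | succ c ih =>
        rw [Function.iterate_succ_apply', Function.iterate_succ_apply']
        have hn' : K ≤ (fun b => max (g.toFun b) (nextIn A b))^[c] n :=
          hn.trans (Function.id_le_iterate_of_id_le
            (fun b => (g.lt_apply b).le.trans (le_max_left _ _)) c n)
        exact (hstep _ hn').trans (g.maxNext_mono hinf ih)
    exact this r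
  · intro h
    obtain ⟨j, hj, hij⟩ := (h.and (eventually_ge_atTop i)).exists
    exact ⟨_, ext_mem_extFilter s j, Zoo.growthLE_of_frontLE hj (hF.matches_mono hs hij hf)
      (hG.matches_mono hs hij hg)⟩

end Growth

/-! ### The order of almost fronts -/

namespace Zoo

variable {N : Type*} {s : Zoo N} {F G H : Set (Node N)} {k : ℕ}

lemma FrontLE.trans_frontLT (h₁ : s.FrontLE F G) (h₂ : s.FrontLT G H) : s.FrontLT F H := by
  rw [frontLE_iff] at h₁
  rw [frontLT_iff] at h₂ ⊢
  filter_upwards [h₁, h₂] with k ⟨x, y, hx, hy, hyx⟩ ⟨y', z, hy', hz, hzy, hne⟩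
  obtain rfl := Set.singleton_injective (hy.symm.trans hy')
  refine ⟨x, z, hx, hz, le_trans hzy hyx, ?_⟩
  rintro rfl
  exact hne (le_antisymm hzy hyx)

lemma branch_inter_roots {n : ℕ} (hk : k ∈ (s.S n).ext) :
    s.branch k ∩ s.roots = {(s.S n).root} := by
  refine branch_inter_eq_singleton_iff.2 ⟨⟨⟨n, (s.S n).root_le _ hk⟩, n, rfl⟩, ?_⟩
  rintro _ hy ⟨m, rfl⟩
  rw [index_unique (mem_creature_of_ge hk hy) (s.S m).root_mem]

lemma isStarFront_roots (s : Zoo N) : s.IsStarFront s.roots := by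
  refine ⟨?_, almostAllBranches_iff.2 (s.eventually_mem_ext.mono fun k ⟨n, hk⟩ =>
    ⟨_, branch_inter_roots hk⟩)⟩
  rintro _ ⟨n, rfl⟩
  exact ⟨n, (s.S n).root_mem⟩

lemma frontLE_roots (h : ∀ᶠ k in s.leaves, ∃ x, s.branch k ∩ F = {x}) : s.FrontLE F s.roots := by
  rw [frontLE_iff]
  filter_upwards [h, s.eventually_mem_ext] with k ⟨x, hx⟩ ⟨n, hn⟩
  refine ⟨x, _, hx, branch_inter_roots hn, n, (s.S n).root_le _ ?_⟩
  exact mem_creature_of_ge hn (branch_inter_eq_singleton_iff.1 hx).1.1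

/-- The front consisting of all leaves. -/
def leafFront (s : Zoo N) : Set (Node N) := Sum.inl '' s.ext

lemma branch_inter_leafFront (hk : k ∈ s.ext) : s.branch k ∩ s.leafFront = {Sum.inl k} := by
  refine branch_inter_eq_singleton_iff.2 ⟨⟨le_refl hk, k, hk, rfl⟩, ?_⟩
  rintro _ hy ⟨l, -, rfl⟩
  exact (eq_of_inl_le hy).symm

lemma isStarFront_leafFront (s : Zoo N) : s.IsStarFront s.leafFront := by
  refine ⟨?_, almostAllBranches_iff.2 (s.eventually_mem_ext.mono fun k hk =>
    ⟨_, branch_inter_leafFront hk⟩)⟩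
  rintro _ ⟨k, hk, rfl⟩
  exact hk

lemma branch_finite (s : Zoo N) (k : ℕ) : (s.branch k).Finite := by
  by_cases hk : k ∈ s.ext
  · obtain ⟨n, hn⟩ := hk
    exact (s.S n).carrier.finite_toSet.subset fun x hx => mem_creature_of_ge hn hx
  · exact Set.finite_empty.subset fun x hx => hk (ext_of_le hx)

lemma leaves_above_finite (s : Zoo N) (x : Node N) : {k | s.le x (Sum.inl k)}.Finite := by
  by_cases hx : x ∈ s.nodes
  · obtain ⟨n, hn⟩ := hx
    exact (s.S n).ext_finite.subset fun k hk => mem_creature_of_le hn hk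
  · exact Set.finite_empty.subset fun k hk => hx (left_mem hk)

/-- Almost fronts are equal modulo a finite set iff they meet almost every branch in the same
node. -/
lemma symmDiff_finite_iff (hF : F ⊆ s.nodes) (hG : G ⊆ s.nodes) :
    (symmDiff F G).Finite ↔ ∀ᶠ k in s.leaves, s.branch k ∩ F = s.branch k ∩ G := by
  constructor
  · intro h
    have hbad : (⋃ x ∈ symmDiff F G, {k | s.le x (Sum.inl k)}).Finite :=
      h.biUnion fun x _ => s.leaves_above_finite x
    rw [eventually_leaves_iff, ← Nat.cofinite_eq_atTop]
    filter_upwards [hbad.compl_mem_cofinite] with k hk _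
    simp only [mem_compl_iff, mem_iUnion, not_exists] at hk
    ext x
    refine and_congr_right fun hx => ?_
    have := fun h => hk x h hx
    rw [Set.mem_symmDiff] at this
    tauto
  · intro h
    rw [eventually_leaves_iff, ← Nat.cofinite_eq_atTop, eventually_cofinite] at h
    refine (h.biUnion fun k _ => s.branch_finite k).subset fun x hx => ?_
    have hxs : x ∈ s.nodes := hx.elim (fun h => hF h.1) fun h => hG h.1
    obtain ⟨k, hk⟩ := exists_leaf hxs
    refine mem_biUnion (x := k) (fun heq => ?_) hk
    have h1 : x ∈ F ↔ x ∈ G := by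
      have := Set.ext_iff.1 (heq (ext_of_le hk)) x
      exact ⟨fun h => (this.1 ⟨hk, h⟩).2, fun h => (this.2 ⟨hk, h⟩).2⟩
    rw [Set.mem_symmDiff] at hx
    tauto

end Zoo

variable {N I : Type*} [LinearOrder I] {s : I → Zoo N}

/-- An almost front of one of the zoos, as an almost front of the sequence. -/
def SeqFront.of {F : Set (Node N)} {i : I} (h : (s i).IsStarFront F) : SeqFront s := ⟨F, i, h⟩

lemma SeqFront.eventually_tracked (F : SeqFront s) (hs : SufficientlyGeneric s) :
    ∀ᶠ j in atTop, Tracked s F.1 j := by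
  obtain ⟨i, hi⟩ := F.2
  filter_upwards [eventually_ge_atTop i] with j hij
  exact (tracked_of_isStarFront hi).mono hs hij

lemma eventually_forall_nat [Nonempty I] (hI : ∀ u : ℕ → I, ∃ j, ∀ n, u n ≤ j) {P : ℕ → I → Prop}
    (h : ∀ n, ∀ᶠ j in atTop, P n j) : ∀ᶠ j in atTop, ∀ n, P n j := by
  simp only [eventually_atTop] at h ⊢
  choose u hu using h
  obtain ⟨a, ha⟩ := hI u
  exact ⟨a, fun j hj n => hu n j ((ha n).trans hj)⟩

/-- An order-preserving and order-reflecting map from the almost fronts onto a linear order. -/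
structure FrontMap (s : I → Zoo N) (D : Type*) [LinearOrder D] where
  toFun : SeqFront s → D
  surjective : Function.Surjective toFun
  le_iff : ∀ F G, toFun F ≤ toFun G ↔ SeqFrontLE s F.1 G.1

namespace FrontMap

variable {D : Type*} [LinearOrder D]

lemma setoid_iff (φ : FrontMap s D) (hs : SufficientlyGeneric s) (F G : SeqFront s) :
    (seqFrontSetoid s).r F G ↔ φ.toFun F = φ.toFun G := by
  have hsymm : ∀ j, (symmDiff (F.1 ∩ (s j).nodes) (G.1 ∩ (s j).nodes)).Finite ↔
      ∀ᶠ k in (s j).leaves, (s j).branch k ∩ F.1 = (s j).branch k ∩ G.1 := fun j => by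
    rw [Zoo.symmDiff_finite_iff inter_subset_right inter_subset_right]
    simp only [Zoo.branch_inter_inter_nodes]
  change (∀ᶠ j in atTop, (symmDiff (F.1 ∩ (s j).nodes) (G.1 ∩ (s j).nodes)).Finite) ↔ _
  simp only [hsymm]
  rw [le_antisymm_iff, φ.le_iff, φ.le_iff, SeqFrontLE, SeqFrontLE, ← eventually_and]
  refine eventually_congr ?_
  filter_upwards [F.eventually_tracked hs, G.eventually_tracked hs] with j hF hG
  rw [Zoo.frontLE_iff, Zoo.frontLE_iff, ← eventually_and]
  refine eventually_congr ?_
  filter_upwards [hF.2, hG.2] with k ⟨x, hx⟩ ⟨y, hy⟩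
  constructor
  · intro h
    obtain rfl := Set.singleton_injective ((hx.symm.trans h).trans hy)
    have := Zoo.le_refl (Zoo.left_mem (Zoo.branch_inter_eq_singleton_iff.1 hx).1.1)
    exact ⟨⟨x, x, hx, hy, this⟩, x, x, hy, hx, this⟩
  · rintro ⟨⟨x₁, y₁, hx₁, hy₁, h₁⟩, y₂, x₂, hy₂, hx₂, h₂⟩
    obtain rfl := Set.singleton_injective (hx₁.symm.trans hx₂)
    obtain rfl := Set.singleton_injective (hy₁.symm.trans hy₂)
    rw [hx₁, hy₁, Zoo.le_antisymm h₁ h₂]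

/-- The map of a `FrontMap` induces an order isomorphism on the classes of almost fronts. -/
lemma nonempty_orderIso (φ : FrontMap s D) (hs : SufficientlyGeneric s) :
    Nonempty (FrontClasses s ≃o D) := by
  let f : FrontClasses s → D := Quotient.lift (s := seqFrontSetoid s) φ.toFun
    fun F G h => (φ.setoid_iff hs F G).1 h
  have hf : Function.Bijective f := by
    refine ⟨?_, fun d => (φ.surjective d).elim fun F hF => ⟨Quotient.mk _ F, hF⟩⟩
    rintro ⟨F⟩ ⟨G⟩ h
    exact Quotient.sound (s := seqFrontSetoid s) ((φ.setoid_iff hs F G).2 h)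
  refine ⟨⟨Equiv.ofBijective f hf, ?_⟩⟩
  rintro ⟨F⟩ ⟨G⟩
  change φ.toFun F ≤ φ.toFun G ↔ _
  constructor
  · intro h
    refine ⟨F, G, rfl, rfl, ((φ.le_iff F G).1 h).mono fun j hj => ?_⟩
    exact Zoo.frontLE_inter_nodes.2 hj
  · rintro ⟨F', G', hF, hG, h⟩
    have h1 := (φ.setoid_iff hs F' F).1 (Quotient.exact (s := seqFrontSetoid s) hF)
    have h2 := (φ.setoid_iff hs G' G).1 (Quotient.exact (s := seqFrontSetoid s) hG)
    rw [← h1, ← h2, φ.le_iff]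
    exact h.mono fun j hj => Zoo.frontLE_inter_nodes.1 hj

variable [Nonempty I]

lemma lt_iff (φ : FrontMap s D) (hs : SufficientlyGeneric s) (F G : SeqFront s) :
    φ.toFun F < φ.toFun G ↔ ∀ᶠ j in atTop, (s j).FrontLT F.1 G.1 := by
  rw [← not_le, φ.le_iff]
  constructor
  · intro h
    obtain ⟨i, hF, hG⟩ := ((F.eventually_tracked hs).and (G.eventually_tracked hs)).exists
    obtain ⟨j, hij, hle | hlt⟩ := hG.exists_comparable hF hs
    · exact absurd (seqFrontLE_of_frontLE hs (hG.mono hs hij.le) (hF.mono hs hij.le) hle) h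
    · exact (eventually_ge_atTop j).mono fun a ha =>
        (hF.mono hs hij.le).frontLT_mono (hG.mono hs hij.le) hs ha hlt
  · intro h h'
    obtain ⟨j, hj, hj'⟩ := (h.and h').exists
    exact hj.not_frontLE hj'

lemma covBy (φ : FrontMap s D) (hs : SufficientlyGeneric s) {F G : SeqFront s} {i : I}
    (hF : Tracked s F.1 i)
    (hG : Tracked s G.1 i) (h : ∀ᶠ k in (s i).leaves, ∃ x p, (s i).branch k ∩ F.1 = {x} ∧
      (s i).branch k ∩ G.1 = {p} ∧ x ∈ (s i).succ p) : φ.toFun F ⋖ φ.toFun G := by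
  have hlt : (s i).FrontLT F.1 G.1 := by
    rw [Zoo.frontLT_iff]
    filter_upwards [h] with k ⟨x, p, hx, hp, hxp⟩
    exact ⟨x, p, hx, hp, (Zoo.mem_succ_iff.1 hxp).1, (Zoo.mem_succ_iff.1 hxp).2.1⟩
  refine ⟨(φ.lt_iff hs F G).2 ((eventually_ge_atTop i).mono fun a ha =>
    hF.frontLT_mono hG hs ha hlt), fun d hFd hdG => ?_⟩
  obtain ⟨H, rfl⟩ := φ.surjective d
  rw [φ.lt_iff hs] at hFd hdG
  obtain ⟨j, h1, h2, hij⟩ := (hFd.and (hdG.and (eventually_ge_atTop i))).exists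
  rw [Zoo.frontLT_iff] at h1 h2
  obtain ⟨k, ⟨x, p, hx, hp, hxp⟩, ⟨x', y, hx', hy, hyx, hne⟩, ⟨y', p', hy', hp', hpy, hne'⟩,
    hFk, hGk, href⟩ := ((h.filter_mono (hs.leaves_anti hij)).and
      (h1.and (h2.and ((hF.branch_eq hs hij).and
      ((hG.branch_eq hs hij).and (hs.refinesAt hij)))))).exists
  obtain rfl := Set.singleton_injective (hy.symm.trans hy')
  obtain rfl := Set.singleton_injective (hx'.symm.trans (hFk.trans hx))
  obtain rfl := Set.singleton_injective (hp'.symm.trans (hGk.trans hp))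
  have hxk := (Zoo.branch_inter_eq_singleton_iff.1 hx').1.1
  have hpy' := (href.le_iff (Zoo.left_mem (Zoo.le_of_mem_succ hxp)) (Zoo.le_trans hyx hxk)).1 hpy
  have hyx' := (href.le_iff (Zoo.right_mem hpy') hxk).1 hyx
  rcases (Zoo.mem_succ_iff.1 hxp).2.2 y hpy' hyx' with h | h
  · exact hne' h.symm
  · exact hne h

lemma exists_isBot (φ : FrontMap s D) (hs : SufficientlyGeneric s) :
    ∃ i, IsBot (φ.toFun (.of (Zoo.isStarFront_leafFront (s i)))) := by
  obtain ⟨i⟩ := ‹Nonempty I›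
  refine ⟨i, fun d => ?_⟩
  obtain ⟨F, rfl⟩ := φ.surjective d
  rw [φ.le_iff]
  obtain ⟨j, hF, hij⟩ := ((F.eventually_tracked hs).and (eventually_ge_atTop i)).exists
  have hL := tracked_of_isStarFront (Zoo.isStarFront_leafFront (s i))
  refine seqFrontLE_of_frontLE hs (hL.mono hs hij) hF ?_
  rw [Zoo.frontLE_iff]
  filter_upwards [hF.2, hL.branch_eq hs hij, hs.leaves_anti hij (s i).eventually_mem_ext]
    with k ⟨y, hy⟩ h1 h2
  exact ⟨_, y, h1.trans (Zoo.branch_inter_leafFront h2), hy,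
    (Zoo.branch_inter_eq_singleton_iff.1 hy).1.1⟩

/-- The predecessor of an almost front without leaves consists of the direct successors of its
nodes. -/
lemma exists_pred (φ : FrontMap s D) (hs : SufficientlyGeneric s) (d : D) (hd : ¬ IsBot d) :
    ∃ e, e ⋖ d := by
  obtain ⟨F, rfl⟩ := φ.surjective d
  obtain ⟨i, hi⟩ := φ.exists_isBot hs
  have hlt := lt_of_le_of_ne (hi (φ.toFun F)) fun h => hd (h ▸ hi)
  rw [φ.lt_iff hs] at hlt
  obtain ⟨j, hj, hF, hij⟩ :=
    (hlt.and ((F.eventually_tracked hs).and (eventually_ge_atTop i))).exists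
  have hL := tracked_of_isStarFront (Zoo.isStarFront_leafFront (s i))
  set G : Set (Node N) := {y | ∃ x ∈ F.1, y ∈ (s j).succ x} with hG
  have hev : ∀ᶠ k in (s j).leaves, ∃ y x, (s j).branch k ∩ G = {y} ∧
      (s j).branch k ∩ F.1 = {x} ∧ y ∈ (s j).succ x := by
    rw [Zoo.frontLT_iff] at hj
    filter_upwards [hj, hL.branch_eq hs hij, hs.leaves_anti hij (s i).eventually_mem_ext]
      with k ⟨l, x, hl, hx, hxl, hne⟩ h1 h2
    obtain rfl := Set.singleton_injective (hl.symm.trans (h1.trans (Zoo.branch_inter_leafFront h2)))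
    obtain ⟨y, hy, hyk⟩ := Zoo.exists_succ_le hxl hne
    refine ⟨y, x, ?_, hx, hy⟩
    rw [Zoo.branch_inter_eq_singleton_iff] at hx ⊢
    refine ⟨⟨hyk, x, hx.1.2, hy⟩, ?_⟩
    rintro y' hy'k ⟨x', hx', hy'⟩
    obtain rfl := hx.2 x' (Zoo.le_trans (Zoo.le_of_mem_succ hy') hy'k) hx'
    exact Zoo.eq_of_succ_le_common hy' hy hy'k hyk
  have hGs : (s j).IsStarFront G := by
    refine ⟨?_, Zoo.almostAllBranches_iff.2 (hev.mono fun k ⟨y, _, hy, _⟩ => ⟨y, hy⟩)⟩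
    rintro y ⟨x, -, hy⟩
    exact Zoo.right_mem (Zoo.le_of_mem_succ hy)
  exact ⟨_, φ.covBy hs (F := .of hGs) (tracked_of_isStarFront hGs) hF hev⟩

/-- In a zoo that is homogeneous for membership in `F`, the direct predecessors of the nodes of `F`
form an almost front, the successor of `F`. -/
lemma exists_succ (φ : FrontMap s D) (hs : SufficientlyGeneric s) (d : D) : ∃ e, d ⋖ e := by
  classical
  obtain ⟨F, rfl⟩ := φ.surjective d
  obtain ⟨i, hi⟩ := F.2
  have hFi := tracked_of_isStarFront hi
  obtain ⟨j, hij, hj⟩ := hs.roots_lt i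
  have hR := tracked_of_isStarFront (Zoo.isStarFront_roots (s i))
  have hlt : (s j).FrontLT F.1 (s j).roots := by
    refine (hFi.frontLE_mono hR hs hij (Zoo.frontLE_roots hFi.2)).trans_frontLT ?_
    simpa only [Zoo.FrontLT, Zoo.branch_inter_inter_nodes] using hj
  obtain ⟨a, hja, ha⟩ := hs.homUnary j 2 fun x => if x ∈ F.1 then 1 else 0
  have hFj := hFi.mono hs hij
  set G : Set (Node N) := {p | p ∈ (s j).nodes ∧ ∃ y ∈ F.1, y ∈ (s a).succ p} with hG
  have hev : ∀ᶠ k in (s a).leaves, ∃ x p, (s a).branch k ∩ F.1 = {x} ∧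
      (s a).branch k ∩ G = {p} ∧ x ∈ (s a).succ p := by
    rw [Zoo.frontLT_iff] at hlt
    filter_upwards [ha.eventually, hs.refinesAt hja.le, hFj.branch_eq hs hja.le,
      hs.leaves_anti hja.le hlt] with k hhom href hFk ⟨x, ρ, hx, hρ, hρx, hne⟩
    have hx' := Zoo.branch_inter_eq_singleton_iff.1 (hFk.trans hx)
    obtain ⟨p, hρp, hxp⟩ := Zoo.exists_pred_ge
      ((href.le_iff (Zoo.left_mem hρx) hx'.1.1).2 hρx) hne
    have hpk := Zoo.le_trans (Zoo.le_of_mem_succ hxp) hx'.1.1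
    refine ⟨x, p, hFk.trans hx, Zoo.branch_inter_eq_singleton_iff.2
      ⟨⟨hpk, href.mem_nodes (Zoo.left_mem hρx) hpk hρp, x, hx'.1.2, hxp⟩, ?_⟩, hxp⟩
    rintro p' hp'k ⟨hp', y, hyF, hyp'⟩
    have hne' : p' ≠ Sum.inl k := by
      rintro rfl
      have h1 := Zoo.mem_succ_iff.1 hyp'
      exact h1.2.1 (Zoo.eq_of_inl_le h1.1).symm
    obtain ⟨z, hz, hzk⟩ := Zoo.exists_succ_le hp'k hne'
    have hcol := hhom p' hp' hp'k hne' y hyp' z hz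
    have hzF : z ∈ F.1 := by
      by_contra hzF
      rw [if_pos hyF, if_neg hzF] at hcol
      exact absurd hcol (by decide)
    obtain rfl := hx'.2 z hzk hzF
    exact Zoo.eq_of_mem_succ_of_mem_succ hz hxp
  have hGs : (s a).IsStarFront G := by
    refine ⟨?_, Zoo.almostAllBranches_iff.2 (hev.mono fun k ⟨_, p, _, hp, _⟩ => ⟨p, hp⟩)⟩
    rintro p ⟨-, y, -, hy⟩
    exact Zoo.left_mem (Zoo.le_of_mem_succ hy)
  exact ⟨_, φ.covBy hs (G := .of hGs) (hFj.mono hs hja.le) (tracked_of_isStarFront hGs) hev⟩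

/-- Countably many almost fronts have an upper bound: the roots of a late zoo. -/
lemma exists_upper_bound (φ : FrontMap s D) (hs : SufficientlyGeneric s)
    (hI : ∀ u : ℕ → I, ∃ j, ∀ n, u n ≤ j)
    (a : ℕ → D) : ∃ d, ∀ n, a n ≤ d := by
  choose F hF using fun n => φ.surjective (a n)
  obtain ⟨j, hj⟩ := (eventually_forall_nat hI fun n => (F n).eventually_tracked hs).exists
  refine ⟨φ.toFun (.of (Zoo.isStarFront_roots (s j))), fun n => ?_⟩
  rw [← hF n, φ.le_iff]
  exact seqFrontLE_of_frontLE hs (hj n) (tracked_of_isStarFront (Zoo.isStarFront_roots _))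
    (Zoo.frontLE_roots (hj n).2)

/-- An increasing sequence of almost fronts `F n` below all `G m` is interpolated by a set that
follows later and later `F n` on the creatures of a late zoo. -/
lemma exists_between_seq (φ : FrontMap s D) (hs : SufficientlyGeneric s)
    (hI : ∀ u : ℕ → I, ∃ j, ∀ n, u n ≤ j)
    {a b : ℕ → D} (ha : Monotone a) (hab : ∀ m n, a m ≤ b n) :
    ∃ d, (∀ n, a n ≤ d) ∧ ∀ n, d ≤ b n := by
  classical
  choose F hF using fun n => φ.surjective (a n)
  choose G hG using fun n => φ.surjective (b n)
  have hFF : ∀ m n, m ≤ n → SeqFrontLE s (F m).1 (F n).1 := fun m n h => by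
    rw [← φ.le_iff, hF, hF]
    exact ha h
  have hFG : ∀ m n, SeqFrontLE s (F m).1 (G n).1 := fun m n => by
    rw [← φ.le_iff, hF, hG]
    exact hab m n
  obtain ⟨j, hj⟩ := (eventually_forall_nat hI fun n => (((F n).eventually_tracked hs).and
    ((G n).eventually_tracked hs)).and (eventually_forall_nat hI fun m =>
      (hFG n m).and (eventually_all.2 (hFF n m)))).exists
  set t := s j with ht
  let R (A B : Set (Node N)) (k : ℕ) : Prop :=
    ∃ x y, t.branch k ∩ A = {x} ∧ t.branch k ∩ B = {y} ∧ t.le y x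
  let P (m n : ℕ) : Prop :=
    ∀ c ≤ m, ∀ k ∈ (t.S n).ext, R (F c).1 (F m).1 k ∧ R (F m).1 (G c).1 k
  have hP : ∀ m, ∀ᶠ n in atTop, P m n := by
    intro m
    have : ∀ c ∈ Finset.range (m + 1), ∀ᶠ n in atTop, ∀ k ∈ (t.S n).ext,
        R (F c).1 (F m).1 k ∧ R (F m).1 (G c).1 k := by
      intro c hc
      rw [← Zoo.eventually_leaves_iff_creatures]
      exact (Zoo.frontLE_iff.1 (((hj c).2 m).2 (Finset.mem_range_succ_iff.1 hc))).and
        (Zoo.frontLE_iff.1 ((hj m).2 c).1)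
    filter_upwards [(Filter.eventually_all_finset _).2 this] with n hn c hc
    exact hn c (Finset.mem_range_succ_iff.2 hc)
  let M (n : ℕ) : ℕ := Nat.findGreatest (fun m => P m n) n
  have hM : ∀ m, ∀ᶠ n in atTop, m ≤ M n ∧ P (M n) n := by
    intro m
    filter_upwards [hP m, eventually_ge_atTop m] with n hn hmn
    exact ⟨Nat.le_findGreatest hmn hn, Nat.findGreatest_spec (P := fun m => P m n) hmn hn⟩
  let H : Set (Node N) := {x | ∃ n, x ∈ (t.S n).carrier ∧ x ∈ (F (M n)).1}
  have hbr : ∀ n, ∀ k ∈ (t.S n).ext, t.branch k ∩ H = t.branch k ∩ (F (M n)).1 := by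
    intro n k hk
    ext x
    refine and_congr_right fun hx => ?_
    have hxn := Zoo.mem_creature_of_ge hk hx
    constructor
    · rintro ⟨n', hn', h⟩
      rwa [Zoo.index_unique hxn hn']
    · exact fun h => ⟨n, hxn, h⟩
  have hFH : ∀ m, t.FrontLE (F m).1 H ∧ t.FrontLE H (G m).1 := by
    intro m
    rw [Zoo.frontLE_iff, Zoo.frontLE_iff, ← eventually_and, Zoo.eventually_leaves_iff_creatures]
    filter_upwards [hM m] with n ⟨hmn, hn⟩ k hk
    rw [hbr n k hk]
    exact hn m hmn k hk
  have hH : t.IsStarFront H := by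
    refine ⟨fun x ⟨n, hn, _⟩ => ⟨n, hn⟩, Zoo.almostAllBranches_iff.2 ?_⟩
    exact (Zoo.frontLE_iff.1 (hFH 0).1).mono fun k ⟨_, y, _, hy, _⟩ => ⟨y, hy⟩
  have hHt := tracked_of_isStarFront hH
  refine ⟨φ.toFun (.of hH), fun n => ?_, fun n => ?_⟩
  · rw [← hF n, φ.le_iff]
    exact seqFrontLE_of_frontLE hs (hj n).1.1 hHt (hFH n).1
  · rw [← hG n, φ.le_iff]
    exact seqFrontLE_of_frontLE hs hHt (hj n).1.2 (hFH n).2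

lemma exists_between (φ : FrontMap s D) (hs : SufficientlyGeneric s)
    (hI : ∀ u : ℕ → I, ∃ j, ∀ n, u n ≤ j)
    (A B : Set D) (hA : A.Countable) (hB : B.Countable) (hne : A.Nonempty)
    (hAB : ∀ a ∈ A, ∀ b ∈ B, a ≤ b) : ∃ d, (∀ a ∈ A, a ≤ d) ∧ ∀ b ∈ B, d ≤ b := by
  obtain ⟨a, rfl⟩ := hA.exists_eq_range hne
  rcases B.eq_empty_or_nonempty with rfl | hneB
  · obtain ⟨d, hd⟩ := φ.exists_upper_bound hs hI a
    exact ⟨d, by rintro _ ⟨n, rfl⟩; exact hd n, by simp⟩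
  · obtain ⟨b, rfl⟩ := hB.exists_eq_range hneB
    obtain ⟨d, h1, h2⟩ := φ.exists_between_seq hs hI (a := partialSups a) (b := b)
      (partialSups a).monotone fun m n =>
        partialSups_le a m _ fun i _ => hAB _ ⟨i, rfl⟩ _ ⟨n, rfl⟩
    refine ⟨d, ?_, ?_⟩
    · rintro _ ⟨n, rfl⟩
      exact (le_partialSups a n).trans (h1 n)
    · rintro _ ⟨n, rfl⟩
      exact h2 n

end FrontMap

variable [Nonempty I]

/-! ### Growth functions modulo the filter -/

lemma growth_le_total (hs : SufficientlyGeneric s) (hU : ∀ A ∈ extFilter s, A.Infinite)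
    (f g : GrowthMod (extFilter s) hU) : f ≤ g ∨ g ≤ f := by
  obtain ⟨i, F, hF, hfF⟩ := exists_front_matches hs f
  obtain ⟨j, G, hG, hgG⟩ := exists_front_matches hs g
  have hF' := tracked_of_isStarFront hF
  have hG' := tracked_of_isStarFront hG
  have hi := le_max_left i j
  have hj := le_max_right i j
  have hfF' := hF'.matches_mono hs hi hfF
  have hgG' := hG'.matches_mono hs hj hgG
  replace hF' := hF'.mono hs hi
  replace hG' := hG'.mono hs hj
  obtain ⟨a, ha, h⟩ := hF'.exists_comparable hG' hs
  have hfg := fun h => (growthLE_iff_seqFrontLE hs hF' hG' hfF' hgG').2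
    (seqFrontLE_of_frontLE hs (hF'.mono hs ha.le) (hG'.mono hs ha.le) h)
  have hgf := fun h => (growthLE_iff_seqFrontLE hs hG' hF' hgG' hfF').2
    (seqFrontLE_of_frontLE hs (hG'.mono hs ha.le) (hF'.mono hs ha.le) h)
  exact h.imp hfg fun h => hgf h.frontLE

/-- The classes of growth functions form a linear order. -/
@[reducible]
noncomputable def growthLinearOrder (hs : SufficientlyGeneric s)
    (hU : ∀ A ∈ extFilter s, A.Infinite) :
    LinearOrder (Antisymmetrization (GrowthMod (extFilter s) hU) (· ≤ ·)) :=
  letI : Std.Total (α := GrowthMod (extFilter s) hU) (· ≤ ·) := ⟨growth_le_total hs hU⟩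
  letI := Classical.decRel (α := GrowthMod (extFilter s) hU) (· ≤ ·)
  letI := Classical.decRel (α := GrowthMod (extFilter s) hU) (· < ·)
  inferInstance

/-- Sending an almost front to the class of the growth functions that match it. -/
lemma nonempty_frontMap (hs : SufficientlyGeneric s) (hU : ∀ A ∈ extFilter s, A.Infinite) :
    letI := growthLinearOrder hs hU
    Nonempty (FrontMap s (Antisymmetrization (GrowthMod (extFilter s) hU) (· ≤ ·))) := by
  have hex : ∀ F : SeqFront s, ∃ f, ∀ᶠ j in atTop, (s j).Matches f F.1 := by
    intro F
    obtain ⟨i, hi⟩ := F.2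
    obtain ⟨f, hf⟩ := (s i).exists_growth_matches F.1
    exact ⟨f, (eventually_ge_atTop i).mono fun j hij =>
      (tracked_of_isStarFront hi).matches_mono hs hij hf⟩
  choose g hg using hex
  have key : ∀ (F G : SeqFront s) (f h : GrowthMod (extFilter s) hU),
      (∀ᶠ j in atTop, (s j).Matches f F.1) → (∀ᶠ j in atTop, (s j).Matches h G.1) →
      (f ≤ h ↔ SeqFrontLE s F.1 G.1) := by
    intro F G f h hf hh
    obtain ⟨j, h1, h2, h3, h4⟩ := (hf.and (hh.and ((F.eventually_tracked hs).and
      (G.eventually_tracked hs)))).exists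
    exact growthLE_iff_seqFrontLE hs h3 h4 h1 h2
  let := growthLinearOrder hs hU
  refine ⟨⟨fun F => toAntisymmetrization (α := GrowthMod (extFilter s) hU) (· ≤ ·) (g F), ?_,
    fun F G => key F G _ _ (hg F) (hg G)⟩⟩
  intro d
  induction d using Quotient.inductionOn with
  | h f =>
    obtain ⟨i, F, hF, hfF⟩ := exists_front_matches hs f
    have hf : ∀ᶠ j in atTop, (s j).Matches f F := (eventually_ge_atTop i).mono fun j hij =>
      (tracked_of_isStarFront hF).matches_mono hs hij hfF
    have hrefl : SeqFrontLE s F F := seqFrontLE_of_frontLE hs (tracked_of_isStarFront hF)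
      (tracked_of_isStarFront hF) (tracked_of_isStarFront hF).frontLE_refl
    refine ⟨.of hF, Quotient.sound ⟨?_, ?_⟩⟩
    · exact (key (.of hF) (.of hF) _ _ (hg _) hf).2 hrefl
    · exact (key (.of hF) (.of hF) _ _ hf (hg _)).2 hrefl

universe u v

/-! ### Recognizing the orders `D₁` and `D₂` -/

section Coarse

variable {D : Type u} [LinearOrder D]

lemma finite_Icc_trans {x y z : D} (h₁ : (Icc y x).Finite) (h₂ : (Icc z y).Finite) :
    (Icc z x).Finite :=
  (h₁.union h₂).subset fun w hw =>
    (le_total y w).imp (fun h => ⟨h, hw.2⟩) fun h => ⟨hw.1, h⟩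

/-- A linear order with the coarser preorder "`x ≤ y`, or the interval between `y` and `x` is
finite". -/
def Coarse (D : Type u) : Type u := D

/-- The relation extends the order, as `Icc y x` is empty or a singleton if `x ≤ y`. -/
instance : Preorder (Coarse D) where
  le x y := (Icc (α := D) y x).Finite
  le_refl x := by
    have h : ∀ y : D, (Icc y y).Finite := fun y => by
      rw [Icc_self]
      exact finite_singleton y
    exact h x
  le_trans _ _ _ h₁ h₂ := finite_Icc_trans h₁ h₂

lemma finite_Icc_of_le {x y : D} (h : x ≤ y) : (Icc y x).Finite :=
  (finite_singleton x).subset fun _ hz => le_antisymm hz.2 (h.trans hz.1)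

/-- The quotient of a linear order by the relation "the interval between `x` and `y` is finite". -/
abbrev FiniteQuotient (D : Type u) [LinearOrder D] : Type u :=
  Antisymmetrization (Coarse D) (· ≤ ·)

noncomputable instance : LinearOrder (FiniteQuotient D) :=
  letI : Std.Total (α := Coarse D) (· ≤ ·) :=
    ⟨fun x y => (le_total (α := D) x y).imp finite_Icc_of_le finite_Icc_of_le⟩
  letI := Classical.decRel (α := Coarse D) (· ≤ ·)
  letI := Classical.decRel (α := Coarse D) (· < ·)
  inferInstance

/-- The quotient map. -/
def toFiniteQuotient (D : Type u) [LinearOrder D] : D →o FiniteQuotient D where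
  toFun x := toAntisymmetrization (α := Coarse D) (· ≤ ·) x
  monotone' _ _ h := finite_Icc_of_le h

lemma toFiniteQuotient_le_iff {x y : D} :
    toFiniteQuotient D x ≤ toFiniteQuotient D y ↔ (Icc y x).Finite := Iff.rfl

lemma toFiniteQuotient_lt_iff {x y : D} :
    toFiniteQuotient D x < toFiniteQuotient D y ↔ (Icc x y).Infinite := by
  rw [← not_le, toFiniteQuotient_le_iff, Set.Infinite]

lemma toFiniteQuotient_surjective : Function.Surjective (toFiniteQuotient D) := fun d =>
  Quotient.inductionOn d fun x => ⟨x, rfl⟩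

lemma toFiniteQuotient_eq_iff {x y : D} :
    toFiniteQuotient D x = toFiniteQuotient D y ↔ (uIcc x y).Finite := by
  rw [le_antisymm_iff, toFiniteQuotient_le_iff, toFiniteQuotient_le_iff]
  rcases le_total x y with h | h
  · rw [uIcc_of_le h]
    exact and_iff_right (finite_Icc_of_le h)
  · rw [uIcc_of_ge h]
    exact and_iff_left (finite_Icc_of_le h)

lemma lt_of_infinite_Icc {x y : D} (h : (Icc x y).Infinite) : x < y := by
  by_contra! h'
  exact h (finite_Icc_of_le h')

lemma infinite_Icc_of_covBy_left {x x' y : D} (h : (Icc x y).Infinite) (hx : x ⋖ x') :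
    (Icc x' y).Infinite := by
  intro hfin
  refine h ((hfin.union (finite_singleton x)).subset fun z hz => ?_)
  rcases hz.1.eq_or_lt with rfl | h'
  · exact Or.inr rfl
  · exact Or.inl ⟨hx.ge_of_gt h', hz.2⟩

lemma infinite_Icc_of_covBy_right {x y y' : D} (h : (Icc x y).Infinite) (hy : y' ⋖ y) :
    (Icc x y').Infinite := by
  intro hfin
  refine h ((hfin.union (finite_singleton y)).subset fun z hz => ?_)
  rcases hz.2.eq_or_lt with rfl | h'
  · exact Or.inr rfl
  · exact Or.inl ⟨hz.1, hy.le_of_lt h'⟩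

/-- In the presence of a saturation property, the other properties of `D₁` reduce to a bound on the
cardinality. -/
lemma isD1_of_saturated (hbot : ∃ a : D, IsBot a) (hcard : #D ≤ ℵ₁)
    (hsat : ∀ C C' : Set D, C.Countable → C'.Countable → C.Nonempty →
      (∀ x ∈ C, ∀ y ∈ C', x < y) → ∃ c, (∀ x ∈ C, x < c) ∧ ∀ y ∈ C', c < y) : IsD1 D where
  exists_bot := hbot
  no_top x := by
    obtain ⟨c, hc, -⟩ := hsat {x} ∅ (countable_singleton x) countable_empty
      (singleton_nonempty x) (by simp)
    exact ⟨c, hc x rfl⟩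
  card_eq := by
    refine hcard.antisymm ?_
    rw [← succ_aleph0, Order.succ_le_iff]
    by_contra! h
    have : Countable D := mk_le_aleph0_iff.1 h
    obtain ⟨a, -⟩ := hbot
    obtain ⟨c, hc, -⟩ := hsat univ ∅ countable_univ countable_empty ⟨a, trivial⟩ (by simp)
    exact lt_irrefl c (hc c trivial)
  dense a b hab hcount := by
    obtain ⟨c, hc, hcb⟩ := hsat (insert a (Ioo a b)) {b} (hcount.insert a)
      (countable_singleton b) (insert_nonempty _ _) (by
        rintro x (rfl | hx) y rfl
        · exact hab
        · exact hx.2)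
    exact lt_irrefl c (hc c (Or.inr ⟨hc a (Or.inl rfl), hcb b rfl⟩))
  saturated := hsat

/-- A discrete linear order of size at most `ℵ₁` with weak interpolation for countable sets is
a `D₂`-order: strictness in the quotient is gained by closing the countable sets under successors
and predecessors. -/
theorem isD2_of_interpolation (hbot : ∃ a : D, IsBot a) (hsucc : ∀ x : D, ∃ y, x ⋖ y)
    (hpred : ∀ x : D, ¬ IsBot x → ∃ y, y ⋖ x) (hcard : #D ≤ ℵ₁)
    (hint : ∀ A B : Set D, A.Countable → B.Countable → A.Nonempty →
      (∀ a ∈ A, ∀ b ∈ B, a ≤ b) → ∃ d, (∀ a ∈ A, a ≤ d) ∧ ∀ b ∈ B, d ≤ b) : IsD2 D where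
  exists_bot := hbot
  no_top x := (hsucc x).imp fun _ h => h.lt
  exists_succ := hsucc
  exists_pred := hpred
  quotient := by
    refine ⟨FiniteQuotient D, inferInstance, toFiniteQuotient D, ?_, toFiniteQuotient_surjective,
      fun x y => toFiniteQuotient_eq_iff⟩
    refine isD1_of_saturated ?_ ((mk_le_of_surjective toFiniteQuotient_surjective).trans hcard) ?_
    · obtain ⟨a, ha⟩ := hbot
      refine ⟨toFiniteQuotient D a, fun d => ?_⟩
      obtain ⟨x, rfl⟩ := toFiniteQuotient_surjective d
      exact (toFiniteQuotient D).monotone (ha x)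
    intro C C' hC hC' hne hCC'
    choose σ hσ using hsucc
    have hpred' : ∀ x : D, ∃ y, ¬ IsBot x → y ⋖ x := fun x => by
      by_cases hx : IsBot x
      · exact ⟨x, fun h => absurd hx h⟩
      · exact (hpred x hx).imp fun y hy _ => hy
    choose ρ hρ using hpred'
    choose r hr using toFiniteQuotient_surjective (D := D)
    have hfar : ∀ x ∈ C, ∀ y ∈ C', (Icc (r x) (r y)).Infinite := fun x hx y hy => by
      rw [← toFiniteQuotient_lt_iff, hr, hr]
      exact hCC' x hx y hy
    have hup : ∀ x y : D, (Icc x y).Infinite → ∀ n, (Icc (σ^[n] x) y).Infinite := by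
      intro x y h n
      induction n with
      | zero => exact h
      | succ n ih =>
        rw [Function.iterate_succ_apply']
        exact infinite_Icc_of_covBy_left ih (hσ _)
    have hnotbot : ∀ x y : D, (Icc x y).Infinite → ¬ IsBot y := fun x y h hy =>
      (lt_of_infinite_Icc h).not_ge (hy x)
    have hdown : ∀ x y : D, (Icc x y).Infinite → ∀ n, (Icc x (ρ^[n] y)).Infinite := by
      intro x y h n
      induction n with
      | zero => exact h
      | succ n ih =>
        rw [Function.iterate_succ_apply']
        exact infinite_Icc_of_covBy_right ih (hρ _ (hnotbot _ _ ih))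
    obtain ⟨c₀, hc₀⟩ := hne
    obtain ⟨d, hd, hd'⟩ := hint (⋃ c ∈ C, range fun n => σ^[n] (r c))
      (⋃ c ∈ C', range fun n => ρ^[n] (r c)) (hC.biUnion fun c _ => countable_range _)
      (hC'.biUnion fun c _ => countable_range _)
      ⟨r c₀, mem_biUnion hc₀ ⟨0, rfl⟩⟩ (by
        intro a ha b hb
        obtain ⟨c, hc, m, rfl⟩ := mem_iUnion₂.1 ha
        obtain ⟨c', hc', n, rfl⟩ := mem_iUnion₂.1 hb
        exact (lt_of_infinite_Icc (hup _ _ (hdown _ _ (hfar c hc c' hc') n) m)).le)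
    refine ⟨toFiniteQuotient D d, fun c hc => ?_, fun c hc => ?_⟩
    · rw [← hr c, toFiniteQuotient_lt_iff]
      have hmono : StrictMono fun n => σ^[n] (r c) := strictMono_nat_of_lt_succ fun n => by
        simp only [Function.iterate_succ_apply']
        exact (hσ _).lt
      refine (infinite_range_of_injective hmono.injective).mono ?_
      rintro _ ⟨n, rfl⟩
      exact ⟨hmono.monotone (Nat.zero_le n), hd _ (mem_biUnion hc ⟨n, rfl⟩)⟩
    · rw [← hr c, toFiniteQuotient_lt_iff]
      have hanti : StrictAnti fun n => ρ^[n] (r c) := strictAnti_nat_of_succ_lt fun n => by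
        simp only [Function.iterate_succ_apply']
        exact (hρ _ (hnotbot _ _ (hdown _ _ (hfar c₀ hc₀ c hc) n))).lt
      refine (infinite_range_of_injective hanti.injective).mono ?_
      rintro _ ⟨n, rfl⟩
      exact ⟨hd' _ (mem_biUnion hc ⟨n, rfl⟩), hanti.antitone (Nat.zero_le n)⟩

end Coarse

/-! ### Uniqueness of the order `D₂` -/

/-- The index set of a back-and-forth construction: a well-order of size `ℵ₁` with countable initial
segments. -/
abbrev OmegaOne : Type := (ℵ₁ : Cardinal.{0}).ord.ToType

lemma countable_Iio_omegaOne (i : OmegaOne) : (Iio i).Countable := by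
  rw [← le_aleph0_iff_set_countable, ← Order.lt_succ_iff, succ_aleph0]
  have h := mk_Iio_lt i (by simp)
  rwa [mk_ord_toType] at h

/-- What the back-and-forth construction needs to know about a `D₂`-order. -/
structure BackForthData (D : Type u) [LinearOrder D] where
  bot : D
  succ : D → D
  pred : D → D
  bot_le : ∀ x, bot ≤ x
  covBy_succ : ∀ x, x ⋖ succ x
  pred_bot : pred bot = bot
  pred_covBy : ∀ x, x ≠ bot → pred x ⋖ x
  /-- Countable cuts are filled, if their lower half is closed under successors. -/
  fill : ∀ L R : Set D, L.Countable → R.Countable → L.Nonempty → (∀ x ∈ L, succ x ∈ L) →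
    (∀ x ∈ L, ∀ y ∈ R, x < y) → ∃ z, (∀ x ∈ L, x < z) ∧ ∀ y ∈ R, z < y
  gen : OmegaOne → D
  /-- Under successors and predecessors `gen` generates the whole order. -/
  mem_of_gen : ∀ A : Set D, (∀ x ∈ A, succ x ∈ A) → (∀ x ∈ A, pred x ∈ A) → (∀ i, gen i ∈ A) →
    ∀ x, x ∈ A

lemma mem_of_finite_Icc {D : Type u} [LinearOrder D] {σ : D → D} (hσ : ∀ x, x ⋖ σ x) {A : Set D}
    (hA : ∀ x ∈ A, σ x ∈ A) {x y : D} (hx : x ∈ A) (hxy : x ≤ y) (hfin : (Icc x y).Finite) :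
    y ∈ A := by
  obtain ⟨m, ⟨hmA, hm⟩, hmax⟩ := Set.exists_max_image (A ∩ Icc x y) id
    (hfin.subset inter_subset_right) ⟨x, hx, le_rfl, hxy⟩
  rcases hm.2.eq_or_lt with rfl | h
  · exact hmA
  · have := hmax (σ m) ⟨hA m hmA, hm.1.trans (hσ m).le, (hσ m).ge_of_gt h⟩
    exact absurd this (hσ m).lt.not_ge

lemma mem_of_finite_Icc_pred {D : Type u} [LinearOrder D] {ρ : D → D} {b : D} (hb : ∀ x, b ≤ x)
    (hρ : ∀ x, x ≠ b → ρ x ⋖ x) {A : Set D} (hA : ∀ x ∈ A, ρ x ∈ A) {x y : D} (hx : x ∈ A)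
    (hyx : y ≤ x) (hfin : (Icc y x).Finite) : y ∈ A := by
  obtain ⟨m, ⟨hmA, hm⟩, hmin⟩ := Set.exists_min_image (A ∩ Icc y x) id
    (hfin.subset inter_subset_right) ⟨x, hx, hyx, le_rfl⟩
  rcases hm.1.eq_or_lt with rfl | h
  · exact hmA
  · have hcov := hρ m ((hb y).trans_lt h).ne'
    have := hmin (ρ m) ⟨hA m hmA, hcov.le_of_lt h, hcov.le.trans hm.2⟩
    exact absurd this hcov.lt.not_ge

lemma IsD2.nonempty_backForthData {D : Type u} [LinearOrder D] (h : IsD2 D) :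
    Nonempty (BackForthData D) := by
  obtain ⟨b, hb⟩ := h.exists_bot
  obtain ⟨D₁, _, π, h₁, hπ, hπfin⟩ := h.quotient
  choose σ hσ using h.exists_succ
  have hpred : ∀ x : D, ∃ y, (x = b → y = b) ∧ (x ≠ b → y ⋖ x) := fun x => by
    by_cases hx : x = b
    · exact ⟨b, fun _ => rfl, fun h => absurd hx h⟩
    · obtain ⟨y, hy⟩ := h.exists_pred x fun hbot => hx (le_antisymm (hbot b) (hb x))
      exact ⟨y, fun h => absurd h hx, fun _ => hy⟩
  choose ρ hρb hρ using hpred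
  choose r hr using hπ
  have hcard : Cardinal.lift.{u} #OmegaOne = Cardinal.lift.{0} #D₁ := by
    rw [h₁.card_eq, mk_ord_toType]
    simp
  obtain ⟨e⟩ := Cardinal.lift_mk_eq'.1 hcard
  refine ⟨⟨b, σ, ρ, hb, hσ, hρb b rfl, hρ, ?_, fun i => r (e i), ?_⟩⟩
  · intro L R hL hR hne hcl hLR
    obtain ⟨c, hc, hc'⟩ := h₁.saturated (π '' L) (π '' R) (hL.image _) (hR.image _)
      (hne.image _) (by
        rintro _ ⟨x, hx, rfl⟩ _ ⟨y, hy, rfl⟩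
        refine lt_of_le_of_ne (π.monotone (hLR x hx y hy).le) fun heq => ?_
        rw [hπfin, uIcc_of_le (hLR x hx y hy).le] at heq
        exact lt_irrefl y (hLR y (mem_of_finite_Icc hσ hcl hx (hLR x hx y hy).le heq) y hy))
    refine ⟨r c, fun x hx => ?_, fun y hy => ?_⟩
    · have := hc _ ⟨x, hx, rfl⟩
      rw [← hr c] at this
      exact π.monotone.reflect_lt this
    · have := hc' _ ⟨y, hy, rfl⟩
      rw [← hr c] at this
      exact π.monotone.reflect_lt this
  · intro A hA hA' hgen x
    have hx : r (e (e.symm (π x))) ∈ A := hgen _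
    rw [Equiv.apply_symm_apply] at hx
    have hfin := (hπfin (r (π x)) x).1 (hr _)
    rcases le_total (r (π x)) x with hle | hle
    · rw [uIcc_of_le hle] at hfin
      exact mem_of_finite_Icc hσ hA hx hle hfin
    · rw [uIcc_of_ge hle] at hfin
      exact mem_of_finite_Icc_pred hb hρ hA' hx hle hfin

/-- A transfinite construction of length `ω₁` of an increasing sequence of sets that meets
requirements `R i`, provided that countable chains of good sets have good upper bounds. -/
lemma exists_monotone_meeting {X : Type*} {Good : Set X → Prop}
    (hchain : ∀ c : Set (Set X), c.Countable → IsChain (· ⊆ ·) c → (∀ p ∈ c, Good p) →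
      ∃ q, Good q ∧ ∀ p ∈ c, p ⊆ q)
    {R : OmegaOne → Set X → Prop} (hR : ∀ i p, Good p → ∃ q, p ⊆ q ∧ Good q ∧ R i q) :
    ∃ F : OmegaOne → Set X, Monotone F ∧ ∀ i, Good (F i) ∧ R i (F i) := by
  classical
  let step (i : OmegaOne) (f : ∀ j, j < i → Set X) : Set X :=
    if h : ∃ q, Good q ∧ R i q ∧ ∀ j hj, f j hj ⊆ q then h.choose else ∅
  let F : OmegaOne → Set X := (wellFounded_lt (α := OmegaOne)).fix step
  have hF : ∀ i, F i = step i fun j _ => F j := fun i => WellFounded.fix_eq _ _ _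
  have hspec : ∀ i, Good (F i) ∧ R i (F i) ∧ ∀ j < i, F j ⊆ F i := by
    intro i
    induction i using WellFoundedLT.induction with
    | ind i ih =>
      have hex : ∃ q, Good q ∧ R i q ∧ ∀ j, ∀ _ : j < i, F j ⊆ q := by
        obtain ⟨p, hp, hpc⟩ := hchain (F '' Iio i) ((countable_Iio_omegaOne i).image _) (by
          rintro _ ⟨j, hj, rfl⟩ _ ⟨k, hk, rfl⟩ hne
          rcases lt_trichotomy j k with h | rfl | h
          · exact Or.inl ((ih k hk).2.2 j h)
          · exact absurd rfl hne
          · exact Or.inr ((ih j hj).2.2 k h)) (by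
          rintro _ ⟨j, hj, rfl⟩
          exact (ih j hj).1)
        obtain ⟨q, hpq, hq, hRq⟩ := hR i p hp
        exact ⟨q, hq, hRq, fun j hj => (hpc _ ⟨j, hj, rfl⟩).trans hpq⟩
      have heq : F i = hex.choose := by
        rw [hF i]
        exact dif_pos hex
      rw [heq]
      exact hex.choose_spec
  refine ⟨F, fun i j hij => ?_, fun i => ⟨(hspec i).1, (hspec i).2.1⟩⟩
  rcases hij.eq_or_lt with rfl | h
  · exact Subset.rfl
  · exact (hspec j).2.2 i h

namespace BackForthData

variable {D : Type u} {D' : Type v} [LinearOrder D] [LinearOrder D']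

lemma pred_succ (E : BackForthData D) (x : D) : E.pred (E.succ x) = x :=
  (E.pred_covBy _ ((E.bot_le x).trans_lt (E.covBy_succ x).lt).ne').unique_left (E.covBy_succ x)

lemma succ_pred (E : BackForthData D) {x : D} (hx : x ≠ E.bot) : E.succ (E.pred x) = x :=
  (E.covBy_succ _).unique_right (E.pred_covBy x hx)

/-- The class of a point outside of a closed set is a copy of `ℤ`, and it lies in one gap of the
closed set. -/
lemma exists_orbit (E : BackForthData D) {A : Set D} (hb : E.bot ∈ A) (hs : ∀ x ∈ A, E.succ x ∈ A)
    (hp : ∀ x ∈ A, E.pred x ∈ A) {x : D} (hx : x ∉ A) :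
    ∃ e : ℤ → D, e 0 = x ∧ (∀ n, e n ⋖ e (n + 1)) ∧ (∀ n, e n ∉ A) ∧
      ∀ a ∈ A, ∀ n, a < e n ↔ a < x := by
  have hne : ∀ y ∉ A, y ≠ E.bot := fun y hy h => hy (h ▸ hb)
  have hpred : ∀ n, E.pred^[n] x ∉ A := by
    intro n
    induction n with
    | zero => exact hx
    | succ n ih =>
      rw [Function.iterate_succ_apply']
      exact fun h => ih (E.succ_pred (hne _ ih) ▸ hs _ h)
  let e : ℤ → D
    | Int.ofNat n => E.succ^[n] x
    | Int.negSucc n => E.pred^[n + 1] x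
  have hcov : ∀ n, e n ⋖ e (n + 1) := by
    rintro (n | n)
    · change E.succ^[n] x ⋖ E.succ^[n + 1] x
      rw [Function.iterate_succ_apply']
      exact E.covBy_succ _
    · have h : e (Int.negSucc n + 1) = E.pred^[n] x := by cases n <;> rfl
      rw [h]
      change E.pred^[n + 1] x ⋖ _
      rw [Function.iterate_succ_apply']
      exact E.pred_covBy _ (hne _ (hpred n))
  have hsucc : ∀ n, E.succ (e n) = e (n + 1) := fun n =>
    (E.covBy_succ _).unique_right (hcov n)
  have hA : ∀ n, e n ∈ A ↔ e (n + 1) ∈ A := fun n => by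
    rw [← hsucc]
    exact ⟨hs _, fun h => E.pred_succ (e n) ▸ hp _ h⟩
  have hnot : ∀ n, e n ∉ A := by
    intro n
    induction n using Int.induction_on with
    | zero => exact hx
    | succ n ih => exact fun h => ih ((hA n).2 h)
    | pred n ih =>
      intro h
      have := (hA _).1 h
      rw [sub_add_cancel] at this
      exact ih this
  have hlt : ∀ a ∈ A, ∀ n, a < e n ↔ a < e (n + 1) := fun a ha n =>
    ⟨fun h => h.trans (hcov n).lt, fun h => lt_of_le_of_ne ((hcov n).le_of_lt h) fun heq =>
      hnot n (heq ▸ ha)⟩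
  refine ⟨e, rfl, hcov, hnot, fun a ha n => ?_⟩
  induction n using Int.induction_on with
  | zero => exact Iff.rfl
  | succ n ih => rw [← hlt a ha, ih]
  | pred n ih => rw [hlt a ha, sub_add_cancel, ih]

/-- The approximations: countable partial isomorphisms that are closed under successors and
predecessors. -/
structure PartialIsoSet (E : BackForthData D) (E' : BackForthData D') (p : Set (D × D')) :
    Prop where
  countable : p.Countable
  bot_mem : (E.bot, E'.bot) ∈ p
  succ_mem : ∀ a b, (a, b) ∈ p → (E.succ a, E'.succ b) ∈ p
  pred_mem : ∀ a b, (a, b) ∈ p → (E.pred a, E'.pred b) ∈ p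
  lt_iff : ∀ a b a' b', (a, b) ∈ p → (a', b') ∈ p → (a < a' ↔ b < b')

variable {E : BackForthData D} {E' : BackForthData D'} {p : Set (D × D')}

lemma PartialIsoSet.swap (h : PartialIsoSet E E' p) :
    PartialIsoSet E' E (Prod.swap ⁻¹' p) where
  countable := h.countable.preimage Prod.swap_injective
  bot_mem := h.bot_mem
  succ_mem b a hab := h.succ_mem a b hab
  pred_mem b a hab := h.pred_mem a b hab
  lt_iff b a b' a' hab hab' := (h.lt_iff a b a' b' hab hab').symm

lemma PartialIsoSet.exists_extension (h : PartialIsoSet E E' p) (x : D) :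
    ∃ q, p ⊆ q ∧ PartialIsoSet E E' q ∧ ∃ y, (x, y) ∈ q := by
  by_cases hx : x ∈ Prod.fst '' p
  · obtain ⟨⟨_, y⟩, hy, rfl⟩ := hx
    exact ⟨p, Subset.rfl, h, y, hy⟩
  have hxp : ∀ a b, (a, b) ∈ p → a ≠ x := fun a b hab heq => hx ⟨_, hab, heq⟩
  obtain ⟨y, hy, hy'⟩ := E'.fill {b | ∃ a, (a, b) ∈ p ∧ a < x} {b | ∃ a, (a, b) ∈ p ∧ x < a}
    ((h.countable.image Prod.snd).mono (by rintro b ⟨a, hab, _⟩; exact ⟨(a, b), hab, rfl⟩))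
    ((h.countable.image Prod.snd).mono (by rintro b ⟨a, hab, _⟩; exact ⟨(a, b), hab, rfl⟩))
    ⟨E'.bot, E.bot, h.bot_mem, lt_of_le_of_ne (E.bot_le x) (hxp _ _ h.bot_mem)⟩
    (by
      rintro b ⟨a, hab, hax⟩
      have hs := h.succ_mem a b hab
      exact ⟨_, hs, lt_of_le_of_ne ((E.covBy_succ a).ge_of_gt hax) (hxp _ _ hs)⟩)
    (by
      rintro b ⟨a, hab, hax⟩ b' ⟨a', hab', hax'⟩
      exact (h.lt_iff _ _ _ _ hab hab').1 (hax.trans hax'))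
  have hxy : ∀ a b, (a, b) ∈ p → (a < x ↔ b < y) := by
    intro a b hab
    refine ⟨fun hax => hy b ⟨a, hab, hax⟩, fun hby => ?_⟩
    by_contra! hxa
    exact lt_asymm hby (hy' b ⟨a, hab, lt_of_le_of_ne hxa (hxp a b hab).symm⟩)
  have hyp : y ∉ Prod.snd '' p := by
    rintro ⟨⟨a, b⟩, hab, rfl⟩
    rcases lt_or_gt_of_ne (hxp a b hab) with hlt | hlt
    · exact lt_irrefl _ (hy b ⟨a, hab, hlt⟩)
    · exact lt_irrefl _ (hy' b ⟨a, hab, hlt⟩)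
  obtain ⟨e, he0, hecov, heA, helt⟩ := E.exists_orbit (A := Prod.fst '' p) ⟨_, h.bot_mem, rfl⟩
    (by rintro _ ⟨⟨a, b⟩, hab, rfl⟩; exact ⟨_, h.succ_mem a b hab, rfl⟩)
    (by rintro _ ⟨⟨a, b⟩, hab, rfl⟩; exact ⟨_, h.pred_mem a b hab, rfl⟩) hx
  obtain ⟨e', he0', hecov', heA', helt'⟩ := E'.exists_orbit (A := Prod.snd '' p)
    ⟨_, h.bot_mem, rfl⟩
    (by rintro _ ⟨⟨a, b⟩, hab, rfl⟩; exact ⟨_, h.succ_mem a b hab, rfl⟩)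
    (by rintro _ ⟨⟨a, b⟩, hab, rfl⟩; exact ⟨_, h.pred_mem a b hab, rfl⟩) hyp
  have hmix : ∀ a b n, (a, b) ∈ p → (a < e n ↔ b < e' n) := fun a b n hab => by
    rw [helt a ⟨_, hab, rfl⟩, helt' b ⟨_, hab, rfl⟩, hxy a b hab]
  have hmix' : ∀ a b n, (a, b) ∈ p → (e n < a ↔ e' n < b) := fun a b n hab => by
    have h1 : a ≠ e n := fun heq => heA n ⟨_, hab, heq⟩
    have h2 : b ≠ e' n := fun heq => heA' n ⟨_, hab, heq⟩
    have := hmix a b n hab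
    rw [← not_iff_not, not_lt, not_lt, le_iff_lt_or_eq, le_iff_lt_or_eq, or_iff_left h1,
      or_iff_left h2, this]
  have hmono : StrictMono e := strictMono_int_of_lt_succ fun n => (hecov n).lt
  have hmono' : StrictMono e' := strictMono_int_of_lt_succ fun n => (hecov' n).lt
  refine ⟨p ∪ range fun n => (e n, e' n), subset_union_left, ⟨?_, ?_, ?_, ?_, ?_⟩, y,
    Or.inr ⟨0, Prod.ext he0 he0'⟩⟩
  · exact h.countable.union (countable_range _)
  · exact Or.inl h.bot_mem
  · rintro a b (hab | ⟨n, hn⟩)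
    · exact Or.inl (h.succ_mem a b hab)
    · obtain ⟨rfl, rfl⟩ := Prod.mk.inj hn
      refine Or.inr ⟨n + 1, ?_⟩
      rw [(E.covBy_succ _).unique_right (hecov n), (E'.covBy_succ _).unique_right (hecov' n)]
  · rintro a b (hab | ⟨n, hn⟩)
    · exact Or.inl (h.pred_mem a b hab)
    · obtain ⟨rfl, rfl⟩ := Prod.mk.inj hn
      refine Or.inr ⟨n - 1, ?_⟩
      have h1 := hecov (n - 1)
      have h2 := hecov' (n - 1)
      rw [sub_add_cancel] at h1 h2
      have hn1 : e n ≠ E.bot := fun heq => heA n (heq ▸ ⟨_, h.bot_mem, rfl⟩)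
      have hn2 : e' n ≠ E'.bot := fun heq => heA' n (heq ▸ ⟨_, h.bot_mem, rfl⟩)
      rw [(E.pred_covBy _ hn1).unique_left h1, (E'.pred_covBy _ hn2).unique_left h2]
  · rintro a b a' b' (hab | ⟨n, hn⟩) (hab' | ⟨n', hn'⟩)
    · exact h.lt_iff a b a' b' hab hab'
    · obtain ⟨rfl, rfl⟩ := Prod.mk.inj hn'
      exact hmix a b n' hab
    · obtain ⟨rfl, rfl⟩ := Prod.mk.inj hn
      exact hmix' a' b' n hab'
    · obtain ⟨rfl, rfl⟩ := Prod.mk.inj hn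
      obtain ⟨rfl, rfl⟩ := Prod.mk.inj hn'
      rw [hmono.lt_iff_lt, hmono'.lt_iff_lt]

lemma exists_partialIsoSet (E : BackForthData D) (E' : BackForthData D') :
    ∃ p, PartialIsoSet E E' p := by
  have hmono : StrictMono fun n => E.succ^[n] E.bot := strictMono_nat_of_lt_succ fun n => by
    simp only [Function.iterate_succ_apply']
    exact (E.covBy_succ _).lt
  have hmono' : StrictMono fun n => E'.succ^[n] E'.bot := strictMono_nat_of_lt_succ fun n => by
    simp only [Function.iterate_succ_apply']
    exact (E'.covBy_succ _).lt
  refine ⟨range fun n => (E.succ^[n] E.bot, E'.succ^[n] E'.bot), countable_range _, ⟨0, rfl⟩,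
    ?_, ?_, ?_⟩
  · rintro _ _ ⟨n, hn⟩
    obtain ⟨rfl, rfl⟩ := Prod.mk.inj hn
    exact ⟨n + 1, by simp only [Function.iterate_succ_apply']⟩
  · rintro _ _ ⟨n, hn⟩
    obtain ⟨rfl, rfl⟩ := Prod.mk.inj hn
    rcases n with _ | n
    · exact ⟨0, by simp [pred_bot]⟩
    · exact ⟨n, by simp only [Function.iterate_succ_apply', pred_succ]⟩
  · rintro _ _ _ _ ⟨n, hn⟩ ⟨n', hn'⟩
    obtain ⟨rfl, rfl⟩ := Prod.mk.inj hn
    obtain ⟨rfl, rfl⟩ := Prod.mk.inj hn'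
    exact (hmono.lt_iff_lt (a := n) (b := n')).trans (hmono'.lt_iff_lt (a := n) (b := n')).symm

lemma exists_partialIsoSet_of_chain {c : Set (Set (D × D'))} (hc : c.Countable)
    (hchain : IsChain (· ⊆ ·) c) (hgood : ∀ p ∈ c, PartialIsoSet E E' p) :
    ∃ q, PartialIsoSet E E' q ∧ ∀ p ∈ c, p ⊆ q := by
  rcases c.eq_empty_or_nonempty with rfl | ⟨p₀, hp₀⟩
  · obtain ⟨q, hq⟩ := exists_partialIsoSet E E'
    exact ⟨q, hq, by simp⟩
  refine ⟨⋃₀ c, ⟨?_, ?_, ?_, ?_, ?_⟩, fun p hp => subset_sUnion_of_mem hp⟩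
  · exact hc.sUnion fun p hp => (hgood p hp).countable
  · exact ⟨p₀, hp₀, (hgood p₀ hp₀).bot_mem⟩
  · rintro a b ⟨p, hp, hab⟩
    exact ⟨p, hp, (hgood p hp).succ_mem a b hab⟩
  · rintro a b ⟨p, hp, hab⟩
    exact ⟨p, hp, (hgood p hp).pred_mem a b hab⟩
  · rintro a b a' b' ⟨p, hp, hab⟩ ⟨p', hp', hab'⟩
    rcases hchain.total hp hp' with h | h
    · exact (hgood p' hp').lt_iff _ _ _ _ (h hab) hab'
    · exact (hgood p hp).lt_iff _ _ _ _ hab (h hab')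

theorem nonempty_orderIso (E : BackForthData D) (E' : BackForthData D') : Nonempty (D ≃o D') := by
  obtain ⟨F, hmono, hF⟩ := exists_monotone_meeting (Good := PartialIsoSet E E')
    (fun c hc hchain hgood => exists_partialIsoSet_of_chain hc hchain hgood)
    (R := fun i q => (∃ y, (E.gen i, y) ∈ q) ∧ ∃ x, (x, E'.gen i) ∈ q) (by
      intro i p hp
      obtain ⟨q, hpq, hq, y, hy⟩ := hp.exists_extension (E.gen i)
      obtain ⟨q', hqq', hq', x, hx⟩ := hq.swap.exists_extension (E'.gen i)
      exact ⟨Prod.swap ⁻¹' q', fun u hu => hqq' (a := u.swap) (hpq hu), hq'.swap,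
        ⟨y, hqq' (a := (y, E.gen i)) hy⟩, x, hx⟩)
  have hdom : ∀ x, ∃ y i, (x, y) ∈ F i := by
    intro x
    refine E.mem_of_gen {x | ∃ y i, (x, y) ∈ F i} ?_ ?_ ?_ x
    · rintro x ⟨y, i, h⟩
      exact ⟨_, i, (hF i).1.succ_mem x y h⟩
    · rintro x ⟨y, i, h⟩
      exact ⟨_, i, (hF i).1.pred_mem x y h⟩
    · exact fun i => (hF i).2.1.imp fun y hy => ⟨i, hy⟩
  have hran : ∀ y, ∃ x i, (x, y) ∈ F i := by
    intro y
    refine E'.mem_of_gen {y | ∃ x i, (x, y) ∈ F i} ?_ ?_ ?_ y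
    · rintro y ⟨x, i, h⟩
      exact ⟨_, i, (hF i).1.succ_mem x y h⟩
    · rintro y ⟨x, i, h⟩
      exact ⟨_, i, (hF i).1.pred_mem x y h⟩
    · exact fun i => (hF i).2.2.imp fun x hx => ⟨i, hx⟩
  have hlt : ∀ a b a' b' i j, (a, b) ∈ F i → (a', b') ∈ F j → (a < a' ↔ b < b') := by
    intro a b a' b' i j h h'
    exact (hF (max i j)).1.lt_iff _ _ _ _ (hmono (le_max_left i j) h) (hmono (le_max_right i j) h')
  choose f i hf using hdom
  have hstrict : StrictMono f := fun a b hab => (hlt _ _ _ _ _ _ (hf a) (hf b)).1 hab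
  refine ⟨hstrict.orderIsoOfSurjective f fun y => ?_⟩
  obtain ⟨x, j, hxy⟩ := hran y
  refine ⟨x, le_antisymm ?_ ?_⟩
  · exact not_lt.1 fun h => lt_irrefl x ((hlt _ _ _ _ _ _ hxy (hf x)).2 h)
  · exact not_lt.1 fun h => lt_irrefl x ((hlt _ _ _ _ _ _ (hf x) hxy).2 h)

end BackForthData

/-! ### Clones above the clone of a filter -/

namespace NatClone

variable {C C' : NatClone} {n : ℕ} {U : Filter ℕ}

lemma belowMax_subset (hC : ofFilter U ≤ C) {g : (Fin (n + 1) → ℕ) → ℕ} (hg : g ∈ belowMax n) :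
    g ∈ C.ops n := hC n fun _ hD => hD n (Or.inl hg)

lemma nextIn_mem (hC : ofFilter U ≤ C) {A : Set ℕ} (hA : A ∈ U) :
    (fun x : Fin 1 → ℕ => nextIn A (x 0)) ∈ C.ops 0 :=
  hC 0 fun _ hD => hD 0 (Or.inr ⟨rfl, A, hA, fun _ => rfl⟩)

/-- An operation `g` lies in a clone if it is bounded by an operation `φ` of the clone: apply
to `x` and `φ x` an operation bounded by the maximum. -/
lemma mem_of_le (hC : ofFilter U ≤ C) {φ g : (Fin (n + 1) → ℕ) → ℕ} (hφ : φ ∈ C.ops n)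
    (hg : ∀ x, g x ≤ φ x) : g ∈ C.ops n := by
  let b : (Fin (n + 1 + 1) → ℕ) → ℕ := fun y => min (g fun i => y i.castSucc) (Finset.univ.sup y)
  have hb : b ∈ C.ops (n + 1) := belowMax_subset hC fun y => min_le_right _ _
  have h := C.comp_mem (n + 1) n b hb
    (fun i x => Fin.lastCases (motive := fun _ => ℕ) (φ x) (fun j => x j) i) (fun i => by
      induction i using Fin.lastCases with
      | last => simpa using hφ
      | cast j => simpa using C.proj_mem n j)
  convert h using 1
  ext x
  simp only [b, Fin.lastCases_castSucc]
  refine (min_eq_left ((hg x).trans ?_)).symm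
  have := Finset.le_sup (f := fun i : Fin (n + 1 + 1) =>
    Fin.lastCases (motive := fun _ => ℕ) (φ x) (fun j => x j) i)
    (Finset.mem_univ (Fin.last (n + 1)))
  simpa using this

/-- The growth function `f`, as a unary operation, belongs to the clone. -/
def HasGrowth (C : NatClone) (f : GrowthFunction) : Prop :=
  (fun x : Fin 1 → ℕ => f.toFun (x 0)) ∈ C.ops 0

lemma max_mem (hC : ofFilter U ≤ C) {f g : (Fin (n + 1) → ℕ) → ℕ} (hf : f ∈ C.ops n)
    (hg : g ∈ C.ops n) : (fun x => max (f x) (g x)) ∈ C.ops n := by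
  have hmax : (fun y : Fin 2 → ℕ => max (y 0) (y 1)) ∈ C.ops 1 := belowMax_subset hC fun y =>
    max_le (Finset.le_sup (Finset.mem_univ 0)) (Finset.le_sup (Finset.mem_univ 1))
  exact C.comp_mem 1 n _ hmax ![f, g] fun i => by fin_cases i <;> assumption

lemma iterate_mem {φ : ℕ → ℕ} (h : (fun x : Fin 1 → ℕ => φ (x 0)) ∈ C.ops 0) (k : ℕ) :
    (fun x : Fin 1 → ℕ => φ^[k] (x 0)) ∈ C.ops 0 := by
  induction k with
  | zero => exact C.proj_mem 0 0
  | succ k ih =>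
    simp only [Function.iterate_succ_apply']
    exact C.comp_mem 0 0 _ h (fun _ x => φ^[k] (x 0)) fun _ => ih

lemma HasGrowth.of_growthLE (hC : ofFilter U ≤ C) {f g : GrowthFunction} {A : Set ℕ} (hA : A ∈ U)
    (hfg : GrowthLE A f g) (hg : C.HasGrowth g) : C.HasGrowth f := by
  obtain ⟨k, hk⟩ := hfg
  exact mem_of_le hC (iterate_mem (φ := g.maxNext A) (max_mem hC hg (nextIn_mem hC hA)) k)
    fun x => hk (x 0)

lemma hasGrowth_succFun (hC : ofFilter U ≤ C) (hU : ∀ A ∈ U, A.Infinite) :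
    C.HasGrowth GrowthFunction.succFun :=
  mem_of_le hC (nextIn_mem hC univ_mem) fun x => (nextIn_spec (hU _ univ_mem) (x 0)).2

/-- The least growth function that bounds an operation in terms of the largest argument. -/
def bound (g : (Fin (n + 1) → ℕ) → ℕ) : GrowthFunction where
  toFun m := max (m + 1) ((Fintype.piFinset fun _ => Finset.range (m + 1)).sup g)
  mono _ _ hab := max_le_max (Nat.succ_le_succ hab) (Finset.sup_mono
    (Fintype.piFinset_subset _ _ fun _ => Finset.range_mono (Nat.succ_le_succ hab)))
  lt_apply m := (Nat.lt_succ_self m).trans_le (le_max_left _ _)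

lemma le_bound (g : (Fin (n + 1) → ℕ) → ℕ) {m : ℕ} {x : Fin (n + 1) → ℕ} (hx : ∀ i, x i ≤ m) :
    g x ≤ (bound g).toFun m :=
  (Finset.le_sup (f := g) (Fintype.mem_piFinset.2 fun i =>
    Finset.mem_range_succ_iff.2 (hx i))).trans (le_max_right _ _)

lemma bound_le {g : (Fin (n + 1) → ℕ) → ℕ} {m c : ℕ} (hc : m < c)
    (h : ∀ x, (∀ i, x i ≤ m) → g x ≤ c) : (bound g).toFun m ≤ c :=
  max_le hc (Finset.sup_le fun x hx => h x fun i =>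
    Finset.mem_range_succ_iff.1 (Fintype.mem_piFinset.1 hx i))

/-- A clone in the interval is determined by the growth functions that belong to it. -/
lemma hasGrowth_bound_iff (hC : ofFilter U ≤ C) (hU : ∀ A ∈ U, A.Infinite)
    {g : (Fin (n + 1) → ℕ) → ℕ} : C.HasGrowth (bound g) ↔ g ∈ C.ops n := by
  constructor
  · intro h
    have hsup : (fun x : Fin (n + 1) → ℕ => Finset.univ.sup x) ∈ C.ops n :=
      belowMax_subset hC fun _ => le_rfl
    exact mem_of_le hC (C.comp_mem 0 n _ h (fun _ x => Finset.univ.sup x) fun _ => hsup)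
      fun x => le_bound g fun i => Finset.le_sup (Finset.mem_univ i)
  · intro hg
    -- For every `m` choose arguments at most `m` at which `g` is largest.
    have hex : ∀ m : ℕ, ∃ x : Fin (n + 1) → ℕ, (∀ i, x i ≤ m) ∧
        (Fintype.piFinset fun _ : Fin (n + 1) => Finset.range (m + 1)).sup g = g x := by
      intro m
      obtain ⟨x, hx, h⟩ := Finset.exists_mem_eq_sup
        (Fintype.piFinset fun _ : Fin (n + 1) => Finset.range (m + 1))
        ⟨fun _ => 0, Fintype.mem_piFinset.2 fun _ => by simp⟩ g
      exact ⟨x, fun i => Finset.mem_range_succ_iff.1 (Fintype.mem_piFinset.1 hx i), h⟩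
    choose x hx hgx using hex
    have hcomp := C.comp_mem n 0 g hg (fun i y => x (y 0) i) fun i =>
      belowMax_subset hC fun y => (hx (y 0) i).trans (Finset.le_sup (Finset.mem_univ 0))
    refine mem_of_le hC (max_mem hC (hasGrowth_succFun hC hU) hcomp) fun y => ?_
    exact max_le_max le_rfl (hgx (y 0)).le

/-! ### The interval of clones and the Dedekind completion -/

section Interval

variable {D : Type*} [LinearOrder D] {q : GrowthFunction → D}

lemma class_le_of_le (hq : ∀ f g, q f ≤ q g ↔ ∃ A ∈ U, GrowthLE A f g) {f g : GrowthFunction}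
    (h : ∀ m, f.toFun m ≤ g.toFun m) : q f ≤ q g :=
  (hq f g).2 ⟨univ, univ_mem, 1, fun m => (h m).trans (le_max_left _ _)⟩

lemma class_bound_unary (hq : ∀ f g, q f ≤ q g ↔ ∃ A ∈ U, GrowthLE A f g) (f : GrowthFunction) :
    q (bound fun x : Fin 1 → ℕ => f.toFun (x 0)) = q f :=
  le_antisymm (class_le_of_le hq fun m => bound_le (f.lt_apply m) fun _ hx => f.mono (hx 0))
    (class_le_of_le hq fun m => le_bound (fun x : Fin 1 → ℕ => f.toFun (x 0)) (x := fun _ => m)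
      fun _ => le_rfl)

lemma iterate_maxNext_anti (hU : ∀ A ∈ U, A.Infinite) (P : GrowthFunction) {A B : Set ℕ}
    (hA : A ∈ U) (hAB : A ⊆ B) (k m : ℕ) : (P.maxNext B)^[k] m ≤ (P.maxNext A)^[k] m :=
  (P.maxNext_mono (hU A hA |>.mono hAB)).iterate_le_of_le
    (fun i => max_le_max le_rfl (nextIn_anti (hU A hA) hAB i)) k m

/-- The class of a composition is at most the largest of the classes of its constituents. -/
lemma class_bound_comp_le (hU : ∀ A ∈ U, A.Infinite)
    (hq : ∀ f g, q f ≤ q g ↔ ∃ A ∈ U, GrowthLE A f g) {k : ℕ} {f : (Fin (k + 1) → ℕ) → ℕ}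
    {g : Fin (k + 1) → (Fin (n + 1) → ℕ) → ℕ} {P : GrowthFunction} (hf : q (bound f) ≤ q P)
    (hg : ∀ i, q (bound (g i)) ≤ q P) : q (bound fun x => f fun i => g i x) ≤ q P := by
  simp only [hq] at hf hg ⊢
  obtain ⟨A, hA, a, ha⟩ := hf
  choose B hB b hb using hg
  have hBU : (⋂ i, B i) ∈ U := iInter_mem.2 hB
  have hEU := inter_mem hA hBU
  have hmono := P.maxNext_mono (hU _ hEU)
  have hE : ∀ i m, (bound (g i)).toFun m ≤
      (P.maxNext (A ∩ ⋂ i, B i))^[Finset.univ.sup b] m := fun i m =>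
    ((hb i m).trans (iterate_maxNext_anti hU P hEU
      (inter_subset_right.trans (iInter_subset B i)) (b i) m)).trans
      (P.iterate_maxNext_le_of_le _ (Finset.le_sup (Finset.mem_univ i)) m)
  refine ⟨A ∩ ⋂ i, B i, hEU, a + Finset.univ.sup b, fun m => bound_le ?_ fun x hx => ?_⟩
  · have h1 : m < (bound (g 0)).toFun m := (bound (g 0)).lt_apply m
    exact (h1.trans_le (hE 0 m)).trans_le
      (P.iterate_maxNext_le_of_le _ (Nat.le_add_left _ _) m)
  · refine (le_bound f (m := (P.maxNext (A ∩ ⋂ i, B i))^[Finset.univ.sup b] m)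
      fun i => (le_bound (g i) hx).trans (hE i m)).trans ?_
    change _ ≤ (P.maxNext (A ∩ ⋂ i, B i))^[a + Finset.univ.sup b] m
    rw [Function.iterate_add_apply]
    exact (ha _).trans (iterate_maxNext_anti hU P hEU inter_subset_left a _)

lemma class_bound_le_of_mem_belowMax (hq : ∀ f g, q f ≤ q g ↔ ∃ A ∈ U, GrowthLE A f g)
    {g : (Fin (n + 1) → ℕ) → ℕ} (hg : g ∈ belowMax n) (f : GrowthFunction) :
    q (bound g) ≤ q f :=
  class_le_of_le hq fun m => bound_le (f.lt_apply m) fun x hx =>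
    ((hg x).trans (Finset.sup_le fun i _ => hx i)).trans (f.lt_apply m).le

lemma class_bound_le_of_mem_nextOps (hU : ∀ A ∈ U, A.Infinite)
    (hq : ∀ f g, q f ≤ q g ↔ ∃ A ∈ U, GrowthLE A f g)
    {g : (Fin (n + 1) → ℕ) → ℕ} (hg : g ∈ nextOps U n) (f : GrowthFunction) :
    q (bound g) ≤ q f := by
  obtain ⟨-, A, hA, hgA⟩ := hg
  refine (hq _ _).2 ⟨A, hA, 1, fun m => ?_⟩
  refine bound_le ((f.lt_apply m).trans_le (le_max_left _ _)) fun x hx => ?_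
  rw [hgA]
  exact (nextIn_mono (hU A hA) (hx 0)).trans (le_max_right _ _)

/-- The operations whose bound has its class in a given initial segment form a clone. -/
def ofLowerSet (hU : ∀ A ∈ U, A.Infinite) (hsurj : Function.Surjective q)
    (hq : ∀ f g, q f ≤ q g ↔ ∃ A ∈ U, GrowthLE A f g) (L : LowerSet D)
    (hL : (L : Set D).Nonempty) : NatClone where
  ops _ := {g | q (bound g) ∈ L}
  proj_mem k i := by
    obtain ⟨d, hd⟩ := hL
    obtain ⟨f, rfl⟩ := hsurj d
    exact L.lower (class_bound_le_of_mem_belowMax hq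
      (fun x => Finset.le_sup (f := x) (Finset.mem_univ i)) f) hd
  comp_mem k n f hf g hg := by
    obtain ⟨i, hi⟩ := Finite.exists_max fun i => q (bound (g i))
    rcases le_total (q (bound f)) (q (bound (g i))) with h | h
    · exact L.lower (class_bound_comp_le hU hq h hi) (hg i)
    · exact L.lower (class_bound_comp_le hU hq le_rfl fun j => (hi j).trans h) hf

lemma ofFilter_le_ofLowerSet (hU : ∀ A ∈ U, A.Infinite) (hsurj : Function.Surjective q)
    (hq : ∀ f g, q f ≤ q g ↔ ∃ A ∈ U, GrowthLE A f g) (L : LowerSet D)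
    (hL : (L : Set D).Nonempty) : ofFilter U ≤ ofLowerSet hU hsurj hq L hL := by
  refine fun k g hg => hg _ fun n g hg => ?_
  obtain ⟨d, hd⟩ := hL
  obtain ⟨f, rfl⟩ := hsurj d
  rcases hg with hg | hg
  · exact L.lower (class_bound_le_of_mem_belowMax hq hg f) hd
  · exact L.lower (class_bound_le_of_mem_nextOps hU hq hg f) hd

/-- If growth functions modulo the filter are linearly ordered, then a clone above the clone of the
filter is the same as a nonempty initial segment of classes of growth functions. -/
theorem nonempty_interval_orderIso (hU : ∀ A ∈ U, A.Infinite) (hsurj : Function.Surjective q)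
    (hq : ∀ f g, q f ≤ q g ↔ ∃ A ∈ U, GrowthLE A f g) :
    Nonempty (Set.Icc (ofFilter U) full ≃o DedekindCompletion D) := by
  let Φ : Set.Icc (ofFilter U) full → DedekindCompletion D := fun C =>
    ⟨⟨{d | ∃ f, q f = d ∧ C.1.HasGrowth f}, by
      rintro _ e hed ⟨f, rfl, hf⟩
      obtain ⟨g, rfl⟩ := hsurj e
      obtain ⟨A, hA, hgf⟩ := (hq g f).1 hed
      exact ⟨g, rfl, hf.of_growthLE C.2.1 hA hgf⟩⟩,
      ⟨_, _, rfl, hasGrowth_succFun C.2.1 hU⟩⟩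
  have hmem : ∀ C f, q f ∈ (Φ C).1 ↔ C.1.HasGrowth f := by
    intro C f
    refine ⟨?_, fun h => ⟨f, rfl, h⟩⟩
    rintro ⟨g, hgf, hg⟩
    obtain ⟨A, hA, hfg⟩ := (hq f g).1 hgf.ge
    exact hg.of_growthLE C.2.1 hA hfg
  have hle : ∀ C C', Φ C ≤ Φ C' ↔ C ≤ C' := by
    intro C C'
    constructor
    · intro h k g hg
      rw [← hasGrowth_bound_iff C'.2.1 hU, ← hmem]
      rw [← hasGrowth_bound_iff C.2.1 hU, ← hmem] at hg
      exact h hg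
    · rintro h _ ⟨f, rfl, hf⟩
      exact ⟨f, rfl, h 0 hf⟩
  refine ⟨OrderIso.ofSurjective (OrderEmbedding.ofMapLEIff Φ hle) ?_⟩
  rintro ⟨L, hL⟩
  refine ⟨⟨ofLowerSet hU hsurj hq L hL, ofFilter_le_ofLowerSet hU hsurj hq L hL,
    fun _ _ _ => trivial⟩, Subtype.ext (SetLike.ext fun d => ?_)⟩
  obtain ⟨f, rfl⟩ := hsurj d
  refine (hmem _ f).trans ?_
  change q (bound fun x : Fin 1 → ℕ => f.toFun (x 0)) ∈ L ↔ q f ∈ L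
  rw [class_bound_unary hq]

end Interval

end NatClone

/-! ### The length of the sequence and the number of growth functions -/

lemma exists_upper_bound_Iio_omega_one (u : ℕ → Set.Iio (Ordinal.omega 1 : Ordinal.{0})) :
    ∃ j, ∀ n, u n ≤ j := by
  have h : ⨆ n, (u n).1 < Ordinal.omega 1 := Ordinal.iSup_lt_omega_one fun n => (u n).2
  exact ⟨⟨_, h⟩, fun n => Ordinal.le_iSup (fun n => (u n).1) n⟩

instance : Nonempty (Set.Iio (Ordinal.omega 1 : Ordinal.{0})) :=
  ⟨⟨0, Ordinal.omega_pos 1⟩⟩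

lemma mk_growthFunction_le : #GrowthFunction ≤ 𝔠 := by
  have h : Function.Injective GrowthFunction.toFun := by
    rintro ⟨f, _, _⟩ ⟨g, _, _⟩ rfl
    rfl
  refine (mk_le_of_injective h).trans ?_
  simp

end CloneZoo

theorem mainTheorem3 (hCH : (ℵ₁ : Cardinal.{0}) = 𝔠) {N : Type*}
    (s : Set.Iio (Ordinal.omega 1 : Ordinal.{0}) → CloneZoo.Zoo N)
    (hs : CloneZoo.SufficientlyGeneric s) :
    ∃ (D₂ : Type) (_ : LinearOrder D₂),
      (CloneZoo.IsD2 D₂ ∧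
        ∀ (D : Type*) [LinearOrder D], CloneZoo.IsD2 D → Nonempty (D ≃o D₂)) ∧
      ∃ hU : ∀ A ∈ CloneZoo.extFilter s, A.Infinite,
        (∃ V : Ultrafilter ℕ, (V : Filter ℕ) = CloneZoo.extFilter s ⊓ Filter.cofinite) ∧
        Nonempty (CloneZoo.FrontClasses s ≃o D₂) ∧
        Nonempty
          (Antisymmetrization (CloneZoo.GrowthMod (CloneZoo.extFilter s) hU) (· ≤ ·) ≃o D₂) ∧
        Nonempty
          (Set.Icc (CloneZoo.NatClone.ofFilter (CloneZoo.extFilter s)) CloneZoo.NatClone.full ≃o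
            CloneZoo.DedekindCompletion D₂) := by
  have hU := CloneZoo.infinite_of_mem_extFilter hs
  let Q := Antisymmetrization (CloneZoo.GrowthMod (CloneZoo.extFilter s) hU) (· ≤ ·)
  let inst : LinearOrder Q := CloneZoo.growthLinearOrder hs hU
  obtain ⟨φ⟩ := CloneZoo.nonempty_frontMap hs hU
  have hI := CloneZoo.exists_upper_bound_Iio_omega_one
  have hcard : #Q ≤ ℵ₁ :=
    (mk_quotient_le (α := CloneZoo.GrowthFunction)).trans
      (CloneZoo.mk_growthFunction_le.trans_eq hCH.symm)
  have hD2 : CloneZoo.IsD2 Q := CloneZoo.isD2_of_interpolation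
    ((φ.exists_isBot hs).imp' _ fun _ h => h)
    (φ.exists_succ hs) (φ.exists_pred hs) hcard (φ.exists_between hs hI)
  refine ⟨Q, inst, ⟨hD2, fun D _ hD => ?_⟩, hU, CloneZoo.exists_ultrafilter_eq hs,
    φ.nonempty_orderIso hs, ⟨OrderIso.refl Q⟩, ?_⟩
  · obtain ⟨E⟩ := hD.nonempty_backForthData
    obtain ⟨E'⟩ := hD2.nonempty_backForthData
    exact E.nonempty_orderIso E'
  · exact CloneZoo.NatClone.nonempty_interval_orderIso hU
      (q := fun f => toAntisymmetrization
        (α := CloneZoo.GrowthMod (CloneZoo.extFilter s) hU) (· ≤ ·) f)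
      (fun d => Quotient.inductionOn d fun f => ⟨f, rfl⟩) fun _ _ => Iff.rfl
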